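/- Let $\mathbf T$ be an essentially small site with enough points and let $\mathbf{sPre}$ be the category of simplicial presheaves on $\mathbf T$. The projective model structure on $\mathbf{sPre}$ has the objectwise weak equivalences as weak equivalences and the objectwise Kan fibrations as fibrations; the injective model structure has the objectwise weak equivalences as weak equivalences and the monomorphisms as cofibrations. The local projective (local injective) model structure is the left Bousfield localization of the projective (injective) one at the maps $\operatorname{hocolim}\mathcal U_*\to X$, where $X$ runs through the objects of $\mathbf T$ and $\mathcal U\to X$ through the hypercovers of $X$. For any of these model structures, the homotopy pullback of a diagram $\mathcal X\xrightarrow{f}\mathcal Z\xleftarrow{g}\mathcal Y$ is $\mathcal E(f)\times_{\mathcal Z}\mathcal E(g)$, where $\mathcal X\to\mathcal E(f)\to\mathcal Z$ and $\mathcal Y\to\mathcal E(g)\to\mathcal Z$ are factorizations of $f$ and $g$ into an acyclic cofibration followed by a fibration. Let $\mathcal X\xrightarrow{f}\mathcal Z\xleftarrow{g}\mathcal Y$ be a diagram in $\mathbf{sPre}$. Then the homotopy pullback of the diagram in the projective model structure is stalkwise weakly equivalent to its homotopy pullback in the local projective model structure. More precisely, let $\mathcal E^{\mathrm{proj}}(f),\mathcal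 E^{\mathrm{proj}}(g)$ and $\mathcal E^{\mathrm{loc}}(f),\mathcal E^{\mathrm{loc}}(g)$ come from any such factorizations in the two model structures. Then there are maps $a\colon\mathcal E^{\mathrm{proj}}(f)\to\mathcal E^{\mathrm{loc}}(f)$ under $\mathcal X$ and over $\mathcal Z$, and $b\colon\mathcal E^{\mathrm{proj}}(g)\to\mathcal E^{\mathrm{loc}}(g)$ under $\mathcal Y$ and over $\mathcal Z$; and for all such $a$ and $b$ the induced map $$\mathcal E^{\mathrm{proj}}(f)\times_{\mathcal Z}\mathcal E^{\mathrm{proj}}(g)\longrightarrow\mathcal E^{\mathrm{loc}}(f)\times_{\mathcal Z}\mathcal E^{\mathrm{loc}}(g)$$ induces a weak equivalence of simplicial sets on the stalks at every point of $\mathbf T$. The same holds with the injective and local injective model structures in place of the projective and local projective ones. -/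

import Mathlib

/-! # Simplicial presheaves: global and local model structures, homotopy pullbacks -/

open CategoryTheory Limits Opposite MonoidalCategory Simplicial

universe w v u

noncomputable section

namespace SimplicialPresheaf

/-! ## Simplicial sets -/

/-- A map `f : X ⟶ Y` of simplicial sets is a *Kan fibration* if it has the right lifting property
with respect to all horn inclusions `Λ[n, k] ⟶ Δ[n]`, `n ≥ 1`, `0 ≤ k ≤ n`. -/
def kanFibrations : MorphismProperty SSet.{w} := SSet.modelCategoryQuillen.J.rlp

/-- A map `f : X ⟶ Y` of simplicial sets is a *weak (homotopy) equivalence* if for every Kan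
complex `K` composition with `f` induces a bijection `[Y, K] → [X, K]` of (simplicial) homotopy
classes of maps: every `a : X ⟶ K` extends along `f` up to homotopy, and two maps `Y ⟶ K` that
become homotopic after composition with `f` are homotopic. (Homotopy of maps into a Kan complex
is an equivalence relation.) These are the weak equivalences of the standard (Kan–Quillen) model
structure. -/
def kanWeakEquivalences : MorphismProperty SSet.{w} := fun X Y f ↦
  ∀ (K : SSet.{w}) [SSet.KanComplex K],
    (∀ a : X ⟶ K, ∃ b : Y ⟶ K, Nonempty (SSet.Homotopy (f ≫ b) a)) ∧
    (∀ b b' : Y ⟶ K, Nonempty (SSet.Homotopy (f ≫ b) (f ≫ b')) → Nonempty (SSet.Homotopy b b'))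

/-! ## Simplicial presheaves and the projective and injective classes of maps -/

variable (C : Type u) [Category.{v} C]

/-- The category of simplicial presheaves on `C`. -/
abbrev SPre := Cᵒᵖ ⥤ SSet.{w}

/-- Objectwise weak equivalences. -/
def objectwiseWeakEquivalences : MorphismProperty (SPre.{w} C) :=
  fun _ _ f ↦ ∀ X : Cᵒᵖ, kanWeakEquivalences (f.app X)

/-- Projective fibrations: objectwise Kan fibrations. -/
def projectiveFibrations : MorphismProperty (SPre.{w} C) :=
  fun _ _ f ↦ ∀ X : Cᵒᵖ, kanFibrations (f.app X)

/-- Projective cofibrations: maps with the left lifting property with respect to all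
projective fibrations that are objectwise weak equivalences. -/
def projectiveCofibrations : MorphismProperty (SPre.{w} C) :=
  (projectiveFibrations C ⊓ objectwiseWeakEquivalences C).llp

/-- Acyclic cofibrations of the projective model structure. -/
def projectiveAcyclicCofibrations : MorphismProperty (SPre.{w} C) :=
  projectiveCofibrations C ⊓ objectwiseWeakEquivalences C

/-- Injective cofibrations: monomorphisms, that is, objectwise monomorphisms. -/
def injectiveCofibrations : MorphismProperty (SPre.{w} C) :=
  fun _ _ f ↦ ∀ X : Cᵒᵖ, Mono (f.app X)

/-- Acyclic cofibrations of the injective model structure. -/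
def injectiveAcyclicCofibrations : MorphismProperty (SPre.{w} C) :=
  injectiveCofibrations C ⊓ objectwiseWeakEquivalences C

/-- Injective fibrations: maps with the right lifting property with respect to all
injective cofibrations that are objectwise weak equivalences. -/
def injectiveFibrations : MorphismProperty (SPre.{w} C) :=
  (injectiveAcyclicCofibrations C).rlp

/-! ## Mapping spaces -/

variable {C}

/-- The simplicial mapping space `Map(F, W)` of simplicial presheaves, with set of `n`-simplices
`Hom(F × Δ[n], W)`, where `Δ[n]` is regarded as a constant simplicial presheaf. -/
def mapSpace (F W : SPre.{w} C) : SSet.{max u w} :=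
  (SSet.stdSimplex.{w} ⋙ Functor.const Cᵒᵖ ⋙ tensorLeft F).op ⋙ yoneda.obj W

/-- The map `Map(G, W) ⟶ Map(F, W)` of mapping spaces induced by `f : F ⟶ G`. -/
def mapSpacePrecomp {F G : SPre.{w} C} (f : F ⟶ G) (W : SPre.{w} C) :
    mapSpace G W ⟶ mapSpace F W :=
  Functor.whiskerRight (NatTrans.op (Functor.whiskerLeft (SSet.stdSimplex.{w} ⋙ Functor.const Cᵒᵖ)
    ((curriedTensor (SPre.{w} C)).map f))) (yoneda.obj W)

/-- Projectively cofibrant simplicial presheaves. -/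
def IsProjectiveCofibrant (F : SPre.{w} C) : Prop :=
  projectiveCofibrations C (initial.to F)

/-- Projectively fibrant simplicial presheaves: all values are Kan complexes. -/
def IsProjectiveFibrant (F : SPre.{w} C) : Prop :=
  ∀ X : Cᵒᵖ, SSet.KanComplex (F.obj X)

/-- For a projectively fibrant `W`, this says that `f` induces a weak equivalence of homotopy
function complexes (derived mapping spaces) from `B` to `W` and from `A` to `W`: whenever
`f' : A' ⟶ B'` is a cofibrant approximation of `f : A ⟶ B` in the projective model structure, the
map `Map(B', W) ⟶ Map(A', W)` is a weak equivalence of simplicial sets. -/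
def InducesDerivedMapEquivalence (W : SPre.{w} C) {A B : SPre.{w} C} (f : A ⟶ B) : Prop :=
  ∀ ⦃A' B' : SPre.{w} C⦄ (f' : A' ⟶ B') (a : A' ⟶ A) (b : B' ⟶ B),
    IsProjectiveCofibrant A' → IsProjectiveCofibrant B' →
    objectwiseWeakEquivalences C a → objectwiseWeakEquivalences C b →
    f' ≫ b = a ≫ f → kanWeakEquivalences (mapSpacePrecomp f' W)

/-! ## Hypercovers and the local classes of maps -/

/-- Local acyclic fibrations `f : F ⟶ G`: for every object `X`, every commutative square from
`∂Δ[n] ⟶ Δ[n]` to `F(X) ⟶ G(X)` (equivalently, from `∂Δ[n] ⊗ X ⟶ Δ[n] ⊗ X` to `F ⟶ G`) acquires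
a lifting `Δ[n] ⟶ F(U)` after restriction along any member `U ⟶ X` of a suitable covering sieve
of `X`. -/
def IsLocalAcyclicFibration (J : GrothendieckTopology C) {F G : SPre.{w} C} (f : F ⟶ G) : Prop :=
  ∀ (X : C) (n : ℕ) (s : (∂Δ[n] : SSet.{w}) ⟶ F.obj (op X)) (t : Δ[n] ⟶ G.obj (op X)),
    s ≫ f.app (op X) = ∂Δ[n].ι ≫ t →
    ∃ R ∈ J X, ∀ (U : C) (i : U ⟶ X), R i →
      ∃ l : Δ[n] ⟶ F.obj (op U),
        ∂Δ[n].ι ≫ l = s ≫ F.map i.op ∧ l ≫ f.app (op U) = t ≫ G.map i.op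

/-- The simplicial presheaf represented by `X`: the representable presheaf `Hom(-, X)`, regarded
as constant in the simplicial direction. -/
def representable [LocallySmall.{w} C] (X : C) : SPre.{w} C :=
  shrinkYoneda.{w}.obj X ⋙ SimplicialObject.const (Type w)

/-- A *hypercover* of `X` is a local acyclic fibration `p : U ⟶ X` of simplicial presheaves such
that each presheaf `U_n` is a coproduct of representables. -/
structure IsHypercover [LocallySmall.{w} C] (J : GrothendieckTopology C) {X : C} {U : SPre.{w} C}
    (p : U ⟶ representable X) : Prop where
  isLocalAcyclicFibration : IsLocalAcyclicFibration J p
  exists_iso_coproduct (n : ℕ) : ∃ (ι : Type w) (Y : ι → C),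
    Nonempty (U ⋙ (evaluation _ (Type w)).obj (op ⦋n⦌) ≅ ∐ fun i ↦ shrinkYoneda.{w}.obj (Y i))

/-- `W` is local with respect to the hypercovers: it is projectively fibrant and every hypercover
`U ⟶ X` induces a weak equivalence of homotopy function complexes into `W`.
The simplicial presheaf `U` is the homotopy colimit of the simplicial diagram `n ↦ U_n` of
(discrete) presheaves, so these are the local objects for the maps `hocolim U_* ⟶ X`. -/
def IsHypercoverLocal [LocallySmall.{w} C] (J : GrothendieckTopology C) (W : SPre.{w} C) : Prop :=
  IsProjectiveFibrant W ∧
    ∀ ⦃X : C⦄ ⦃U : SPre.{w} C⦄ (p : U ⟶ representable X), IsHypercover J p →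
      InducesDerivedMapEquivalence W p

/-- Local weak equivalences: the weak equivalences of the left Bousfield localization at the
hypercovers, i.e. the maps inducing weak equivalences of homotopy function complexes into all
hypercover-local objects. (Homotopy function complexes only depend on the class of objectwise weak
equivalences, so the localizations of the projective and of the injective model structure have the
same weak equivalences.) -/
def localWeakEquivalences [LocallySmall.{w} C] (J : GrothendieckTopology C) :
    MorphismProperty (SPre.{w} C) :=
  fun _ _ f ↦ ∀ W : SPre.{w} C, IsHypercoverLocal J W → InducesDerivedMapEquivalence W f

/-- Acyclic cofibrations of the local projective model structure; a left Bousfield localization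
does not change the cofibrations. -/
def localProjectiveAcyclicCofibrations [LocallySmall.{w} C] (J : GrothendieckTopology C) :
    MorphismProperty (SPre.{w} C) :=
  projectiveCofibrations C ⊓ localWeakEquivalences J

/-- Fibrations of the local projective model structure. -/
def localProjectiveFibrations [LocallySmall.{w} C] (J : GrothendieckTopology C) :
    MorphismProperty (SPre.{w} C) :=
  (localProjectiveAcyclicCofibrations J).rlp

/-- Acyclic cofibrations of the local injective model structure. -/
def localInjectiveAcyclicCofibrations [LocallySmall.{w} C] (J : GrothendieckTopology C) :
    MorphismProperty (SPre.{w} C) :=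
  injectiveCofibrations C ⊓ localWeakEquivalences J

/-- Fibrations of the local injective model structure. -/
def localInjectiveFibrations [LocallySmall.{w} C] (J : GrothendieckTopology C) :
    MorphismProperty (SPre.{w} C) :=
  (localInjectiveAcyclicCofibrations J).rlp

/-! ## Stalks -/

/-- Stalkwise weak equivalences: maps inducing weak equivalences of simplicial sets on the stalks
at all points of the site. -/
def stalkwiseWeakEquivalences (J : GrothendieckTopology C) : MorphismProperty (SPre.{w} C) :=
  fun _ _ f ↦ ∀ x : GrothendieckTopology.Point.{w} J,
    kanWeakEquivalences (x.presheafFiber.map f)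

/-! ## Homotopy pullbacks -/

section

variable {X Y Z : SPre.{w} C} {f : X ⟶ Z} {g : Y ⟶ Z}
  {A B A' B' : MorphismProperty (SPre.{w} C)}

/-- The homotopy pullback of `f : X ⟶ Z` and `g : Y ⟶ Z` computed from factorizations
`X ⟶ E(f) ⟶ Z` and `Y ⟶ E(g) ⟶ Z` into an acyclic cofibration followed by a fibration:
the pullback of `E(f) ⟶ Z ⟵ E(g)`. -/
abbrev homotopyPullback (Ef : A.MapFactorizationData B f) (Eg : A.MapFactorizationData B g) :
    SPre.{w} C :=
  pullback Ef.p Eg.p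

/-- A comparison map `E(f) ⟶ E'(f)` between two factorizations of `f : X ⟶ Z`, under `X` and
over `Z`. -/
structure FactorizationMap (E : A.MapFactorizationData B f) (E' : A'.MapFactorizationData B' f) where
  hom : E.Z ⟶ E'.Z
  i_hom : E.i ≫ hom = E'.i
  hom_p : hom ≫ E'.p = E.p

/-- The map of homotopy pullbacks induced by comparison maps of the factorizations. -/
def homotopyPullbackMap {Ef : A.MapFactorizationData B f} {Eg : A.MapFactorizationData B g}
    {Ef' : A'.MapFactorizationData B' f} {Eg' : A'.MapFactorizationData B' g}
    (a : FactorizationMap Ef Ef') (b : FactorizationMap Eg Eg') :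
    homotopyPullback Ef Eg ⟶ homotopyPullback Ef' Eg' :=
  pullback.map Ef.p Eg.p Ef'.p Eg'.p a.hom b.hom (𝟙 Z)
    (by rw [a.hom_p, Category.comp_id]) (by rw [b.hom_p, Category.comp_id])

end

end SimplicialPresheaf

end

open SimplicialPresheaf

noncomputable section

namespace SimplicialPresheaf

open SSet SSet.modelCategoryQuillen

/-! ### Lifting homotopies -/

/-! The comparison map is tested on the stalk at one point `x`. The stalk functor is a filtered
colimit: it preserves pullbacks and, horns and simplices being finitely presentable, turns
objectwise Kan fibrations into Kan fibrations (`kanFibrations_presheafFiber_map`). The fibrations of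
all four model structures are objectwise Kan fibrations (`objectwise_kanFibrations_of_rlp`). A map
between two cospans of Kan fibrations over a fixed base whose components are weak equivalences
induces a weak equivalence of pullbacks (`kanWeakEquivalences_pullback_map`). So it suffices that
the comparison maps `a` and `b`, which exist by lifting, are weak equivalences on stalks; by
two-out-of-three this holds once objectwise and local weak equivalences are stalkwise weak
equivalences.

For local weak equivalences (`localWeakEquivalences_le_stalkwiseWeakEquivalences`), the skyscraper
presheaf of a Kan complex `K` is right adjoint to the stalk, so mapping into it amounts to mapping
the stalk into `K`. A hypercover is a trivial fibration on stalks, because liftings over a covering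
sieve become liftings in the stalk; hence skyscrapers of Kan complexes are hypercover-local. A local
weak equivalence therefore induces equivalences of mapping spaces from its stalks to every `K`,
which is what a weak equivalence of simplicial sets is.

The rest is simplicial homotopy theory, starting from weak equivalences defined by homotopy classes
of maps into Kan complexes. The point is that acyclic Kan fibrations are trivial fibrations and
acyclic monomorphisms are anodyne. Between Kan complexes this is a manipulation of homotopies and
internal homs. A general Kan fibration is a base change of one between Kan complexes, namely of the
tautological one over `kanUniverse`. That this universe is a Kan complex means that a Kan fibration
`X` over a horn extends to the simplex. With `ι` the horn inclusion and `r` a retraction up to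
homotopy, the extension is the fibre product of `r^* X` and `ι_* X` over `ι_* ι^* r^* X`
(`kanExtension`). -/

lemma anodyneExtensions_stdSimplex_δ (i : Fin 2) :
    anodyneExtensions.{w} (stdSimplex.δ i : Δ[0] ⟶ Δ[1]) := by
  intro E B p hp
  rw [fibrations_eq, ← fibration_iff] at hp
  refine ⟨fun {u v} sq ↦ ?_⟩
  -- The face omitting vertex `1 - j` is the vertex `j`, which is the horn `Λ[1, j]`.
  obtain ⟨j, rfl⟩ : ∃ j : Fin 2, i = 1 - j := ⟨1 - i, by fin_cases i <;> rfl⟩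
  have hf : horn.IsCompatible (n := 0) (i := j) (fun k (_ : k ≠ j) ↦ u) := by
    rw [horn.isCompatible_zero_iff_true]; trivial
  obtain ⟨φ, h₁, h₂⟩ := hf.exists_lift p v (fun k hk ↦ by
    obtain rfl : k = 1 - j := by fin_cases k <;> fin_cases j <;> simp_all
    exact sq.w)
  exact ⟨⟨φ, h₁ _ (by fin_cases j <;> simp), h₂⟩⟩

lemma stdSimplex_δ_eq_const (i : Fin 2) :
    (stdSimplex.δ (1 - i) : Δ[0] ⟶ Δ[1]) = const (stdSimplex.obj₀Equiv.{w}.symm i) := by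
  apply yonedaEquiv.injective
  apply stdSimplex.obj₀Equiv.injective
  fin_cases i <;> rfl

/-- The pushout-product of a monomorphism with an anodyne vertex inclusion is anodyne; the
compatible data `f` and `k` form a map out of its source. Keeping the vertex `e` arbitrary treats
both ends of `Δ[1]` at once. -/
lemma exists_homotopy_lift_of_anodyne {K L E B : SSet.{w}} (i : K ⟶ L) [Mono i] (p : E ⟶ B)
    (hp : kanFibrations p) {e : (Δ[1] : SSet.{w}) _⦋0⦌}
    (he : anodyneExtensions (const e : Δ[0] ⟶ Δ[1]))
    (f : L ⟶ E) (k : K ⊗ Δ[1] ⟶ E) (b : L ⊗ Δ[1] ⟶ B)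
    (h₁ : CartesianMonoidalCategory.lift (𝟙 K) (const e) ≫ k = i ≫ f)
    (h₂ : CartesianMonoidalCategory.lift (𝟙 L) (const e) ≫ b = f ≫ p)
    (h₃ : k ≫ p = i ▷ _ ≫ b) :
    ∃ h : L ⊗ Δ[1] ⟶ E, CartesianMonoidalCategory.lift (𝟙 L) (const e) ≫ h = f ∧
      i ▷ _ ≫ h = k ∧ h ≫ p = b := by
  let sq := Functor.PushoutObjObj.ofHasPushout (curriedTensor SSet.{w}) i
    (const e : Δ[0] ⟶ Δ[1])
  have hsq := anodyneExtensions_pushoutObjObjι sq he _ hp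
  have w₁ : i ▷ Δ[0] ≫ CartesianMonoidalCategory.fst L Δ[0] ≫ f =
      K ◁ (const e : Δ[0] ⟶ Δ[1]) ≫ k := by
    have : K ◁ (const e : Δ[0] ⟶ Δ[1]) = CartesianMonoidalCategory.fst K Δ[0] ≫
        CartesianMonoidalCategory.lift (𝟙 K) (const e) := rfl
    rw [this, Category.assoc, h₁]; rfl
  let l : sq.pt ⟶ E := sq.isPushout.desc (CartesianMonoidalCategory.fst _ _ ≫ f) k w₁
  have hl₁ : sq.inl ≫ l = CartesianMonoidalCategory.fst _ _ ≫ f := sq.isPushout.inl_desc _ _ _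
  have hl₂ : sq.inr ≫ l = k := sq.isPushout.inr_desc _ _ _
  have w₂ : l ≫ p = sq.ι ≫ b := by
    apply sq.isPushout.hom_ext
    · rw [reassoc_of% hl₁, sq.inl_ι_assoc, ← h₂]; rfl
    · rw [reassoc_of% hl₂, sq.inr_ι_assoc, h₃]; rfl
  have sq' : CommSq l sq.ι p b := ⟨w₂⟩
  refine ⟨sq'.lift, ?_, ?_, sq'.fac_right⟩
  · have := sq.inl ≫= sq'.fac_left
    rw [sq.inl_ι_assoc, hl₁] at this
    exact (CartesianMonoidalCategory.lift (𝟙 L) (const (stdSimplex.obj₀Equiv.symm 0)) : L ⟶ L ⊗ Δ[0]) ≫= this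
  · have := sq.inr ≫= sq'.fac_left
    rwa [sq.inr_ι_assoc, hl₂] at this

/-- The homotopy lifting property of Kan fibrations, starting from the end `0`. -/
lemma exists_homotopy_lift₀ {K L E B : SSet.{w}} (i : K ⟶ L) [Mono i] {p : E ⟶ B}
    (hp : kanFibrations p) (f : L ⟶ E) (k : K ⊗ Δ[1] ⟶ E) (b : L ⊗ Δ[1] ⟶ B)
    (h₁ : ι₀ ≫ k = i ≫ f) (h₂ : ι₀ ≫ b = f ≫ p) (h₃ : k ≫ p = i ▷ _ ≫ b) :
    ∃ h : L ⊗ Δ[1] ⟶ E, ι₀ ≫ h = f ∧ i ▷ _ ≫ h = k ∧ h ≫ p = b :=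
  exists_homotopy_lift_of_anodyne i p hp
    (by rw [← stdSimplex_δ_eq_const]; exact anodyneExtensions_stdSimplex_δ _) f k b h₁ h₂ h₃

/-- The homotopy lifting property of Kan fibrations, starting from the end `1`. -/
lemma exists_homotopy_lift₁ {K L E B : SSet.{w}} (i : K ⟶ L) [Mono i] {p : E ⟶ B}
    (hp : kanFibrations p) (f : L ⟶ E) (k : K ⊗ Δ[1] ⟶ E) (b : L ⊗ Δ[1] ⟶ B)
    (h₁ : ι₁ ≫ k = i ≫ f) (h₂ : ι₁ ≫ b = f ≫ p) (h₃ : k ≫ p = i ▷ _ ≫ b) :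
    ∃ h : L ⊗ Δ[1] ⟶ E, ι₁ ≫ h = f ∧ i ▷ _ ≫ h = k ∧ h ≫ p = b :=
  exists_homotopy_lift_of_anodyne i p hp
    (by rw [← stdSimplex_δ_eq_const]; exact anodyneExtensions_stdSimplex_δ _) f k b h₁ h₂ h₃

/-- A union of two subobjects is their pushout along the intersection, and this is preserved by the
product with `S`. The elementwise form avoids naming the intersection. -/
lemma exists_desc_range_sup_range {A B X S Y : SSet.{w}} (i : A ⟶ X) (j : B ⟶ X) [Mono i] [Mono j]
    (f : A ⊗ S ⟶ Y) (g : B ⊗ S ⟶ Y)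
    (h : ∀ n (a : A.obj n) (b : B.obj n) (s : S.obj n), i.app n a = j.app n b →
      f.app n (a, s) = g.app n (b, s)) :
    ∃ u : ((Subcomplex.range i ⊔ Subcomplex.range j : X.Subcomplex) : SSet) ⊗ S ⟶ Y,
      (∀ n (a : A.obj n) (s : S.obj n) (ha), u.app n (⟨i.app n a, ha⟩, s) = f.app n (a, s)) ∧
      (∀ n (b : B.obj n) (s : S.obj n) (hb), u.app n (⟨j.app n b, hb⟩, s) = g.app n (b, s)) := by
  classical
  have hi (n) : Function.Injective (i.app n) :=
    (CategoryTheory.mono_iff_injective _).1 inferInstance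
  have hj (n) : Function.Injective (j.app n) :=
    (CategoryTheory.mono_iff_injective _).1 inferInstance
  have key (n) (x : ((Subcomplex.range i ⊔ Subcomplex.range j : X.Subcomplex) : SSet).obj n)
      (s : S.obj n) : ∃ y : Y.obj n, (∀ a, i.app n a = x.1 → f.app n (a, s) = y) ∧
        (∀ b, j.app n b = x.1 → g.app n (b, s) = y) := by
    obtain ⟨x, hx | hx⟩ := x
    · obtain ⟨a, rfl⟩ := hx
      exact ⟨f.app n (a, s), fun a' ha' ↦ by rw [hi n ha'], fun b hb ↦ (h n a b s hb.symm).symm⟩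
    · obtain ⟨b, rfl⟩ := hx
      exact ⟨g.app n (b, s), fun a' ha' ↦ h n a' b s ha', fun b' hb ↦ by rw [hj n hb]⟩
  choose φ hφ₁ hφ₂ using key
  refine ⟨{ app n := ↾fun z ↦ φ n z.1 z.2, naturality := fun n m q ↦ ?_ }, ?_, ?_⟩
  · ext ⟨⟨x, hx | hx⟩, s⟩
    · obtain ⟨a, rfl⟩ := hx
      refine (hφ₁ m _ _ (A.map q a) (NatTrans.naturality_apply i q a)).symm.trans ?_
      refine (ConcreteCategory.congr_hom (f.naturality q) (show (A ⊗ S).obj n from (a, s))).trans ?_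
      exact congrArg _ (hφ₁ n _ _ a rfl)
    · obtain ⟨b, rfl⟩ := hx
      refine (hφ₂ m _ _ (B.map q b) (NatTrans.naturality_apply j q b)).symm.trans ?_
      refine (ConcreteCategory.congr_hom (g.naturality q) (show (B ⊗ S).obj n from (b, s))).trans ?_
      exact congrArg _ (hφ₂ n _ _ b rfl)
  · intro n a s ha
    exact (hφ₁ n _ _ a rfl).symm
  · intro n b s hb
    exact (hφ₂ n _ _ b rfl).symm

lemma app_congr {X Y : SSet.{w}} {f g : X ⟶ Y} (h : f = g) (n : SimplexCategoryᵒᵖ) (x : X.obj n) :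
    f.app n x = g.app n x := by rw [h]

instance {X Y : SSet.{w}} (f : X ⟶ Y) [Mono f] (Z : SSet.{w}) : Mono (f ▷ Z) := by
  have (n : SimplexCategoryᵒᵖ) : Mono ((f ▷ Z).app n) := by
    have hf : Function.Injective (f.app n) := (CategoryTheory.mono_iff_injective _).1 inferInstance
    rw [CategoryTheory.mono_iff_injective]
    rintro ⟨x, z⟩ ⟨x', z'⟩ h
    exact Prod.ext (hf (congrArg Prod.fst h)) (congrArg Prod.snd h :)
  exact NatTrans.mono_of_mono_app _

instance {X : SSet.{w}} : Mono (ι₀ : X ⟶ X ⊗ Δ[1]) := mono_of_mono_fac (ι₀_fst X)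

instance {X : SSet.{w}} : Mono (ι₁ : X ⟶ X ⊗ Δ[1]) := mono_of_mono_fac (ι₁_fst X)

lemma ι₀_app_ne_ι₁_app {X : SSet.{w}} {n : SimplexCategoryᵒᵖ} (x y : X.obj n) :
    (ι₀ : X ⟶ X ⊗ Δ[1]).app n x ≠ (ι₁ : X ⟶ X ⊗ Δ[1]).app n y := by
  obtain ⟨⟨n⟩⟩ := n
  intro h
  have h' := congrArg (fun z : (X ⊗ (Δ[1] : SSet.{w})).obj (op ⦋n⦌) ↦ (z.2 : (Δ[1] : SSet.{w}) _⦋n⦌) 0) h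
  change (0 : Fin 2) = 1 at h'
  simp at h'

/-- Extension of the sides of a square of homotopies, relative to a subobject and over a base:
`α` is the side where the second parameter is the vertex `e`, while `β` and `γ` are the sides
where the first parameter is `0` and `1`. -/
lemma exists_square_lift_of_anodyne {K L E B : SSet.{w}} (i : K ⟶ L) [Mono i] {p : E ⟶ B}
    (hp : kanFibrations p) {e : (Δ[1] : SSet.{w}) _⦋0⦌}
    (he : anodyneExtensions (const e : Δ[0] ⟶ Δ[1]))
    (α β γ : L ⊗ Δ[1] ⟶ E) (κ : (K ⊗ Δ[1]) ⊗ Δ[1] ⟶ E) (b : (L ⊗ Δ[1]) ⊗ Δ[1] ⟶ B)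
    (hβ : CartesianMonoidalCategory.lift (𝟙 L) (const e) ≫ β = ι₀ ≫ α)
    (hγ : CartesianMonoidalCategory.lift (𝟙 L) (const e) ≫ γ = ι₁ ≫ α)
    (hκ : CartesianMonoidalCategory.lift (𝟙 _) (const e) ≫ κ = i ▷ _ ≫ α)
    (hκβ : ι₀ ▷ _ ≫ κ = i ▷ _ ≫ β) (hκγ : ι₁ ▷ _ ≫ κ = i ▷ _ ≫ γ)
    (hαb : CartesianMonoidalCategory.lift (𝟙 _) (const e) ≫ b = α ≫ p)
    (hβb : β ≫ p = ι₀ ▷ _ ≫ b) (hγb : γ ≫ p = ι₁ ▷ _ ≫ b) (hκb : κ ≫ p = i ▷ _ ▷ _ ≫ b) :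
    ∃ G : (L ⊗ Δ[1]) ⊗ Δ[1] ⟶ E, CartesianMonoidalCategory.lift (𝟙 _) (const e) ≫ G = α ∧
      ι₀ ▷ _ ≫ G = β ∧ ι₁ ▷ _ ≫ G = γ ∧ i ▷ _ ▷ _ ≫ G = κ ∧ G ≫ p = b := by
  -- The given sides are glued in two stages: first over the two disjoint ends of `L ⊗ Δ[1]`, then
  -- with the relative part `K ⊗ Δ[1]`. Homotopy lifting for the resulting subobject of `L ⊗ Δ[1]`
  -- fills the square.
  obtain ⟨u, hu₀, hu₁⟩ := exists_desc_range_sup_range (S := Δ[1]) (ι₀ : L ⟶ L ⊗ Δ[1]) ι₁ β γ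
    (fun n x y s h ↦ (ι₀_app_ne_ι₁_app _ _ h).elim)
  obtain ⟨v, hv₀, hv₁⟩ := exists_desc_range_sup_range (S := Δ[1])
    (Subcomplex.range (ι₀ : L ⟶ L ⊗ Δ[1]) ⊔ Subcomplex.range ι₁).ι (i ▷ Δ[1]) u κ (by
    rintro n ⟨_, ⟨x, rfl⟩ | ⟨x, rfl⟩⟩ ⟨a, t⟩ s h
    · obtain rfl : x = i.app n a := congrArg Prod.fst h
      obtain rfl : _ = t := congrArg Prod.snd h
      refine (hu₀ _ _ _ _).trans ?_
      exact (app_congr hκβ n (a, s)).symm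
    · obtain rfl : x = i.app n a := congrArg Prod.fst h
      obtain rfl : _ = t := congrArg Prod.snd h
      refine (hu₁ _ _ _ _).trans ?_
      exact (app_congr hκγ n (a, s)).symm)
  have hP : ∀ (n) (x : ((Subcomplex.range
      (Subcomplex.range (ι₀ : L ⟶ L ⊗ Δ[1]) ⊔ Subcomplex.range ι₁ : (L ⊗ Δ[1]).Subcomplex).ι ⊔
        Subcomplex.range (i ▷ Δ[1]) : (L ⊗ Δ[1]).Subcomplex) : SSet).obj n),
      (∃ l : L.obj n, x.1 = ι₀.app n l ∧ ∀ s, v.app n (x, s) = β.app n (l, s)) ∨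
      (∃ l : L.obj n, x.1 = ι₁.app n l ∧ ∀ s, v.app n (x, s) = γ.app n (l, s)) ∨
      (∃ l : (K ⊗ Δ[1]).obj n, x.1 = (i ▷ Δ[1]).app n l ∧
        ∀ s, v.app n (x, s) = κ.app n (l, s)) := by
    rintro n ⟨_, ⟨⟨_, ⟨l, rfl⟩ | ⟨l, rfl⟩⟩, rfl⟩ | ⟨l, rfl⟩⟩
    · exact Or.inl ⟨l, rfl, fun s ↦ (hv₀ n _ s _).trans (hu₀ n l s _)⟩
    · exact Or.inr (Or.inl ⟨l, rfl, fun s ↦ (hv₀ n _ s _).trans (hu₁ n l s _)⟩)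
    · exact Or.inr (Or.inr ⟨l, rfl, fun s ↦ hv₁ n l s _⟩)
  obtain ⟨G, hG₁, hG₂, hG₃⟩ := exists_homotopy_lift_of_anodyne (Subcomplex.ι _) p hp he α v b (by
      ext n x
      obtain ⟨l, hl, hl'⟩ | ⟨l, hl, hl'⟩ | ⟨l, hl, hl'⟩ := hP n x
      · refine (hl' _).trans ((app_congr hβ n l).trans ?_)
        exact congrArg (α.app n) hl.symm
      · refine (hl' _).trans ((app_congr hγ n l).trans ?_)
        exact congrArg (α.app n) hl.symm
      · refine (hl' _).trans ((app_congr hκ n l).trans ?_)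
        exact congrArg (α.app n) hl.symm) hαb (by
      ext n ⟨x, s⟩
      obtain ⟨l, hl, hl'⟩ | ⟨l, hl, hl'⟩ | ⟨l, hl, hl'⟩ := hP n x
      · refine (congrArg (p.app n) (hl' s)).trans
          ((app_congr hβb n (l, s)).trans ?_)
        exact congrArg (fun z ↦ b.app n (z, s)) hl.symm
      · refine (congrArg (p.app n) (hl' s)).trans
          ((app_congr hγb n (l, s)).trans ?_)
        exact congrArg (fun z ↦ b.app n (z, s)) hl.symm
      · refine (congrArg (p.app n) (hl' s)).trans
          ((app_congr hκb n (l, s)).trans ?_)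
        exact congrArg (fun z ↦ b.app n (z, s)) hl.symm)
  refine ⟨G, hG₁, ?_, ?_, ?_, hG₃⟩
  · ext n ⟨l, s⟩
    refine (app_congr hG₂ n
      (⟨ι₀.app n l, Or.inl ⟨⟨_, Or.inl ⟨l, rfl⟩⟩, rfl⟩⟩, s)).trans ?_
    exact (hv₀ n ⟨_, Or.inl ⟨l, rfl⟩⟩ s _).trans (hu₀ n l s _)
  · ext n ⟨l, s⟩
    refine (app_congr hG₂ n
      (⟨ι₁.app n l, Or.inl ⟨⟨_, Or.inr ⟨l, rfl⟩⟩, rfl⟩⟩, s)).trans ?_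
    exact (hv₀ n ⟨_, Or.inr ⟨l, rfl⟩⟩ s _).trans (hu₁ n l s _)
  · ext n ⟨l, s⟩
    refine (app_congr hG₂ n
      (⟨(i ▷ Δ[1]).app n l, Or.inr ⟨l, rfl⟩⟩, s)).trans ?_
    exact hv₁ n l s _

/-! ### Homotopies into Kan complexes -/

instance : kanFibrations.{w}.IsMultiplicative := by
  delta kanFibrations; infer_instance

instance : kanFibrations.{w}.IsStableUnderBaseChange := by
  delta kanFibrations; infer_instance

/-- Morphisms from a simplicial set without simplices. -/
def homOfIsEmpty {X : SSet.{w}} (hX : ∀ n, IsEmpty (X.obj n)) (Y : SSet.{w}) : X ⟶ Y where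
  app n := ↾fun x ↦ ((hX n).false x).elim
  naturality n m f := by ext x; exact ((hX n).false x).elim

lemma hom_ext_of_isEmpty {X : SSet.{w}} (hX : ∀ n, IsEmpty (X.obj n)) {Y : SSet.{w}}
    (f g : X ⟶ Y) : f = g := by
  ext n x; exact ((hX n).false x).elim

lemma isEmpty_bot_obj (X : SSet.{w}) (n : SimplexCategoryᵒᵖ) :
    IsEmpty (((⊥ : X.Subcomplex) : SSet).obj n) :=
  ⟨fun x ↦ x.2.elim⟩

lemma isEmpty_tensor_obj {X : SSet.{w}} {n : SimplexCategoryᵒᵖ} (hX : IsEmpty (X.obj n))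
    (Y : SSet.{w}) : IsEmpty ((X ⊗ Y).obj n) :=
  ⟨fun x ↦ hX.false x.1⟩

lemma nonempty_homotopy_of_hom {X Y : SSet.{w}} {f g : X ⟶ Y} (h : X ⊗ Δ[1] ⟶ Y)
    (h₀ : ι₀ ≫ h = f) (h₁ : ι₁ ≫ h = g) : Nonempty (Homotopy f g) :=
  ⟨{ h := h, h₀ := h₀, h₁ := h₁,
     rel := hom_ext_of_isEmpty (fun n ↦ isEmpty_tensor_obj (isEmpty_bot_obj X n) _) _ _ }⟩

lemma nonempty_homotopy_iff {X Y : SSet.{w}} {f g : X ⟶ Y} :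
    Nonempty (Homotopy f g) ↔ ∃ h : X ⊗ Δ[1] ⟶ Y, ι₀ ≫ h = f ∧ ι₁ ≫ h = g :=
  ⟨fun ⟨H⟩ ↦ ⟨H.h, H.h₀, H.h₁⟩, fun ⟨h, h₀, h₁⟩ ↦ nonempty_homotopy_of_hom h h₀ h₁⟩

lemma nonempty_homotopy_refl {X Y : SSet.{w}} (f : X ⟶ Y) : Nonempty (Homotopy f f) :=
  nonempty_homotopy_of_hom (CartesianMonoidalCategory.fst _ _ ≫ f) rfl rfl

lemma nonempty_homotopy_precomp {X Y Z : SSet.{w}} (f : X ⟶ Y) {g g' : Y ⟶ Z}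
    (h : Nonempty (Homotopy g g')) : Nonempty (Homotopy (f ≫ g) (f ≫ g')) := by
  obtain ⟨H, rfl, rfl⟩ := nonempty_homotopy_iff.1 h
  exact nonempty_homotopy_of_hom (f ▷ _ ≫ H) rfl rfl

lemma nonempty_homotopy_postcomp {X Y Z : SSet.{w}} {f f' : X ⟶ Y}
    (h : Nonempty (Homotopy f f')) (g : Y ⟶ Z) : Nonempty (Homotopy (f ≫ g) (f' ≫ g)) := by
  obtain ⟨H, rfl, rfl⟩ := nonempty_homotopy_iff.1 h
  exact nonempty_homotopy_of_hom (H ≫ g) rfl rfl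

lemma kanFibrations_terminal_from (K : SSet.{w}) [hK : KanComplex K] :
    kanFibrations (terminal.from K) := by
  exact (fibration_iff _).1 ((HomotopicalAlgebra.isFibrant_iff K).1 hK)

lemma kanComplex_iff (K : SSet.{w}) : KanComplex K ↔ kanFibrations (terminal.from K) := by
  exact (HomotopicalAlgebra.isFibrant_iff K).trans (fibration_iff _)

lemma kanComplex_of_kanFibration {E B : SSet.{w}} {p : E ⟶ B} (hp : kanFibrations p)
    [KanComplex B] : KanComplex E := by
  rw [kanComplex_iff, ← terminal.comp_from p]
  exact MorphismProperty.comp_mem _ _ _ hp (kanFibrations_terminal_from B)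

/-- Given three sides of a square of homotopies over a base, the fourth exists: the side where
the second parameter is `1` is prescribed. -/
lemma exists_square_side₁ {L E B : SSet.{w}} {p : E ⟶ B} (hp : kanFibrations p)
    (α β γ : L ⊗ Δ[1] ⟶ E) (b : (L ⊗ Δ[1]) ⊗ Δ[1] ⟶ B)
    (hβ : ι₁ ≫ β = ι₀ ≫ α) (hγ : ι₁ ≫ γ = ι₁ ≫ α) (hαb : ι₁ ≫ b = α ≫ p)
    (hβb : β ≫ p = ι₀ ▷ _ ≫ b) (hγb : γ ≫ p = ι₁ ▷ _ ≫ b) :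
    ∃ δ : L ⊗ Δ[1] ⟶ E, ι₀ ≫ δ = ι₀ ≫ β ∧ ι₁ ≫ δ = ι₀ ≫ γ ∧ δ ≫ p = ι₀ ≫ b := by
  -- The absolute statement is the relative one for the empty subobject, where every condition on
  -- the relative part is vacuous.
  have h₁ (n) : IsEmpty ((((⊥ : L.Subcomplex) : SSet) ⊗ Δ[1]).obj n) :=
    isEmpty_tensor_obj (isEmpty_bot_obj L n) _
  have h₂ (n) : IsEmpty (((((⊥ : L.Subcomplex) : SSet) ⊗ Δ[1]) ⊗ Δ[1]).obj n) :=
    isEmpty_tensor_obj (h₁ n) _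
  obtain ⟨G, -, hG₀, hG₁, -, hG⟩ := exists_square_lift_of_anodyne (⊥ : L.Subcomplex).ι hp
    (by rw [← stdSimplex_δ_eq_const]; exact anodyneExtensions_stdSimplex_δ _)
    α β γ (homOfIsEmpty h₂ _) b hβ hγ (hom_ext_of_isEmpty h₁ _ _) (hom_ext_of_isEmpty h₁ _ _)
    (hom_ext_of_isEmpty h₁ _ _) hαb hβb hγb (hom_ext_of_isEmpty h₂ _ _)
  refine ⟨ι₀ ≫ G, ?_, ?_, ?_⟩
  · rw [← hG₀, ι₀_comp_assoc]
  · rw [← hG₁, ι₀_comp_assoc]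
  · rw [Category.assoc, hG]

/-- Filling an open square over the point. Symmetry and transitivity of homotopy are the cases in
which some sides are constant. -/
lemma exists_homotopy_of_square {X K : SSet.{w}} [KanComplex K] {a b a' b' : X ⟶ K}
    (h₁ : Nonempty (Homotopy a b)) (h₂ : Nonempty (Homotopy a' a))
    (h₃ : Nonempty (Homotopy b' b)) : Nonempty (Homotopy a' b') := by
  obtain ⟨α, rfl, rfl⟩ := nonempty_homotopy_iff.1 h₁
  obtain ⟨β, rfl, hβ⟩ := nonempty_homotopy_iff.1 h₂
  obtain ⟨γ, rfl, hγ⟩ := nonempty_homotopy_iff.1 h₃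
  obtain ⟨δ, h₀, h₁, -⟩ := exists_square_side₁ (kanFibrations_terminal_from K) α β γ
    (terminal.from _) hβ hγ (by simp) (by simp) (by simp)
  exact nonempty_homotopy_of_hom δ h₀ h₁

lemma nonempty_homotopy_symm {X K : SSet.{w}} [KanComplex K] {a b : X ⟶ K}
    (h : Nonempty (Homotopy a b)) : Nonempty (Homotopy b a) :=
  exists_homotopy_of_square (nonempty_homotopy_refl b) (nonempty_homotopy_refl b) h

lemma nonempty_homotopy_trans {X K : SSet.{w}} [KanComplex K] {a b c : X ⟶ K}
    (h : Nonempty (Homotopy a b)) (h' : Nonempty (Homotopy b c)) : Nonempty (Homotopy a c) :=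
  exists_homotopy_of_square h' h (nonempty_homotopy_refl c)

/-! ### Weak equivalences -/

lemma kanWeakEquivalences_comp {X Y Z : SSet.{w}} {f : X ⟶ Y} {g : Y ⟶ Z}
    (hf : kanWeakEquivalences f) (hg : kanWeakEquivalences g) : kanWeakEquivalences (f ≫ g) := by
  intro K _
  refine ⟨fun a ↦ ?_, fun b b' h ↦ ?_⟩
  · obtain ⟨b, hb⟩ := (hf K).1 a
    obtain ⟨c, hc⟩ := (hg K).1 b
    refine ⟨c, ?_⟩
    rw [Category.assoc]
    exact nonempty_homotopy_trans (nonempty_homotopy_precomp f hc) hb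
  · simp only [Category.assoc] at h
    exact (hg K).2 _ _ ((hf K).2 _ _ h)

lemma kanWeakEquivalences_of_precomp {X Y Z : SSet.{w}} {f : X ⟶ Y} {g : Y ⟶ Z}
    (hf : kanWeakEquivalences f) (hfg : kanWeakEquivalences (f ≫ g)) : kanWeakEquivalences g := by
  intro K _
  refine ⟨fun a ↦ ?_, fun b b' h ↦ ?_⟩
  · obtain ⟨b, hb⟩ := (hfg K).1 (f ≫ a)
    rw [Category.assoc] at hb
    exact ⟨b, (hf K).2 _ _ hb⟩
  · refine (hfg K).2 _ _ ?_
    simp only [Category.assoc]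
    exact nonempty_homotopy_precomp f h

lemma kanWeakEquivalences_of_postcomp {X Y Z : SSet.{w}} {f : X ⟶ Y} {g : Y ⟶ Z}
    (hg : kanWeakEquivalences g) (hfg : kanWeakEquivalences (f ≫ g)) : kanWeakEquivalences f := by
  intro K _
  refine ⟨fun a ↦ ?_, fun b b' h ↦ ?_⟩
  · obtain ⟨b, hb⟩ := (hfg K).1 a
    rw [Category.assoc] at hb
    exact ⟨_, hb⟩
  · obtain ⟨c, hc⟩ := (hg K).1 b
    obtain ⟨c', hc'⟩ := (hg K).1 b'
    refine nonempty_homotopy_trans (nonempty_homotopy_symm hc)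
      (nonempty_homotopy_trans (nonempty_homotopy_precomp g ((hfg K).2 c c' ?_)) hc')
    simp only [Category.assoc]
    exact nonempty_homotopy_trans (nonempty_homotopy_precomp f hc)
      (nonempty_homotopy_trans h (nonempty_homotopy_symm (nonempty_homotopy_precomp f hc')))

lemma kanWeakEquivalences_of_homotopyEquivalence {X Y : SSet.{w}} {f : X ⟶ Y} (g : Y ⟶ X)
    (hfg : Nonempty (Homotopy (f ≫ g) (𝟙 X))) (hgf : Nonempty (Homotopy (g ≫ f) (𝟙 Y))) :
    kanWeakEquivalences f := by
  intro K _
  refine ⟨fun a ↦ ⟨g ≫ a, ?_⟩, fun b b' h ↦ ?_⟩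
  · simpa using nonempty_homotopy_postcomp hfg a
  · have h₁ := nonempty_homotopy_postcomp hgf b
    have h₂ := nonempty_homotopy_postcomp hgf b'
    have h₃ := nonempty_homotopy_precomp g h
    simp only [Category.assoc, Category.id_comp] at h₁ h₂ h₃
    exact nonempty_homotopy_trans (nonempty_homotopy_symm h₁) (nonempty_homotopy_trans h₃ h₂)

lemma kanWeakEquivalences_of_isIso {X Y : SSet.{w}} (f : X ⟶ Y) [IsIso f] :
    kanWeakEquivalences f :=
  kanWeakEquivalences_of_homotopyEquivalence (inv f) (by simpa using nonempty_homotopy_refl _)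
    (by simpa using nonempty_homotopy_refl _)

/-- Trivial fibrations: maps with the right lifting property with respect to the boundary
inclusions, hence to all monomorphisms. -/
abbrev trivialFibrations : MorphismProperty SSet.{w} := SSet.modelCategoryQuillen.I.rlp

lemma trivialFibrations_lift {K L E B : SSet.{w}} (i : K ⟶ L) [Mono i] {p : E ⟶ B}
    (hp : trivialFibrations p) : HasLiftingProperty i p := by
  rw [trivialFibrations, ← rlp_monomorphisms] at hp
  exact hp _ (MorphismProperty.monomorphisms.infer_property i)

lemma trivialFibrations_le_kanFibrations : trivialFibrations.{w} ≤ kanFibrations := by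
  rw [trivialFibrations, ← rlp_monomorphisms]
  exact MorphismProperty.antitone_rlp J_le_monomorphisms

/-- The cofree simplicial set on a type of labels: maps into it are labellings of all the
simplices of the source. -/
@[simps]
def cofree (T : Type w) : SSet.{w} where
  obj n := (Σ m : SimplexCategory, (m ⟶ n.unop)) → T
  map f := ↾fun φ q ↦ φ ⟨q.1, q.2 ≫ f.unop⟩

/-- The map to `cofree T` corresponding to a labelling. -/
@[simps]
def toCofree {X : SSet.{w}} {T : Type w} (l : ∀ n : SimplexCategoryᵒᵖ, X.obj n → T) :
    X ⟶ cofree T where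
  app n := ↾fun x q ↦ l (op q.1) (X.map q.2.op x)
  naturality n m f := by
    ext x
    funext q
    exact congrArg (l (op q.1)) (Functor.map_comp_apply X f q.2.op x).symm

lemma toCofree_injective {X : SSet.{w}} {T : Type w} (l : ∀ n : SimplexCategoryᵒᵖ, X.obj n → T)
    (n : SimplexCategoryᵒᵖ) (x y : X.obj n) (h : (toCofree l).app n x = (toCofree l).app n y) :
    l n x = l n y := by
  have := congrFun h ⟨n.unop, 𝟙 _⟩
  change l n (X.map (𝟙 n) x) = l n (X.map (𝟙 n) y) at this
  simpa using this

lemma toCofree_label {X : SSet.{w}} {T : Type w} (f : X ⟶ cofree T) :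
    toCofree (fun n x ↦ f.app n x ⟨n.unop, 𝟙 _⟩) = f := by
  ext n x
  funext q
  refine (congrFun (NatTrans.naturality_apply f q.2.op x) ⟨q.1, 𝟙 _⟩).trans ?_
  change f.app n x ⟨q.1, 𝟙 _ ≫ q.2⟩ = _
  rw [Category.id_comp]
  rfl

/-- A map to `cofree T` is an arbitrary labelling of simplices, so labels off the image of `i` are
free. Prescribing them is what later makes an extended map injective. -/
lemma exists_cofree_extension {K L : SSet.{w}} (i : K ⟶ L) [Mono i] {T : Type w}
    (f : K ⟶ cofree T) (l : ∀ n : SimplexCategoryᵒᵖ, L.obj n → T) :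
    ∃ g : L ⟶ cofree T, i ≫ g = f ∧
      ∀ n x, (¬ ∃ y, i.app n y = x) → g.app n x ⟨n.unop, 𝟙 _⟩ = l n x := by
  classical
  let l' (n : SimplexCategoryᵒᵖ) (x : L.obj n) : T :=
    if h : ∃ y, i.app n y = x then f.app n h.choose ⟨n.unop, 𝟙 _⟩ else l n x
  have hl' (n) (y : K.obj n) : l' n (i.app n y) = f.app n y ⟨n.unop, 𝟙 _⟩ := by
    have h : ∃ y', i.app n y' = i.app n y := ⟨y, rfl⟩
    have hi : Function.Injective (i.app n) :=
      (CategoryTheory.mono_iff_injective _).1 inferInstance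
    have h' : h.choose = y := hi h.choose_spec
    change (if h : ∃ y', i.app n y' = i.app n y then _ else _) = _
    rw [dif_pos h, h']
  refine ⟨toCofree l', ?_, fun n x hx ↦ ?_⟩
  · conv_rhs => rw [← toCofree_label f]
    ext n x
    funext q
    refine Eq.trans ?_ (hl' (op q.1) (K.map q.2.op x))
    exact congrArg (l' _) (NatTrans.naturality_apply i q.2.op x).symm
  · have : L.map (𝟙 n) x = x := by simp
    change l' n (L.map (𝟙 n) x) = l n x
    rw [this]
    exact dif_neg hx

lemma trivialFibrations_cofree (T : Type w) [Nonempty T] :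
    trivialFibrations (terminal.from (cofree T)) := by
  rw [trivialFibrations, ← rlp_monomorphisms]
  intro K L i (hi : Mono i)
  refine ⟨fun {u v} sq ↦ ?_⟩
  obtain ⟨g, hg, -⟩ := exists_cofree_extension i u fun _ _ ↦ Classical.arbitrary T
  exact ⟨⟨g, hg, by subsingleton⟩⟩

/-- Every simplicial set embeds into a cofree one, on a set of labels which is closed under
countable powers. -/
lemma exists_mono_cofree (X : SSet.{w}) : ∃ (T : Type w) (_ : Nontrivial T) (_ : (ℕ → T) ↪ T)
    (f : X ⟶ cofree T), Mono f := by
  -- The two layers of `Option` give at least two labels even when `X` is empty; the exponent `ℕ`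
  -- makes `T` isomorphic to its countable power.
  let T := ℕ → Option (Option (Σ n : ℕ, X _⦋n⦌))
  let l (n : SimplexCategoryᵒᵖ) (x : X.obj n) : T := fun _ ↦ some (some ⟨n.unop.len, x⟩)
  refine ⟨T, inferInstance, ((Equiv.curry ℕ ℕ _).symm.trans
    (Equiv.arrowCongr Nat.pairEquiv (.refl _))).toEmbedding, toCofree l, ?_⟩
  have (n : SimplexCategoryᵒᵖ) : Mono ((toCofree l).app n) := by
    rw [CategoryTheory.mono_iff_injective]
    intro x y h
    have := congrFun (toCofree_injective _ n x y h) 0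
    simpa [l] using this
  exact NatTrans.mono_of_mono_app _

/-- An embedding of `K` into a cofree object extends along `i`, because cofree objects are trivially
fibrant; the first factor of a monomorphism is a monomorphism. -/
lemma mono_of_llp_trivialFibrations {K L : SSet.{w}} {i : K ⟶ L} (hi : trivialFibrations.llp i) :
    Mono i := by
  obtain ⟨T, _, -, f, _⟩ := exists_mono_cofree K
  have := hi _ (trivialFibrations_cofree T)
  have sq : CommSq f i (terminal.from (cofree T)) (terminal.from _) := ⟨by simp⟩
  exact mono_of_mono_fac sq.fac_left

lemma anodyneExtensions_mono {K L : SSet.{w}} {i : K ⟶ L} (hi : anodyneExtensions i) : Mono i :=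
  mono_of_llp_trivialFibrations (MorphismProperty.antitone_llp trivialFibrations_le_kanFibrations _ hi)

/-! ### Homotopy extension and lifting -/

lemma mem_boundary_one_iff {X : SSet.{w}} {n : SimplexCategoryᵒᵖ} (z : (X ⊗ Δ[1]).obj n) :
    z.2 ∈ (boundary.{w} 1).obj n ↔ z ∈ (Subcomplex.range (ι₀ : X ⟶ X ⊗ Δ[1])).obj n ∨
      z ∈ (Subcomplex.range (ι₁ : X ⟶ X ⊗ Δ[1])).obj n := by
  obtain ⟨⟨n⟩⟩ := n
  obtain ⟨x, t⟩ := z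
  rw [mem_boundary_iff_notMem_range]
  constructor
  · rintro ⟨j, hj⟩
    obtain rfl | rfl : j = 0 ∨ j = 1 := by fin_cases j <;> simp
    · refine Or.inr ⟨x, Prod.ext rfl ?_⟩
      refine SSet.stdSimplex.ext _ _ fun k ↦ ?_
      have : t k ≠ 0 := fun h ↦ hj ⟨k, h⟩
      exact ((Fin.eq_one_of_ne_zero _ this)).symm
    · refine Or.inl ⟨x, Prod.ext rfl ?_⟩
      refine SSet.stdSimplex.ext _ _ fun k ↦ ?_
      have : t k ≠ 1 := fun h ↦ hj ⟨k, h⟩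
      change 0 = t k
      lia
  · rintro (⟨y, hy⟩ | ⟨y, hy⟩)
    · refine ⟨1, ?_⟩
      rintro ⟨k, hk⟩
      have := congrArg (fun z : (X ⊗ (Δ[1] : SSet.{w})).obj (op ⦋n⦌) ↦
        (z.2 : (Δ[1] : SSet.{w}) _⦋n⦌) k) hy
      exact absurd (this.trans hk) (by decide : (0 : Fin 2) ≠ 1)
    · refine ⟨0, ?_⟩
      rintro ⟨k, hk⟩
      have := congrArg (fun z : (X ⊗ (Δ[1] : SSet.{w})).obj (op ⦋n⦌) ↦
        (z.2 : (Δ[1] : SSet.{w}) _⦋n⦌) k) hy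
      exact absurd (this.trans hk) (by decide : (1 : Fin 2) ≠ 0)

lemma mem_unionProd_boundary_one_iff {X : SSet.{w}} (A : X.Subcomplex) {n : SimplexCategoryᵒᵖ}
    (z : (X ⊗ Δ[1]).obj n) : z ∈ (A.unionProd (boundary.{w} 1)).obj n ↔
      (z ∈ (Subcomplex.range (ι₀ : X ⟶ X ⊗ Δ[1])).obj n ∨
        z ∈ (Subcomplex.range (ι₁ : X ⟶ X ⊗ Δ[1])).obj n) ∨ z.1 ∈ A.obj n :=
  (Subcomplex.mem_unionProd_iff _ _ z).trans (or_congr_left (mem_boundary_one_iff z))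

/-- Homotopies relative to a subobject and with prescribed ends lift along maps which have the
right lifting property with respect to the pushout-product with the boundary of `Δ[1]`. -/
lemma exists_homotopy_lift_of_hasLiftingProperty {K L E B : SSet.{w}} (i : K ⟶ L) [Mono i]
    {q : E ⟶ B}
    (hq : HasLiftingProperty ((Subcomplex.range i).unionProd (boundary.{w} 1)).ι q)
    (β γ : L ⟶ E) (κ : K ⊗ Δ[1] ⟶ E) (b : L ⊗ Δ[1] ⟶ B)
    (hβ : ι₀ ≫ κ = i ≫ β) (hγ : ι₁ ≫ κ = i ≫ γ) (hβb : β ≫ q = ι₀ ≫ b)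
    (hγb : γ ≫ q = ι₁ ≫ b) (hκb : κ ≫ q = i ▷ _ ≫ b) :
    ∃ G : L ⊗ Δ[1] ⟶ E, ι₀ ≫ G = β ∧ ι₁ ≫ G = γ ∧ i ▷ _ ≫ G = κ ∧ G ≫ q = b := by
  have hi (n) : Function.Injective (i.app n) :=
    (CategoryTheory.mono_iff_injective _).1 inferInstance
  -- The source of the pushout-product is covered by the two ends and `K ⊗ Δ[1]`. On each piece the
  -- value is forced, and the hypotheses `hβ` and `hγ` make the values agree on overlaps.
  have key (n) (z : (((Subcomplex.range i).unionProd (boundary.{w} 1)) : SSet).obj n) :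
      ∃ e : E.obj n, (∀ l, ι₀.app n l = z.1 → β.app n l = e) ∧
        (∀ l, ι₁.app n l = z.1 → γ.app n l = e) ∧
        (∀ l, (i ▷ Δ[1]).app n l = z.1 → κ.app n l = e) := by
    obtain ⟨z, hz⟩ := z
    have aux₀ (l : L.obj n) (k) (h : (i ▷ Δ[1]).app n k = ι₀.app n l) :
        κ.app n k = β.app n l := by
      obtain ⟨k, t⟩ := k
      obtain rfl : i.app n k = l := congrArg Prod.fst h
      obtain rfl : t = _ := congrArg Prod.snd h
      exact app_congr hβ n k
    have aux₁ (l : L.obj n) (k) (h : (i ▷ Δ[1]).app n k = ι₁.app n l) :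
        κ.app n k = γ.app n l := by
      obtain ⟨k, t⟩ := k
      obtain rfl : i.app n k = l := congrArg Prod.fst h
      obtain rfl : t = _ := congrArg Prod.snd h
      exact app_congr hγ n k
    rw [mem_unionProd_boundary_one_iff] at hz
    obtain (⟨l, rfl⟩ | ⟨l, rfl⟩) | ⟨l, hl⟩ := hz
    · exact ⟨β.app n l, fun l' h ↦ by rw [show l' = l from congrArg Prod.fst h],
        fun l' h ↦ (ι₀_app_ne_ι₁_app _ _ h.symm).elim, aux₀ l⟩
    · exact ⟨γ.app n l, fun l' h ↦ (ι₀_app_ne_ι₁_app _ _ h).elim,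
        fun l' h ↦ by rw [show l' = l from congrArg Prod.fst h], aux₁ l⟩
    · obtain ⟨_, t⟩ := z
      obtain rfl : i.app n l = _ := hl
      refine ⟨κ.app n (l, t), fun l' h ↦ (aux₀ _ _ h.symm).symm,
        fun l' h ↦ (aux₁ _ _ h.symm).symm, ?_⟩
      rintro ⟨l', t'⟩ h
      obtain rfl : l' = l := hi n (congrArg Prod.fst h)
      obtain rfl : t' = t := congrArg Prod.snd h
      rfl
  choose φ hφ₀ hφ₁ hφ using key
  have cases (n) (z : (((Subcomplex.range i).unionProd (boundary.{w} 1)) : SSet).obj n) :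
      (∃ l, ι₀.app n l = z.1) ∨ (∃ l, ι₁.app n l = z.1) ∨ (∃ l, (i ▷ Δ[1]).app n l = z.1) := by
    obtain (h | h) | ⟨l, hl⟩ := (mem_unionProd_boundary_one_iff _ _).1 z.2
    · exact Or.inl h
    · exact Or.inr (Or.inl h)
    · exact Or.inr (Or.inr ⟨(l, z.1.2), Prod.ext hl rfl⟩)
  let Φ : (((Subcomplex.range i).unionProd (boundary.{w} 1)) : SSet) ⟶ E :=
    { app n := ↾fun z ↦ φ n z
      naturality n m f := by
        ext z
        have hz (A : SSet.{w}) (j : A ⟶ L ⊗ Δ[1]) (l : A.obj n) (hl : j.app n l = z.1) :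
            j.app m (A.map f l) = ((((Subcomplex.range i).unionProd
              (boundary.{w} 1)) : SSet).map f z).1 :=
          (NatTrans.naturality_apply j f l).trans (congrArg ((L ⊗ Δ[1]).map f) hl)
        obtain ⟨l, hl⟩ | ⟨l, hl⟩ | ⟨l, hl⟩ := cases n z
        · refine (hφ₀ m _ _ (hz _ _ _ hl)).symm.trans
            ((NatTrans.naturality_apply β f l).trans ?_)
          exact congrArg _ (hφ₀ n _ _ hl)
        · refine (hφ₁ m _ _ (hz _ _ _ hl)).symm.trans
            ((NatTrans.naturality_apply γ f l).trans ?_)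
          exact congrArg _ (hφ₁ n _ _ hl)
        · refine (hφ m _ _ (hz _ _ _ hl)).symm.trans
            ((NatTrans.naturality_apply κ f l).trans ?_)
          exact congrArg _ (hφ n _ _ hl) }
  have sq : CommSq Φ ((Subcomplex.range i).unionProd (boundary.{w} 1)).ι q b := ⟨by
    ext n z
    obtain ⟨l, hl⟩ | ⟨l, hl⟩ | ⟨l, hl⟩ := cases n z
    · exact (congrArg (q.app n) (hφ₀ n _ _ hl).symm).trans
        ((app_congr hβb n l).trans (congrArg (b.app n) hl))
    · exact (congrArg (q.app n) (hφ₁ n _ _ hl).symm).trans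
        ((app_congr hγb n l).trans (congrArg (b.app n) hl))
    · exact (congrArg (q.app n) (hφ n _ _ hl).symm).trans
        ((app_congr hκb n l).trans (congrArg (b.app n) hl))⟩
  refine ⟨sq.lift, ?_, ?_, ?_, sq.fac_right⟩
  · ext n l
    exact (app_congr sq.fac_left n ⟨ι₀.app n l, by
      rw [mem_unionProd_boundary_one_iff]
      exact Or.inl (Or.inl ⟨l, rfl⟩)⟩).trans (hφ₀ n _ _ rfl).symm
  · ext n l
    exact (app_congr sq.fac_left n ⟨ι₁.app n l, by
      rw [mem_unionProd_boundary_one_iff]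
      exact Or.inl (Or.inr ⟨l, rfl⟩)⟩).trans (hφ₁ n _ _ rfl).symm
  · ext n l
    exact (app_congr sq.fac_left n ⟨(i ▷ Δ[1]).app n l, by
      rw [mem_unionProd_boundary_one_iff]
      exact Or.inr ⟨l.1, rfl⟩⟩).trans (hφ n _ _ rfl).symm

lemma trivialFibrations_homotopy_lift {K L E B : SSet.{w}} (i : K ⟶ L) [Mono i] {q : E ⟶ B}
    (hq : trivialFibrations q) (β γ : L ⟶ E) (κ : K ⊗ Δ[1] ⟶ E) (b : L ⊗ Δ[1] ⟶ B)
    (hβ : ι₀ ≫ κ = i ≫ β) (hγ : ι₁ ≫ κ = i ≫ γ) (hβb : β ≫ q = ι₀ ≫ b)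
    (hγb : γ ≫ q = ι₁ ≫ b) (hκb : κ ≫ q = i ▷ _ ≫ b) :
    ∃ G : L ⊗ Δ[1] ⟶ E, ι₀ ≫ G = β ∧ ι₁ ≫ G = γ ∧ i ▷ _ ≫ G = κ ∧ G ≫ q = b :=
  exists_homotopy_lift_of_hasLiftingProperty i (trivialFibrations_lift _ hq) β γ κ b hβ hγ hβb
    hγb hκb

lemma anodyneExtensions_homotopy_lift {K L E B : SSet.{w}} (i : K ⟶ L)
    (hi : anodyneExtensions i) {q : E ⟶ B}
    (hq : kanFibrations q) (β γ : L ⟶ E) (κ : K ⊗ Δ[1] ⟶ E) (b : L ⊗ Δ[1] ⟶ B)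
    (hβ : ι₀ ≫ κ = i ≫ β) (hγ : ι₁ ≫ κ = i ≫ γ) (hβb : β ≫ q = ι₀ ≫ b)
    (hγb : γ ≫ q = ι₁ ≫ b) (hκb : κ ≫ q = i ▷ _ ≫ b) :
    ∃ G : L ⊗ Δ[1] ⟶ E, ι₀ ≫ G = β ∧ ι₁ ≫ G = γ ∧ i ▷ _ ≫ G = κ ∧ G ≫ q = b := by
  have := anodyneExtensions_mono hi
  refine exists_homotopy_lift_of_hasLiftingProperty i
    (anodyneExtensions_unionProd_ι' _ _ ?_ _ hq) β γ κ b hβ hγ hβb hγb hκb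
  rw [← Subcomplex.toRange_ι i] at hi
  exact (MorphismProperty.cancel_left_of_respectsIso _ _ _).1 hi

/-! ### Fibrations and mapping spaces of Kan complexes -/

/-- Lifting against the empty subobject of `B` gives a section, and lifting against the two ends of
`E ⊗ Δ[1]` gives a homotopy from `p` followed by that section to the identity. So `p` is a homotopy
equivalence. -/
lemma kanWeakEquivalences_of_trivialFibrations {E B : SSet.{w}} {p : E ⟶ B}
    (hp : trivialFibrations p) : kanWeakEquivalences p := by
  have := trivialFibrations_lift (⊥ : B.Subcomplex).ι hp
  have sq : CommSq (homOfIsEmpty (isEmpty_bot_obj B) E) (⊥ : B.Subcomplex).ι p (𝟙 B) :=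
    ⟨hom_ext_of_isEmpty (isEmpty_bot_obj B) _ _⟩
  have hs : sq.lift ≫ p = 𝟙 B := sq.fac_right
  have h (n) := isEmpty_tensor_obj (isEmpty_bot_obj E n) (Δ[1] : SSet.{w})
  obtain ⟨G, h₀, h₁, -, -⟩ := trivialFibrations_homotopy_lift (⊥ : E.Subcomplex).ι hp
    (p ≫ sq.lift) (𝟙 E) (homOfIsEmpty h E) (CartesianMonoidalCategory.fst _ _ ≫ p)
    (hom_ext_of_isEmpty (isEmpty_bot_obj E) _ _) (hom_ext_of_isEmpty (isEmpty_bot_obj E) _ _)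
    (by simp [hs]) (by simp) (hom_ext_of_isEmpty h _ _)
  refine kanWeakEquivalences_of_homotopyEquivalence sq.lift (nonempty_homotopy_of_hom G h₀ h₁) ?_
  rw [hs]
  exact nonempty_homotopy_refl _

lemma kanWeakEquivalences_of_anodyneExtensions {K L : SSet.{w}} {i : K ⟶ L}
    (hi : anodyneExtensions i) : kanWeakEquivalences i := by
  intro M _
  have hM : kanFibrations (terminal.from M) := kanFibrations_terminal_from M
  refine ⟨fun a ↦ ?_, fun b b' h ↦ ?_⟩
  · have := hi _ hM
    have sq : CommSq a i (terminal.from M) (terminal.from L) := ⟨by simp⟩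
    exact ⟨sq.lift, by rw [sq.fac_left]; exact nonempty_homotopy_refl a⟩
  · obtain ⟨κ, h₀, h₁⟩ := nonempty_homotopy_iff.1 h
    obtain ⟨G, hG₀, hG₁, -⟩ := anodyneExtensions_homotopy_lift i hi hM b b' κ (terminal.from _)
      h₀ h₁ (by simp) (by simp) (by simp)
    exact nonempty_homotopy_of_hom G hG₀ hG₁

/-- A Kan fibration that has a section `s` such that `p ≫ s` is vertically homotopic to the
identity is a trivial fibration. -/
lemma trivialFibrations_of_vertical_homotopy {E B : SSet.{w}} {p : E ⟶ B} (hp : kanFibrations p)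
    (s : B ⟶ E) (hs : s ≫ p = 𝟙 B) (V : E ⊗ Δ[1] ⟶ E) (h₀ : ι₀ ≫ V = 𝟙 E) (h₁ : ι₁ ≫ V = p ≫ s)
    (hV : V ≫ p = CartesianMonoidalCategory.fst _ _ ≫ p) : trivialFibrations p := by
  rw [trivialFibrations, ← rlp_monomorphisms]
  intro K L i (hi : Mono i)
  refine ⟨fun {u v} sq ↦ ?_⟩
  -- `v ≫ s` lifts `v` but restricts to `u` only up to the vertical homotopy `V`. Transporting it
  -- back along `V`, from the end `1` to the end `0`, makes the restriction strict.
  obtain ⟨h, hh₁, hh, hhp⟩ := exists_homotopy_lift₁ i hp (v ≫ s) (u ▷ _ ≫ V)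
    (CartesianMonoidalCategory.fst _ _ ≫ v)
    (by rw [ι₁_comp_assoc, h₁, ← Category.assoc, sq.w, Category.assoc])
    (by simp [hs]) (by rw [Category.assoc, hV]; simp [sq.w])
  refine ⟨⟨ι₀ ≫ h, ?_, ?_⟩⟩
  · rw [← ι₀_comp_assoc, hh, ι₀_comp_assoc, h₀, Category.comp_id]
  · rw [Category.assoc, hhp, ι₀_fst_assoc]

/-- Since `E` and `B` are themselves Kan complexes, they can be used as test objects, so `p` has a
homotopy inverse. Homotopy lifting rectifies it to a strict section with a vertical contraction. -/
lemma trivialFibrations_of_kanComplex {E B : SSet.{w}} [KanComplex E] [KanComplex B] {p : E ⟶ B}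
    (hp : kanFibrations p) (hp' : kanWeakEquivalences p) : trivialFibrations p := by
  obtain ⟨s₀, hs₀⟩ := (hp' E).1 (𝟙 E)
  have hs₀' : Nonempty (Homotopy (s₀ ≫ p) (𝟙 B)) := by
    refine (hp' B).2 _ _ ?_
    simpa using nonempty_homotopy_postcomp hs₀ p
  obtain ⟨b, hb₀, hb₁⟩ := nonempty_homotopy_iff.1 hs₀'
  have hB (n) := isEmpty_tensor_obj (isEmpty_bot_obj B n) (Δ[1] : SSet.{w})
  obtain ⟨h, hh₀, -, hhp⟩ := exists_homotopy_lift₀ (⊥ : B.Subcomplex).ι hp s₀ (homOfIsEmpty hB E) b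
    (hom_ext_of_isEmpty (isEmpty_bot_obj B) _ _) hb₀ (hom_ext_of_isEmpty hB _ _)
  obtain ⟨s, hs, hs'⟩ : ∃ s : B ⟶ E, s ≫ p = 𝟙 B ∧ Nonempty (Homotopy s₀ s) :=
    ⟨ι₁ ≫ h, by rw [Category.assoc, hhp, hb₁], nonempty_homotopy_of_hom h hh₀ rfl⟩
  obtain ⟨k, hk₀, hk₁⟩ := nonempty_homotopy_iff.1 (nonempty_homotopy_symm
    (nonempty_homotopy_trans (nonempty_homotopy_symm (nonempty_homotopy_precomp p hs')) hs₀))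
  -- The homotopy `k` from the identity to `p ≫ s` need not be vertical. Cancelling it against its
  -- image `k ≫ p ≫ s`, which has the same projection to `B`, leaves a homotopy over the constant
  -- one.
  obtain ⟨V, hV₀, hV₁, hV⟩ := exists_square_side₁ hp
    (CartesianMonoidalCategory.fst _ _ ≫ p ≫ s) k (k ≫ p ≫ s)
    ((CartesianMonoidalCategory.fst _ _ ▷ _) ≫ k ≫ p) (by simpa using hk₁)
    (by rw [reassoc_of% hk₁, ι₁_fst_assoc, reassoc_of% hs])
    (by rw [ι₁_comp_assoc, reassoc_of% hk₁]; simp [hs])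
    (by rw [← comp_whiskerRight_assoc, ι₀_fst, id_whiskerRight, Category.id_comp])
    (by rw [← comp_whiskerRight_assoc, ι₁_fst, id_whiskerRight, Category.id_comp]; simp [hs])
  refine trivialFibrations_of_vertical_homotopy hp s hs V (hV₀.trans hk₀) ?_ ?_
  · rw [hV₁, reassoc_of% hk₀]
  · rw [hV, ι₀_comp_assoc, reassoc_of% hk₀]

lemma nonempty_homotopy_curry_iff {A Y X : SSet.{w}} (g g' : A ⊗ Y ⟶ X) :
    Nonempty (Homotopy (MonoidalClosed.curry g) (MonoidalClosed.curry g')) ↔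
      Nonempty (Homotopy g g') := by
  have e₀ : A ◁ (ι₀ : Y ⟶ _) = ι₀ ≫ (α_ A Y Δ[1]).hom := rfl
  have e₁ : A ◁ (ι₁ : Y ⟶ _) = ι₁ ≫ (α_ A Y Δ[1]).hom := rfl
  simp only [nonempty_homotopy_iff]
  constructor
  · rintro ⟨h, h₀, h₁⟩
    refine ⟨(α_ _ _ _).hom ≫ MonoidalClosed.uncurry h, ?_, ?_⟩
    · rw [← Category.assoc, ← e₀, ← MonoidalClosed.uncurry_natural_left, h₀,
        MonoidalClosed.uncurry_curry]
    · rw [← Category.assoc, ← e₁, ← MonoidalClosed.uncurry_natural_left, h₁,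
        MonoidalClosed.uncurry_curry]
  · rintro ⟨h, h₀, h₁⟩
    refine ⟨MonoidalClosed.curry ((α_ _ _ _).inv ≫ h), ?_, ?_⟩
    · rw [← MonoidalClosed.curry_natural_left, e₀, Category.assoc, Iso.hom_inv_id_assoc, h₀]
    · rw [← MonoidalClosed.curry_natural_left, e₁, Category.assoc, Iso.hom_inv_id_assoc, h₁]

/-- Homotopy classes of maps from `S ⊗ A` to `K` are those from `A` to the internal hom from `S` to
`K`, which is again a Kan complex. -/
lemma kanWeakEquivalences_whiskerLeft {A M : SSet.{w}} {i : A ⟶ M} (hi : kanWeakEquivalences i)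
    (S : SSet.{w}) : kanWeakEquivalences (S ◁ i) := by
  intro K _
  refine ⟨fun a ↦ ?_, fun b b' h ↦ ?_⟩
  · obtain ⟨b, hb⟩ := (hi ((ihom S).obj K)).1 (MonoidalClosed.curry a)
    refine ⟨MonoidalClosed.uncurry b, ?_⟩
    rwa [← nonempty_homotopy_curry_iff, MonoidalClosed.curry_natural_left,
      MonoidalClosed.curry_uncurry]
  · rw [← nonempty_homotopy_curry_iff] at h ⊢
    refine (hi _).2 _ _ ?_
    simpa only [MonoidalClosed.curry_natural_left] using h

lemma kanWeakEquivalences_whiskerRight {A M : SSet.{w}} {i : A ⟶ M} (hi : kanWeakEquivalences i)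
    (S : SSet.{w}) : kanWeakEquivalences (i ▷ S) := by
  refine kanWeakEquivalences_of_postcomp (kanWeakEquivalences_of_isIso (β_ M S).hom) ?_
  rw [BraidedCategory.braiding_naturality_left]
  exact kanWeakEquivalences_comp (kanWeakEquivalences_of_isIso _)
    (kanWeakEquivalences_whiskerLeft hi S)

/-- Extending the evaluation map up to homotopy along `i ▷ _` and currying gives a homotopy inverse;
uniqueness of such extensions up to homotopy yields the other composite. -/
lemma kanWeakEquivalences_pre {A M : SSet.{w}} {i : A ⟶ M} (hi : kanWeakEquivalences i)
    (K : SSet.{w}) [KanComplex K] : kanWeakEquivalences ((MonoidalClosed.pre i).app K) := by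
  obtain ⟨b, hb⟩ := (kanWeakEquivalences_whiskerRight hi ((ihom A).obj K) K).1 ((ihom.ev A).app K)
  refine kanWeakEquivalences_of_homotopyEquivalence (MonoidalClosed.curry b) ?_ ?_
  · rw [← MonoidalClosed.curry_uncurry (𝟙 ((ihom M).obj K)), ← MonoidalClosed.curry_natural_left,
      nonempty_homotopy_curry_iff]
    refine (kanWeakEquivalences_whiskerRight hi ((ihom M).obj K) K).2 _ _ ?_
    have h := nonempty_homotopy_precomp (A ◁ (MonoidalClosed.pre i).app K) hb
    rwa [← whisker_exchange_assoc, MonoidalClosed.uncurry_id_eq_ev,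
      ← MonoidalClosed.id_tensor_pre_app_comp_ev]
  · rw [← MonoidalClosed.curry_uncurry (𝟙 ((ihom A).obj K)), MonoidalClosed.curry_pre_app,
      nonempty_homotopy_curry_iff, MonoidalClosed.uncurry_id_eq_ev]
    exact hb

lemma trivialFibrations_pre {A M : SSet.{w}} (i : A ⟶ M) [Mono i] (hi : kanWeakEquivalences i)
    (K : SSet.{w}) [KanComplex K] : trivialFibrations ((MonoidalClosed.pre i).app K) :=
  trivialFibrations_of_kanComplex
    ((fibration_iff _).1 (inferInstance : HomotopicalAlgebra.Fibration ((MonoidalClosed.pre i).app K)))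
    (kanWeakEquivalences_pre hi K)

/-- Monomorphisms that are weak equivalences have the left lifting property with respect to the
Kan fibrations between Kan complexes. -/
lemma hasLiftingProperty_of_kanComplex {A M : SSet.{w}} (i : A ⟶ M) [Mono i]
    (hi : kanWeakEquivalences i) {E B : SSet.{w}} [KanComplex E] [KanComplex B] {p : E ⟶ B}
    (hp : kanFibrations p) : HasLiftingProperty i p := by
  have : HomotopicalAlgebra.Fibration p := (fibration_iff _).2 hp
  -- The pullback-hom of `i` and `p` is a Kan fibration between Kan complexes. Its composite with
  -- the projection `sq.fst` and that projection itself are trivial fibrations, so it is a weak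
  -- equivalence and hence a trivial fibration.
  let sq := Functor.PullbackObjObj.ofHasPullback MonoidalClosed.internalHom i p
  have hfst : trivialFibrations sq.fst :=
    MorphismProperty.of_isPullback sq.isPullback.flip (trivialFibrations_pre i hi B)
  have hpre : trivialFibrations (sq.π ≫ sq.fst) := by
    rw [sq.π_fst]
    exact trivialFibrations_pre i hi E
  have hKan : KanComplex sq.pt :=
    kanComplex_of_kanFibration (B := (ihom A).obj E) (trivialFibrations_le_kanFibrations _ hfst)
  have hKan' : KanComplex ((MonoidalClosed.internalHom.obj (op M)).obj E) :=
    inferInstanceAs (KanComplex ((ihom M).obj E))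
  have hπ : trivialFibrations sq.π :=
    trivialFibrations_of_kanComplex ((fibration_iff _).1 (fibration_pullbackObjObjπ sq))
      (kanWeakEquivalences_of_postcomp (kanWeakEquivalences_of_trivialFibrations hfst)
        (kanWeakEquivalences_of_trivialFibrations hpre))
  -- Lifting the empty inclusion into the unit against the pullback-hom is lifting `i` against `p`.
  let sq' := Functor.PushoutObjObj.ofIsInitialRight (curriedTensor SSet.{w}) i
    (initial.to (𝟙_ SSet.{w})) initialIsInitial
  have h := (MonoidalClosed.internalHomAdjunction₂.hasLiftingProperty_iff sq' sq).2
    (trivialFibrations_lift _ hπ)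
  have h' : HasLiftingProperty (i ▷ 𝟙_ SSet.{w}) p := h
  refine (HasLiftingProperty.iff_of_arrow_iso_left (Arrow.isoMk (ρ_ A) (ρ_ M) ?_) p).1 h'
  exact (rightUnitor_naturality i).symm

/-! ### Extension of Kan fibrations along horn inclusions -/

/-- The inclusion of `L` in the cylinder `L ⊗ Δ[1]` at a vertex of `Δ[1]`. -/
abbrev endInclusion (L : SSet.{w}) (e : (Δ[1] : SSet.{w}) _⦋0⦌) : L ⟶ L ⊗ Δ[1] :=
  CartesianMonoidalCategory.lift (𝟙 L) (const e)

lemma endInclusion_naturality_assoc {K L Z : SSet.{w}} (f : K ⟶ L) (e : (Δ[1] : SSet.{w}) _⦋0⦌)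
    (g : L ⊗ Δ[1] ⟶ Z) :
    endInclusion K e ≫ f ▷ _ ≫ g = f ≫ endInclusion L e ≫ g := by
  have h : endInclusion K e ≫ f ▷ _ = f ≫ endInclusion L e := by ext : 1 <;> simp
  rw [reassoc_of% h]

/-- This is the lifting problem for `kanExtensionProj`: `D` and `D'` are the parts of `L` and `K`
lying over the horn, and `endInclusion X e' ≫ γ` is the transport `q`. The map `s'` comes from
reversing transport; a first choice of `y'` is then corrected by a vertical homotopy so that the
compatibility with `q` becomes strict. -/
lemma exists_kan_extension_lift {Λ X K L D D' : SSet.{w}} {p : X ⟶ Λ} (hp : kanFibrations p)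
    {e e' : (Δ[1] : SSet.{w}) _⦋0⦌} (he : anodyneExtensions (const e : Δ[0] ⟶ Δ[1]))
    (he' : anodyneExtensions (const e' : Δ[0] ⟶ Δ[1]))
    (h : Λ ⊗ Δ[1] ⟶ Λ) (hh : endInclusion Λ e ≫ h = 𝟙 Λ)
    (γ : X ⊗ Δ[1] ⟶ X) (hγ : γ ≫ p = p ▷ _ ≫ h) (hγe : endInclusion X e ≫ γ = 𝟙 X)
    (i : K ⟶ L) (hi : anodyneExtensions i) (j : D ⟶ L) [Mono j] (k : D' ⟶ K) (l : D' ⟶ D) [Mono l]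
    (w : k ≫ i = l ≫ j)
    (hpb : ∀ n a b, i.app n a = j.app n b → ∃ c, k.app n c = a ∧ l.app n c = b)
    (v : L ⟶ Λ) (d : D ⟶ Λ) (hd : j ≫ v = d ≫ endInclusion Λ e' ≫ h)
    (y : K ⟶ X) (hy : y ≫ p = i ≫ v) (s : D' ⟶ X) (hs : s ≫ p = l ≫ d)
    (hsy : s ≫ endInclusion X e' ≫ γ = k ≫ y) :
    ∃ (y' : L ⟶ X) (s' : D ⟶ X), i ≫ y' = y ∧ y' ≫ p = v ∧ l ≫ s' = s ∧ s' ≫ p = d ∧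
      s' ≫ endInclusion X e' ≫ γ = j ≫ y' := by
  have := anodyneExtensions_mono hi
  have := hi _ hp
  have sq : CommSq y i p v := ⟨hy⟩
  obtain ⟨y₀, hy₀, hy₀p⟩ : ∃ y₀ : L ⟶ X, i ≫ y₀ = y ∧ y₀ ≫ p = v :=
    ⟨sq.lift, sq.fac_left, sq.fac_right⟩
  -- Transport of `j ≫ y₀` backwards along `h`, from `e'` to `e`, relative to the given path on
  -- `D'`; its end at `e` is `s'`.
  obtain ⟨t, ht, htl, htp⟩ := exists_homotopy_lift_of_anodyne l p hp he' (j ≫ y₀) (s ▷ _ ≫ γ)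
    (d ▷ _ ≫ h) (by rw [endInclusion_naturality_assoc, hsy, ← hy₀, reassoc_of% w])
    (by rw [endInclusion_naturality_assoc, ← hd, Category.assoc, hy₀p])
    (by rw [Category.assoc, hγ, ← comp_whiskerRight_assoc, hs, comp_whiskerRight_assoc])
  obtain ⟨s', hs', hls', hs'p⟩ : ∃ s' : D ⟶ X, s' = endInclusion D e ≫ t ∧ l ≫ s' = s ∧
      s' ≫ p = d := by
    refine ⟨_, rfl, ?_, ?_⟩
    · rw [← endInclusion_naturality_assoc, htl, endInclusion_naturality_assoc, hγe,
        Category.comp_id]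
    · rw [Category.assoc, htp, endInclusion_naturality_assoc, hh, Category.comp_id]
  -- Both `t` and the transport of `s'` by `γ` are paths starting at `s'` over the same path in `Λ`.
  -- Filling the square between them produces, on the side at `e'`, a vertical homotopy `H` from `j
  -- ≫ y₀` to the transport of `s'`, constant on `D'`.
  obtain ⟨G, -, hG₀, hG₁, hGl, hGp⟩ := exists_square_lift_of_anodyne l hp he
    (CartesianMonoidalCategory.fst _ _ ≫ s') t (s' ▷ _ ≫ γ)
    ((CartesianMonoidalCategory.fst _ _ ▷ _) ≫ s ▷ _ ≫ γ)
    ((CartesianMonoidalCategory.fst _ _ ▷ _) ≫ d ▷ _ ≫ h)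
    (by rw [ι₀_fst_assoc, hs'])
    (by rw [endInclusion_naturality_assoc, hγe, ι₁_fst_assoc, Category.comp_id])
    (by rw [endInclusion_naturality_assoc, endInclusion_naturality_assoc, hγe, Category.comp_id,
      ← hls', CartesianMonoidalCategory.whiskerRight_fst_assoc])
    (by rw [← comp_whiskerRight_assoc, ι₀_fst, id_whiskerRight, Category.id_comp, htl])
    (by rw [← comp_whiskerRight_assoc, ι₁_fst, id_whiskerRight, Category.id_comp,
      ← comp_whiskerRight_assoc, hls'])
    (by rw [endInclusion_naturality_assoc, endInclusion_naturality_assoc, hh, Category.comp_id,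
      Category.assoc, hs'p])
    (by rw [← comp_whiskerRight_assoc, ι₀_fst, id_whiskerRight, Category.id_comp, htp])
    (by rw [← comp_whiskerRight_assoc, ι₁_fst, id_whiskerRight, Category.id_comp,
      Category.assoc, hγ, ← comp_whiskerRight_assoc, hs'p])
    (by simp only [Category.assoc, hγ]
        rw [← comp_whiskerRight_assoc s, hs, ← comp_whiskerRight_assoc (l ▷ _),
          CartesianMonoidalCategory.whiskerRight_fst]
        simp only [comp_whiskerRight, Category.assoc])
  obtain ⟨H, hH₀, hH₁, hHl, hHp⟩ : ∃ H : D ⊗ Δ[1] ⟶ X, ι₀ ≫ H = j ≫ y₀ ∧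
      ι₁ ≫ H = s' ≫ endInclusion X e' ≫ γ ∧
      l ▷ _ ≫ H = CartesianMonoidalCategory.fst _ _ ≫ k ≫ y ∧
      H ≫ p = CartesianMonoidalCategory.fst _ _ ≫ j ≫ v := by
    refine ⟨endInclusion _ e' ≫ G, ?_, ?_, ?_, ?_⟩
    · rw [← endInclusion_naturality_assoc, hG₀, ht]
    · rw [← endInclusion_naturality_assoc, hG₁, endInclusion_naturality_assoc]
    · rw [← endInclusion_naturality_assoc, hGl, endInclusion_naturality_assoc,
        endInclusion_naturality_assoc, hsy]
    · rw [Category.assoc, hGp, endInclusion_naturality_assoc, endInclusion_naturality_assoc, hd]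
  obtain ⟨u, hu₁, hu₂⟩ := exists_desc_range_sup_range (S := Δ[1]) i j
    (CartesianMonoidalCategory.fst _ _ ≫ y) H (by
      intro n a b t hab
      obtain ⟨c, rfl, rfl⟩ := hpb n a b hab
      exact (app_congr hHl n (c, t)).symm)
  have cases (n) (x : ((Subcomplex.range i ⊔ Subcomplex.range j : L.Subcomplex) : SSet).obj n) :
      (∃ a ha, x = ⟨i.app n a, ha⟩) ∨ (∃ b hb, x = ⟨j.app n b, hb⟩) := by
    obtain ⟨_, ⟨a, rfl⟩ | ⟨b, rfl⟩⟩ := x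
    exacts [Or.inl ⟨a, Or.inl ⟨a, rfl⟩, rfl⟩, Or.inr ⟨b, Or.inr ⟨b, rfl⟩, rfl⟩]
  -- The homotopy `H` on `D` and the constant one on `K` agree on the intersection, by `hpb`.
  -- Extending their union to `L` over the constant homotopy at `v` moves `y₀` to the required `y'`.
  obtain ⟨W, hW₀, hW, hWp⟩ := exists_homotopy_lift₀ (Subcomplex.range i ⊔ Subcomplex.range j).ι hp
    y₀ u (CartesianMonoidalCategory.fst _ _ ≫ v)
    (by
      ext n x
      obtain ⟨a, ha, rfl⟩ | ⟨b, hb, rfl⟩ := cases n x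
      · exact (hu₁ n a _ ha).trans (app_congr hy₀ n a).symm
      · exact (hu₂ n b _ hb).trans (app_congr hH₀ n b))
    (by rw [ι₀_fst_assoc, hy₀p])
    (by
      ext n ⟨x, t⟩
      obtain ⟨a, ha, rfl⟩ | ⟨b, hb, rfl⟩ := cases n x
      · exact (congrArg (p.app n) (hu₁ n a _ ha)).trans (app_congr hy n a)
      · exact (congrArg (p.app n) (hu₂ n b _ hb)).trans (app_congr hHp n (b, t)))
  refine ⟨ι₁ ≫ W, s', ?_, ?_, hls', hs'p, ?_⟩
  · ext n a
    exact (app_congr hW n (⟨i.app n a, Or.inl ⟨a, rfl⟩⟩,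
      ((ι₁ : L ⟶ L ⊗ Δ[1]).app n (i.app n a)).2)).trans (hu₁ n a _ _)
  · rw [Category.assoc, hWp, ι₁_fst_assoc]
  · rw [← hH₁]
    ext n b
    exact ((app_congr hW n (⟨j.app n b, Or.inr ⟨b, rfl⟩⟩,
      ((ι₁ : L ⟶ L ⊗ Δ[1]).app n (j.app n b)).2)).trans (hu₂ n b _ _)).symm

/-- Families of partially defined simplices, parametrized by the simplices of `Δ[n]`. -/
@[simps]
def partialFamilies (X : SSet.{w}) : SSet.{w} where
  obj n := ∀ m : SimplexCategoryᵒᵖ, (m.unop ⟶ n.unop) → Option (X.obj m)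
  map f := ↾fun s m g ↦ s m (g ≫ f.unop)

/-- Given a Kan fibration `p : X ⟶ A` over a subcomplex `A` of `B`, a retraction up to homotopy
`r : B ⟶ A` and a lift `q : X ⟶ X` of `A.ι ≫ r`, this is the simplicial set over `B` whose
simplices over `σ : Δ[n] ⟶ B` consist of a map `y : Δ[n] ⟶ X` over `σ ≫ r` and a map `s` over `A`
from the inverse image of `A` in `Δ[n]` to `X` such that `s ≫ q` is the restriction of `y`. -/
def kanExtension {B X : SSet.{w}} (A : B.Subcomplex) (r : B ⟶ A) (p : X ⟶ A) (q : X ⟶ X) :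
    (B ⊗ (X ⊗ partialFamilies X)).Subcomplex where
  obj n := { z | p.app n z.2.1 = r.app n z.1 ∧
    (∀ m (f : m.unop ⟶ n.unop) (x : X.obj m), z.2.2 m f = some x →
      ((p.app m x).1 = B.map f.op z.1 ∧ q.app m x = X.map f.op z.2.1)) ∧
    (∀ m (f : m.unop ⟶ n.unop), B.map f.op z.1 ∈ A.obj m → ∃ x, z.2.2 m f = some x) ∧
    (∀ m m' (g : m ⟶ m') (f : m.unop ⟶ n.unop) (x : X.obj m), z.2.2 m f = some x →
      z.2.2 m' (g.unop ≫ f) = some (X.map g x)) }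
  map {n n'} g := by
    rintro ⟨σ, y, s⟩ ⟨h₀, h₁, h₂, h₃⟩
    refine ⟨?_, fun m f x hx ↦ ?_, fun m f hf ↦ ?_, fun m m' g' f x hx ↦ ?_⟩
    · refine (NatTrans.naturality_apply p g y).trans ((congrArg _ h₀).trans ?_)
      exact (NatTrans.naturality_apply r g σ).symm
    · obtain ⟨h₄, h₅⟩ := h₁ m (f ≫ g.unop) x hx
      exact ⟨h₄.trans (Functor.map_comp_apply B g f.op σ),
        h₅.trans (Functor.map_comp_apply X g f.op y)⟩
    · refine h₂ m (f ≫ g.unop) ?_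
      have : B.map (f ≫ g.unop).op σ = B.map f.op (B.map g σ) := Functor.map_comp_apply B g f.op σ
      rwa [this]
    · have := h₃ m m' g' (f ≫ g.unop) x hx
      rwa [← Category.assoc] at this

section

variable {B X : SSet.{w}} {A : B.Subcomplex} {r : B ⟶ A} {p : X ⟶ A} {q : X ⟶ X}

/-- The inclusion of a Kan fibration in its extension. -/
def toKanExtension (hq : q ≫ p = p ≫ A.ι ≫ r) : X ⟶ (kanExtension A r p q : SSet) :=
  Subcomplex.lift (CartesianMonoidalCategory.lift (p ≫ A.ι) (CartesianMonoidalCategory.lift q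
    { app n := ↾fun x m f ↦ some (X.map f.op x)
      naturality n n' g := by
        ext x
        funext m f
        exact congrArg some (Functor.map_comp_apply X g f.op x).symm })) (by
    rintro n _ ⟨x, rfl⟩
    refine ⟨app_congr hq n x, fun m f x' hx' ↦ ?_, fun m f hf ↦ ⟨_, rfl⟩, fun m m' g f x' hx' ↦ ?_⟩
    · obtain rfl : X.map f.op x = x' := Option.some.inj hx'
      exact ⟨congrArg Subtype.val (NatTrans.naturality_apply p f.op x),
        NatTrans.naturality_apply q f.op x⟩
    · obtain rfl : X.map f.op x = x' := Option.some.inj hx'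
      exact congrArg some (Functor.map_comp_apply X f.op g x))

/-- The projection of the extension of a Kan fibration. -/
def kanExtensionProj (A : B.Subcomplex) (r : B ⟶ A) (p : X ⟶ A) (q : X ⟶ X) :
    (kanExtension A r p q : SSet) ⟶ B :=
  (kanExtension A r p q).ι ≫ CartesianMonoidalCategory.fst _ _

lemma toKanExtension_injective (hq : q ≫ p = p ≫ A.ι ≫ r) (n : SimplexCategoryᵒᵖ) :
    Function.Injective ((toKanExtension hq).app n) := by
  intro x x' h
  have h' := congrArg (fun z : (kanExtension A r p q : SSet).obj n ↦ z.1.2.2 n (𝟙 _)) h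
  have h'' : X.map (𝟙 n) x = X.map (𝟙 n) x' := Option.some.inj h'
  simpa using h''

/-- When the base simplex lies in `A`, the partial family is defined everywhere, and its value at
the identity determines both the family and the component `y`. Hence the extension restricts over
`A` to `X` itself. -/
lemma exists_toKanExtension_eq (hq : q ≫ p = p ≫ A.ι ≫ r) {n : SimplexCategoryᵒᵖ}
    (z : (kanExtension A r p q : SSet).obj n)
    (hz : (kanExtensionProj A r p q).app n z ∈ A.obj n) :
    ∃ x, (toKanExtension hq).app n x = z := by
  obtain ⟨⟨σ, y, s⟩, h₀, h₁, h₂, h₃⟩ := z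
  change σ ∈ A.obj n at hz
  obtain ⟨x, hx⟩ := h₂ n (𝟙 _) (by
    have : B.map (𝟙 n) σ = σ := by simp
    exact this.symm ▸ hz)
  obtain ⟨h₄, h₅⟩ := h₁ n (𝟙 _) x hx
  have h₄' : (p.app n x).1 = σ := h₄.trans (by change B.map (𝟙 n) σ = σ; simp)
  have h₅' : q.app n x = y := h₅.trans (by change X.map (𝟙 n) y = y; simp)
  refine ⟨x, Subtype.ext (Prod.ext h₄' (Prod.ext h₅' ?_))⟩
  funext m f
  have := h₃ n m f.op (𝟙 _) x hx
  rw [show f.op.unop ≫ 𝟙 n.unop = f from Category.comp_id f] at this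
  exact this.symm

/-- A map into the extension over `v : L ⟶ B` is a map `y` from `L` over `v ≫ r` together with a map
`s` from the preimage of `A` satisfying `s ≫ q = y` there. The proof unpacks such a pair on `K`,
extends it by `exists_kan_extension_lift`, and packs it again. -/
lemma kanFibrations_kanExtensionProj (hp : kanFibrations p) {e e' : (Δ[1] : SSet.{w}) _⦋0⦌}
    (he : anodyneExtensions (const e : Δ[0] ⟶ Δ[1]))
    (he' : anodyneExtensions (const e' : Δ[0] ⟶ Δ[1]))
    (h : (A : SSet) ⊗ Δ[1] ⟶ A) (hh : endInclusion _ e ≫ h = 𝟙 _)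
    (hr : A.ι ≫ r = endInclusion _ e' ≫ h)
    (γ : X ⊗ Δ[1] ⟶ X) (hγ : γ ≫ p = p ▷ _ ≫ h) (hγe : endInclusion X e ≫ γ = 𝟙 X)
    (hq : endInclusion X e' ≫ γ = q) : kanFibrations (kanExtensionProj A r p q) := by
  intro K L i hi
  replace hi : anodyneExtensions i := J.le_llp_rlp _ hi
  refine ⟨fun {u v} sq ↦ ?_⟩
  have hsq (n) (a : K.obj n) : (u.app n a).1.1 = v.app n (i.app n a) := app_congr sq.w n a
  have h₀ (n) (z : (kanExtension A r p q : SSet).obj n) :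
    p.app n z.1.2.1 = r.app n z.1.1 := z.2.1
  have h₁ (n) (z : (kanExtension A r p q : SSet).obj n) := z.2.2.1
  have h₂ (n) (z : (kanExtension A r p q : SSet).obj n) := z.2.2.2.1
  have h₃ (n) (z : (kanExtension A r p q : SSet).obj n) := z.2.2.2.2
  have hu (n n') (g : n ⟶ n') (a : K.obj n) : u.app n' (K.map g a) =
      (kanExtension A r p q : SSet).map g (u.app n a) := NatTrans.naturality_apply u g a
  have hs (n) (a : (((A.preimage v).preimage i : K.Subcomplex) : SSet).obj n) :
      ∃ x, (u.app n a.1).1.2.2 n (𝟙 _) = some x := by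
    refine h₂ n _ n (𝟙 _) ?_
    have : B.map (𝟙 n) (u.app n a.1).1.1 = v.app n (i.app n a.1) := by simp [hsq]
    exact this.symm ▸ a.2
  choose s hs using hs
  have hsq' (n) (a : (((A.preimage v).preimage i : K.Subcomplex) : SSet).obj n) :
      (p.app n (s n a)).1 = v.app n (i.app n a.1) ∧ q.app n (s n a) = (u.app n a.1).1.2.1 := by
    obtain ⟨h₄, h₅⟩ := h₁ n (u.app n a.1) n (𝟙 _) _ (hs n a)
    refine ⟨h₄.trans ?_, h₅.trans ?_⟩
    · change B.map (𝟙 n) (u.app n a.1).1.1 = _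
      simp [hsq]
    · change X.map (𝟙 n) (u.app n a.1).1.2.1 = _
      simp
  let S : (((A.preimage v).preimage i : K.Subcomplex) : SSet) ⟶ X :=
    { app n := ↾s n
      naturality n n' g := by
        ext a
        have h₄ := hs n' (((A.preimage v).preimage i : SSet).map g a)
        have h₅ : (u.app n' (K.map g a.1)).1.2.2 n' (𝟙 _) = some (X.map g (s n a)) := by
          rw [hu]
          refine Eq.trans ?_ (h₃ n (u.app n a.1) n n' g (𝟙 _) _ (hs n a))
          change (u.app n a.1).1.2.2 n' (𝟙 _ ≫ g.unop) = (u.app n a.1).1.2.2 n' (g.unop ≫ 𝟙 _)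
          rw [Category.id_comp, Category.comp_id]
        exact Option.some.inj (h₄.symm.trans h₅) }
  have := anodyneExtensions_mono hi
  have : Mono ((A.preimage v).fromPreimage i) := by
    have : Mono ((A.preimage v).fromPreimage i ≫ (A.preimage v).ι) := by
      rw [Subcomplex.fromPreimage_ι]
      infer_instance
    exact mono_of_mono _ (A.preimage v).ι
  obtain ⟨y', s', hiy, hy'p, hs's, hs'p, hs'q⟩ := exists_kan_extension_lift hp he he' h hh γ hγ hγe
    i hi (A.preimage v).ι ((A.preimage v).preimage i).ι ((A.preimage v).fromPreimage i) rfl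
    (fun n a b hab ↦ ⟨⟨a, by
      change i.app n a ∈ (A.preimage v).obj n
      rw [hab]
      exact b.2⟩, rfl, Subtype.ext hab⟩) (v ≫ r) (A.fromPreimage v)
    (by rw [← hr]; rfl)
    (u ≫ (kanExtension A r p q).ι ≫ CartesianMonoidalCategory.snd _ _ ≫
      CartesianMonoidalCategory.fst _ _)
    (by
      ext n a
      exact (h₀ n (u.app n a)).trans (congrArg (r.app n) (hsq n a))) S
    (by
      ext n a
      exact Subtype.ext (hsq' n a).1)
    (by
      rw [hq]
      ext n a
      exact (hsq' n a).2)
  rw [hq] at hs'q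
  classical
  let G (m : SimplexCategoryᵒᵖ) (z : L.obj m) : Option (X.obj m) :=
    if hz : z ∈ (A.preimage v).obj m then some (s'.app m ⟨z, hz⟩) else none
  let F : L ⟶ partialFamilies X :=
    { app n := ↾fun x m f ↦ G m (L.map f.op x)
      naturality n n' g := by
        ext x
        funext m f
        exact congrArg (G m) (Functor.map_comp_apply L g f.op x).symm }
  have hF (n x m f) : F.app n x m f = if hx : L.map f.op x ∈ (A.preimage v).obj m then
        some (s'.app m ⟨L.map f.op x, hx⟩) else none := rfl
  refine ⟨⟨Subcomplex.lift (CartesianMonoidalCategory.lift v (CartesianMonoidalCategory.lift y' F))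
    ?_, ?_, rfl⟩⟩
  · rintro n _ ⟨x, rfl⟩
    have hmem (m) (f : m.unop ⟶ n.unop) : L.map f.op x ∈ (A.preimage v).obj m ↔
        B.map f.op (v.app n x) ∈ A.obj m := by
      rw [← NatTrans.naturality_apply v f.op x]
      rfl
    refine ⟨app_congr hy'p n x, fun m f t ht ↦ ?_, fun m f hf ↦ ?_, fun m m' g f t ht ↦ ?_⟩
    · by_cases hx : L.map f.op x ∈ (A.preimage v).obj m
      · have ht' : F.app n x m f = some t := ht
        rw [hF, dif_pos hx] at ht'
        obtain rfl := Option.some.inj ht'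
        refine ⟨?_, ?_⟩
        · refine (congrArg Subtype.val (app_congr hs'p m ⟨L.map f.op x, hx⟩)).trans ?_
          change v.app m (L.map f.op x) = B.map f.op (v.app n x)
          exact NatTrans.naturality_apply v f.op x
        · exact (app_congr hs'q m ⟨L.map f.op x, hx⟩).trans (NatTrans.naturality_apply y' f.op x)
      · have ht' : F.app n x m f = some t := ht
        rw [hF, dif_neg hx] at ht'
        exact (Option.some_ne_none _ ht'.symm).elim
    · exact ⟨_, dif_pos ((hmem m f).2 hf)⟩
    · by_cases hx : L.map f.op x ∈ (A.preimage v).obj m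
      · have ht' : F.app n x m f = some t := ht
        rw [hF, dif_pos hx] at ht'
        obtain rfl := Option.some.inj ht'
        have e : L.map g (L.map f.op x) = L.map (g.unop ≫ f).op x :=
          (Functor.map_comp_apply L f.op g x).symm
        have hx' : L.map (g.unop ≫ f).op x ∈ (A.preimage v).obj m' := by
          rw [← e]
          exact (A.preimage v).map g hx
        refine (dif_pos hx').trans (congrArg some ?_)
        refine Eq.trans ?_ (NatTrans.naturality_apply s' g ⟨L.map f.op x, hx⟩)
        exact congrArg (s'.app m') (Subtype.ext e.symm)
      · have ht' : F.app n x m f = some t := ht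
        rw [hF, dif_neg hx] at ht'
        exact (Option.some_ne_none _ ht'.symm).elim
  · ext n a
    refine Subtype.ext (Prod.ext (hsq n a).symm (Prod.ext (app_congr hiy n a) ?_))
    funext m f
    have e : L.map f.op (i.app n a) = i.app m (K.map f.op a) :=
      (NatTrans.naturality_apply i f.op a).symm
    have e' : (u.app n a).1.2.2 m f = (u.app m (K.map f.op a)).1.2.2 m (𝟙 _) := by
      rw [hu]
      change _ = (u.app n a).1.2.2 m (𝟙 _ ≫ f)
      rw [Category.id_comp]
    change F.app n (i.app n a) m f = _
    rw [hF]
    refine Eq.trans ?_ e'.symm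
    by_cases hx : L.map f.op (i.app n a) ∈ (A.preimage v).obj m
    · have hx' : i.app m (K.map f.op a) ∈ (A.preimage v).obj m := e ▸ hx
      rw [dif_pos hx, hs m ⟨K.map f.op a, hx'⟩]
      refine congrArg some (Eq.trans ?_ (app_congr hs's m ⟨K.map f.op a, hx'⟩))
      exact congrArg (s'.app m) (Subtype.ext e)
    -- Outside the preimage of `A` the new family is undefined. So is the old one, since a defined
    -- value has to project to `A`.
    · rw [dif_neg hx]
      cases ht : (u.app m (K.map f.op a)).1.2.2 m (𝟙 _) with
      | none => rfl
      | some t =>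
        refine (hx ?_).elim
        have h₄ := (h₁ m _ m (𝟙 _) t ht).1
        rw [e]
        change v.app m (i.app m (K.map f.op a)) ∈ A.obj m
        rw [← hsq]
        have : B.map (𝟙 m) (u.app m (K.map f.op a)).1.1 = (u.app m (K.map f.op a)).1.1 := by simp
        rw [← this]
        exact h₄ ▸ (p.app m t).2

end

/-! ### Contractions of horns -/

/-- The map `Δ[n] ⊗ Δ[1] ⟶ Δ[n]` given by a monotone map. -/
def stdSimplexHomotopy {n : ℕ} (φ : Fin 2 × Fin (n + 1) →o Fin (n + 1)) :
    (Δ[n] ⊗ Δ[1] : SSet.{w}) ⟶ Δ[n] where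
  app m := ↾fun z ↦ stdSimplex.objMk (φ.comp
    ((stdSimplex.asOrderHom (n := 1) z.2).prod (stdSimplex.asOrderHom (n := n) z.1)))

lemma anodyneExtensions_const (i : Fin 2) :
    anodyneExtensions.{w} (const (stdSimplex.obj₀Equiv.{w}.symm i) : Δ[0] ⟶ Δ[1]) := by
  rw [← stdSimplex_δ_eq_const]
  exact anodyneExtensions_stdSimplex_δ _

/-- A simplex omitting a vertex `l ≠ k` still omits it after a deformation that fixes each vertex or
sends it to `k`, so the horn is preserved. At the end `i'` the vertex `j` is omitted throughout, so
the whole simplex lands in the horn. -/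
lemma exists_horn_contraction_of_orderHom {n : ℕ} (k : Fin (n + 1))
    (φ : Fin 2 × Fin (n + 1) →o Fin (n + 1)) (i i' : Fin 2) (hφ : ∀ x, φ (i, x) = x)
    (hφk : ∀ t x, φ (t, x) = x ∨ φ (t, x) = k) (j : Fin (n + 1)) (hj : j ≠ k)
    (hφj : ∀ x, φ (i', x) ≠ j) :
    ∃ (e e' : (Δ[1] : SSet.{w}) _⦋0⦌) (r : Δ[n] ⟶ (Λ[n, k] : SSet.{w}))
      (h : (Λ[n, k] : SSet.{w}) ⊗ Δ[1] ⟶ Λ[n, k]),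
      anodyneExtensions (const e : Δ[0] ⟶ Δ[1]) ∧ anodyneExtensions (const e' : Δ[0] ⟶ Δ[1]) ∧
      endInclusion _ e ≫ h = 𝟙 _ ∧ Λ[n, k].ι ≫ r = endInclusion _ e' ≫ h := by
  refine ⟨stdSimplex.obj₀Equiv.symm i, stdSimplex.obj₀Equiv.symm i',
    Subcomplex.lift (endInclusion _ (stdSimplex.obj₀Equiv.symm i') ≫ stdSimplexHomotopy φ) ?_,
    Subcomplex.lift (Λ[n, k].ι ▷ _ ≫ stdSimplexHomotopy φ) ?_,
    anodyneExtensions_const i, anodyneExtensions_const i', ?_, ?_⟩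
  · rintro ⟨⟨m⟩⟩ _ ⟨x, rfl⟩
    rw [mem_horn_iff_notMem_range]
    refine ⟨j, hj, ?_⟩
    rintro ⟨a, ha⟩
    exact hφj _ ha
  · rintro ⟨⟨m⟩⟩ _ ⟨⟨⟨x, hx⟩, t⟩, rfl⟩
    rw [mem_horn_iff_notMem_range] at hx ⊢
    obtain ⟨l, hl, hlx⟩ := hx
    refine ⟨l, hl, ?_⟩
    rintro ⟨a, ha⟩
    change φ _ = l at ha
    rcases hφk (stdSimplex.asOrderHom (n := 1) t a) (stdSimplex.asOrderHom (n := n) x a) with h | h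
    · exact hlx ⟨a, h.symm.trans ha⟩
    · exact hl (ha.symm.trans h)
  · ext ⟨⟨m⟩⟩ x
    refine Subtype.ext ?_
    refine SSet.stdSimplex.ext _ _ fun a ↦ ?_
    exact hφ _
  · rfl

lemma exists_horn_contraction {n : ℕ} (k : Fin (n + 2)) :
    ∃ (e e' : (Δ[1] : SSet.{w}) _⦋0⦌) (r : Δ[n + 1] ⟶ (Λ[n + 1, k] : SSet.{w}))
      (h : (Λ[n + 1, k] : SSet.{w}) ⊗ Δ[1] ⟶ Λ[n + 1, k]),
      anodyneExtensions (const e : Δ[0] ⟶ Δ[1]) ∧ anodyneExtensions (const e' : Δ[0] ⟶ Δ[1]) ∧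
      endInclusion _ e ≫ h = 𝟙 _ ∧ Λ[n + 1, k].ι ≫ r = endInclusion _ e' ≫ h := by
  -- Monotonicity in the time parameter fixes the direction. For the last vertex one moves from the
  -- identity to `max x k`, which omits `0`; otherwise from `min x k`, which omits the last vertex,
  -- to the identity. This is why both vertices `e` and `e'` are part of the output.
  by_cases hk : k = Fin.last (n + 1)
  · refine exists_horn_contraction_of_orderHom k
      ⟨fun z ↦ if z.1 = 0 then z.2 else max z.2 k, ?_⟩ 0 1 (fun x ↦ rfl) (fun t x ↦ ?_) 0
      (by rw [hk]; exact (Fin.last_pos).ne) (fun x h ↦ ?_)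
    · rintro ⟨t, x⟩ ⟨t', x'⟩ ⟨h, h'⟩
      dsimp at h h' ⊢
      split_ifs with h₁ h₂ h₂
      · exact h'
      · exact h'.trans (le_max_left _ _)
      · lia
      · exact max_le_max_right _ h'
    · change (if t = 0 then x else max x k) = x ∨ (if t = 0 then x else max x k) = k
      split_ifs
      · exact Or.inl rfl
      · exact max_choice _ _
    · have : max x k = 0 := h
      rw [hk] at this
      have h' := (le_max_right x (Fin.last (n + 1))).trans this.le
      exact (Fin.last_pos.not_ge h').elim
  · refine exists_horn_contraction_of_orderHom k
      ⟨fun z ↦ if z.1 = 1 then z.2 else min z.2 k, ?_⟩ 1 0 (fun x ↦ rfl) (fun t x ↦ ?_)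
      (Fin.last (n + 1)) (Ne.symm hk) (fun x h ↦ ?_)
    · rintro ⟨t, x⟩ ⟨t', x'⟩ ⟨h, h'⟩
      dsimp at h h' ⊢
      split_ifs with h₁ h₂ h₂
      · exact h'
      · lia
      · exact (min_le_left _ _).trans h'
      · exact min_le_min_right _ h'
    · change (if t = 1 then x else min x k) = x ∨ (if t = 1 then x else min x k) = k
      split_ifs
      · exact Or.inl rfl
      · exact min_choice _ _
    · have : min x k = Fin.last (n + 1) := h
      exact hk (Fin.last_le_iff.1 (this.symm.le.trans (min_le_right _ _)))

/-! ### Sets that are closed under countable products -/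

lemma nonempty_embedding_pi {T : Type w} [Nonempty T] (c : (ℕ → T) ↪ T) {ι : Type*} [Countable ι]
    {α : ι → Type*} (hα : ∀ i, Nonempty (α i ↪ T)) : Nonempty ((∀ i, α i) ↪ T) := by
  classical
  obtain ⟨ν, hν⟩ := exists_injective_nat ι
  let f (i) : α i ↪ T := (hα i).some
  refine ⟨⟨fun a ↦ c (Function.extend ν (fun i ↦ f i (a i)) fun _ ↦ Classical.arbitrary T),
    fun a a' h ↦ ?_⟩⟩
  funext i
  have := congrFun (c.injective h) (ν i)
  simpa [hν.extend_apply] using this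

lemma nonempty_embedding_prod {T : Type w} (c : (ℕ → T) ↪ T) {α β : Type*}
    (hα : Nonempty (α ↪ T)) (hβ : Nonempty (β ↪ T)) : Nonempty (α × β ↪ T) := by
  obtain ⟨f⟩ := hα
  obtain ⟨g⟩ := hβ
  refine ⟨⟨fun z ↦ c (fun n ↦ if n = 0 then f z.1 else g z.2), fun z z' h ↦ ?_⟩⟩
  have h₀ := congrFun (c.injective h) 0
  have h₁ := congrFun (c.injective h) 1
  exact Prod.ext (f.injective (by simpa using h₀)) (g.injective (by simpa using h₁))

/-- Two distinct labels suffice to encode indicator functions of singletons. -/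
lemma nonempty_embedding_of_countable {T : Type w} [Nontrivial T] (c : (ℕ → T) ↪ T)
    (α : Type*) [Countable α] : Nonempty (α ↪ T) := by
  classical
  obtain ⟨ν, hν⟩ := exists_injective_nat α
  obtain ⟨a, b, hab⟩ := exists_pair_ne T
  refine ⟨⟨fun x ↦ c (fun n ↦ if n = ν x then a else b), fun x x' h ↦ hν ?_⟩⟩
  have := congrFun (c.injective h) (ν x)
  by_contra h'
  simp [h', hab] at this

lemma nonempty_embedding_option {T : Type w} [Nontrivial T] (c : (ℕ → T) ↪ T) {α : Type*}
    (hα : Nonempty (α ↪ T)) : Nonempty (Option α ↪ T) := by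
  obtain ⟨f⟩ := hα
  obtain ⟨g⟩ := nonempty_embedding_prod c (nonempty_embedding_of_countable c Bool) ⟨.refl T⟩
  refine ⟨.trans ⟨fun x ↦ x.elim (false, Classical.arbitrary T) (fun a ↦ (true, f a)), ?_⟩ g⟩
  rintro (_ | x) (_ | x') h <;> simp_all

instance : Countable SimplexCategoryᵒᵖ :=
  Function.Injective.countable (f := fun m : SimplexCategoryᵒᵖ ↦ m.unop.len) fun _ _ h ↦
    Opposite.unop_injective (SimplexCategory.ext h)

instance : Countable SimplexCategory :=
  Function.Injective.countable (f := fun m : SimplexCategory ↦ m.len) fun _ _ h ↦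
    SimplexCategory.ext h

instance (m n : SimplexCategory) : Countable (m ⟶ n) :=
  Function.Injective.countable (f := fun f ↦ (f.toOrderHom : Fin (m.len + 1) → Fin (n.len + 1)))
    fun _ _ h ↦ SimplexCategory.Hom.ext _ _ (OrderHom.ext _ _ h)

instance (n : ℕ) (m : SimplexCategoryᵒᵖ) : Countable ((Δ[n] : SSet.{w}).obj m) :=
  stdSimplex.objEquiv.injective.countable

lemma nonempty_embedding_cofree {T : Type w} [Nontrivial T] (c : (ℕ → T) ↪ T)
    (m : SimplexCategoryᵒᵖ) : Nonempty ((cofree T).obj m ↪ T) :=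
  nonempty_embedding_pi c (ι := Σ n : SimplexCategory, (n ⟶ m.unop)) (α := fun _ ↦ T)
    fun _ ↦ ⟨.refl T⟩

lemma nonempty_embedding_partialFamilies {T : Type w} [Nontrivial T] (c : (ℕ → T) ↪ T)
    {X : SSet.{w}} (hX : ∀ m, Nonempty (X.obj m ↪ T)) (m : SimplexCategoryᵒᵖ) :
    Nonempty ((partialFamilies X).obj m ↪ T) :=
  nonempty_embedding_pi c (α := fun n : SimplexCategoryᵒᵖ ↦ (n.unop ⟶ m.unop) → Option (X.obj n))
    fun n ↦ nonempty_embedding_pi c (α := fun _ : n.unop ⟶ m.unop ↦ Option (X.obj n))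
      fun _ ↦ nonempty_embedding_option c (hX n)

/-! ### A universe of Kan fibrations -/

/-- A subcomplex `Q` of `B ⊗ S` is Kan over `B` if the projection `Q ⟶ B` is a Kan fibration. -/
def IsKanOver {B S : SSet.{w}} (Q : (B ⊗ S).Subcomplex) : Prop :=
  kanFibrations (Q.ι ≫ CartesianMonoidalCategory.fst B S)

/-- The projection of the preimage is a base change of that of `Q`. The statement concerns a single
map `i`, since it also serves for acyclic monomorphisms not yet known to be anodyne. -/
lemma exists_lift_preimage {B B' S : SSet.{w}} {Q : (B ⊗ S).Subcomplex} (f : B' ⟶ B)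
    {K L : SSet.{w}} (i : K ⟶ L) (u : K ⟶ (Q.preimage (f ▷ S) : SSet)) (v : L ⟶ B')
    (h : u ≫ (Q.preimage (f ▷ S)).ι ≫ CartesianMonoidalCategory.fst _ _ = i ≫ v)
    (hQ : HasLiftingProperty i (Q.ι ≫ CartesianMonoidalCategory.fst B S)) :
    ∃ l : L ⟶ (Q.preimage (f ▷ S) : SSet), i ≫ l = u ∧
      l ≫ (Q.preimage (f ▷ S)).ι ≫ CartesianMonoidalCategory.fst _ _ = v := by
  have sq : CommSq (u ≫ Q.fromPreimage (f ▷ S)) i (Q.ι ≫ CartesianMonoidalCategory.fst B S)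
    (v ≫ f) := ⟨by
      simp only [Category.assoc, Subcomplex.fromPreimage_ι_assoc,
        CartesianMonoidalCategory.whiskerRight_fst] at h ⊢
      rw [reassoc_of% h]⟩
  refine ⟨Subcomplex.lift (CartesianMonoidalCategory.lift v
    (sq.lift ≫ Q.ι ≫ CartesianMonoidalCategory.snd _ _)) ?_, ?_, rfl⟩
  · rintro n _ ⟨x, rfl⟩
    have h₁ : (f.app n (v.app n x), (sq.lift.app n x).1.2) = (sq.lift.app n x).1 :=
      Prod.ext (app_congr sq.fac_right n x).symm rfl
    change (f.app n (v.app n x), (sq.lift.app n x).1.2) ∈ Q.obj n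
    exact h₁ ▸ (sq.lift.app n x).2
  · ext n x
    refine Subtype.ext (Prod.ext (app_congr h n x).symm ?_)
    exact congrArg (fun z : (Q : SSet).obj n ↦ z.1.2) (app_congr sq.fac_left n x)

lemma IsKanOver.preimage {B B' S : SSet.{w}} {Q : (B ⊗ S).Subcomplex} (hQ : IsKanOver Q)
    (f : B' ⟶ B) : IsKanOver (Q.preimage (f ▷ S)) := by
  intro K L i hi
  refine ⟨fun {u v} sq ↦ ?_⟩
  obtain ⟨l, h₁, h₂⟩ := exists_lift_preimage f i u v sq.w (hQ _ hi)
  exact ⟨⟨l, h₁, h₂⟩⟩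

/-- A horn-filling problem involves the base only through one simplex, the target of the horn
inclusion. -/
lemma isKanOver_of_preimage {B S : SSet.{w}} {Q : (B ⊗ S).Subcomplex}
    (hQ : ∀ (n : ℕ) (x : B _⦋n⦌), IsKanOver (Q.preimage (yonedaEquiv.symm x ▷ S))) :
    IsKanOver Q := by
  intro K L i hi
  have hi' := hi
  simp only [J, MorphismProperty.iSup_iff] at hi'
  obtain ⟨m, ⟨k⟩⟩ := hi'
  refine ⟨fun {u v} sq ↦ ?_⟩
  obtain ⟨x, rfl⟩ := yonedaEquiv.symm.surjective v
  let u' : (Λ[m + 1, k] : SSet.{w}) ⟶ (Q.preimage (yonedaEquiv.symm x ▷ S) : SSet) :=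
    Subcomplex.lift (CartesianMonoidalCategory.lift Λ[m + 1, k].ι
      (u ≫ Q.ι ≫ CartesianMonoidalCategory.snd _ _)) (by
      rintro n _ ⟨a, rfl⟩
      have h₁ : ((yonedaEquiv.symm x).app n a.1, (u.app n a).1.2) = (u.app n a).1 :=
        Prod.ext (app_congr sq.w n a).symm rfl
      change ((yonedaEquiv.symm x).app n a.1, (u.app n a).1.2) ∈ Q.obj n
      exact h₁ ▸ (u.app n a).2)
  have := hQ _ x _ hi
  have sq' : CommSq u' Λ[m + 1, k].ι ((Q.preimage (yonedaEquiv.symm x ▷ S)).ι ≫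
    CartesianMonoidalCategory.fst _ _) (𝟙 _) := ⟨rfl⟩
  refine ⟨⟨sq'.lift ≫ Q.fromPreimage _, ?_, ?_⟩⟩
  · rw [sq'.fac_left_assoc]
    ext n a
    exact Subtype.ext (Prod.ext (app_congr sq.w n a).symm rfl)
  · have := sq'.fac_right =≫ yonedaEquiv.symm x
    simpa only [Category.assoc, Subcomplex.fromPreimage_ι_assoc,
      CartesianMonoidalCategory.whiskerRight_fst, Category.id_comp] using this

/-- Subobjects of `Λ[n + 1, k] ⊗ cofree T` that are Kan over the horn extend to `Δ[n + 1]`. -/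
lemma IsKanOver.exists_horn_extension {T : Type w} [Nontrivial T] (c : (ℕ → T) ↪ T) {n : ℕ}
    (k : Fin (n + 2)) {Q : ((Λ[n + 1, k] : SSet.{w}) ⊗ cofree T).Subcomplex} (hQ : IsKanOver Q) :
    ∃ P : (Δ[n + 1] ⊗ cofree T).Subcomplex, IsKanOver P ∧
      P.preimage (Λ[n + 1, k].ι ▷ cofree T) = Q := by
  obtain ⟨e, e', r, h, he, he', hh, hr⟩ := exists_horn_contraction.{w} k
  let p : (Q : SSet) ⟶ Λ[n + 1, k] := Q.ι ≫ CartesianMonoidalCategory.fst _ _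
  have hp : kanFibrations p := hQ
  have hQ' (n) := isEmpty_tensor_obj (isEmpty_bot_obj (Q : SSet) n) (Δ[1] : SSet.{w})
  -- Transport in the fibration along the contraction of the horn, starting from the identity at
  -- `e`.
  obtain ⟨γ, hγe, -, hγ⟩ := exists_homotopy_lift_of_anodyne (⊥ : (Q : SSet).Subcomplex).ι p hp he
    (𝟙 (Q : SSet)) (homOfIsEmpty hQ' _) (p ▷ _ ≫ h)
    (hom_ext_of_isEmpty (isEmpty_bot_obj _) _ _)
    (by rw [endInclusion_naturality_assoc, hh, Category.comp_id, Category.id_comp])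
    (hom_ext_of_isEmpty hQ' _ _)
  let q : (Q : SSet) ⟶ Q := endInclusion _ e' ≫ γ
  have hq : q ≫ p = p ≫ Λ[n + 1, k].ι ≫ r := by
    rw [hr, ← endInclusion_naturality_assoc, ← hγ, Category.assoc]
  let φ := toKanExtension (r := r) (p := p) hq
  have hφ : Mono φ := by
    have (m : SimplexCategoryᵒᵖ) : Mono (φ.app m) := (CategoryTheory.mono_iff_injective _).2
      (toKanExtension_injective hq m)
    exact NatTrans.mono_of_mono_app _
  let π := kanExtensionProj Λ[n + 1, k] r p q
  have hπ : kanFibrations π := kanFibrations_kanExtensionProj hp he he' h hh hr γ hγ hγe rfl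
  -- Closure of `T` under countable powers enters here: a simplex of the extension is a countable
  -- amount of data in `Q`, so the extension can be labelled injectively by `T`.
  have hlabel (m : SimplexCategoryᵒᵖ) :
      Nonempty ((kanExtension Λ[n + 1, k] r p q : SSet).obj m ↪ T) := by
    have hX (m) : Nonempty ((Q : SSet).obj m ↪ T) := by
      obtain ⟨g⟩ := nonempty_embedding_prod c
        (nonempty_embedding_of_countable c ((Δ[n + 1] : SSet.{w}).obj m)) (nonempty_embedding_cofree c m)
      exact ⟨.trans ⟨fun z ↦ (z.1.1.1, z.1.2), fun z z' h ↦
        Subtype.ext (Prod.ext (Subtype.ext (congrArg Prod.fst h)) (congrArg Prod.snd h :))⟩ g⟩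
    obtain ⟨g⟩ := nonempty_embedding_prod c
        (nonempty_embedding_of_countable c ((Δ[n + 1] : SSet.{w}).obj m))
        (nonempty_embedding_prod c (hX m) (nonempty_embedding_partialFamilies c hX m))
    exact ⟨.trans ⟨fun z ↦ (z.1.1, (z.1.2.1, z.1.2.2)), fun z z' h ↦ Subtype.ext h⟩ g⟩
  let l (m) : (kanExtension Λ[n + 1, k] r p q : SSet).obj m ↪ T := (hlabel m).some
  obtain ⟨g, hg, hgl⟩ := exists_cofree_extension φ (Q.ι ≫ CartesianMonoidalCategory.snd _ _)
    fun m z ↦ l m z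
  let M := CartesianMonoidalCategory.lift π g
  have hφM : φ ≫ M = Q.ι ≫ Λ[n + 1, k].ι ▷ cofree T := by
    ext1
    · rfl
    · rw [Category.assoc, CartesianMonoidalCategory.lift_snd, hg]
      rfl
  have hQφ (m) (z) (hz : π.app m z ∈ Λ[n + 1, k].obj m) : ∃ x, φ.app m x = z :=
    exists_toKanExtension_eq hq z hz
  have hφπ (m) (x) : π.app m (φ.app m x) ∈ Λ[n + 1, k].obj m := (p.app m x).2
  have hι (m) : Function.Injective ((Q.ι ≫ Λ[n + 1, k].ι ▷ cofree T).app m) :=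
    (CategoryTheory.mono_iff_injective _).1 inferInstance
  have hM : Mono M := by
    have (m : SimplexCategoryᵒᵖ) : Mono (M.app m) := by
      rw [CategoryTheory.mono_iff_injective]
      intro z z' hzz'
      have h₁ : π.app m z = π.app m z' := congrArg (fun t : (Δ[n + 1] ⊗ cofree T : SSet.{w}).obj m ↦ t.1) hzz'
      have h₂ : g.app m z = g.app m z' := congrArg (fun t : (Δ[n + 1] ⊗ cofree T : SSet.{w}).obj m ↦ t.2) hzz'
      -- Over the horn `M` is the original embedding of `Q`; elsewhere the labels are injective. The
      -- two cases are separated by the projection to the simplex.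
      by_cases hz : π.app m z ∈ Λ[n + 1, k].obj m
      · obtain ⟨x, rfl⟩ := hQφ m z hz
        obtain ⟨x', rfl⟩ := hQφ m z' (h₁ ▸ hz)
        refine congrArg (φ.app m) (hι m ?_)
        exact (app_congr hφM m x).symm.trans (hzz'.trans (app_congr hφM m x'))
      · have h₃ : ¬ ∃ x, φ.app m x = z := by
          rintro ⟨x, rfl⟩
          exact hz (hφπ m x)
        have h₄ : ¬ ∃ x, φ.app m x = z' := by
          rintro ⟨x, rfl⟩
          exact hz (h₁ ▸ hφπ m x)
        apply (l m).injective
        rw [← hgl m z h₃, ← hgl m z' h₄, h₂]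
    exact NatTrans.mono_of_mono_app _
  refine ⟨Subcomplex.range M, ?_, ?_⟩
  · refine (MorphismProperty.cancel_left_of_respectsIso kanFibrations (Subcomplex.toRange M) _).1 ?_
    exact hπ
  · ext m z
    constructor
    · rintro ⟨y, hy⟩
      have h₁ : π.app m y = z.1.1 := congrArg (fun t : (Δ[n + 1] ⊗ cofree T : SSet.{w}).obj m ↦ t.1) hy
      obtain ⟨x, rfl⟩ := hQφ m y (h₁ ▸ z.1.2)
      have h₂ : (Λ[n + 1, k].ι ▷ cofree T).app m x.1 = (Λ[n + 1, k].ι ▷ cofree T).app m z :=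
        (app_congr hφM m x).symm.trans hy
      have h₃ : x.1 = z :=
        (CategoryTheory.mono_iff_injective ((Λ[n + 1, k].ι ▷ cofree T).app m)).1 inferInstance h₂
      exact h₃ ▸ x.2
    · intro hz
      exact ⟨φ.app m ⟨z, hz⟩, app_congr hφM m ⟨z, hz⟩⟩

/-- The simplicial set whose `n`-simplices are the subobjects of `Δ[n] ⊗ S` that are
Kan over `Δ[n]`. -/
def kanUniverse (S : SSet.{w}) : SSet.{w} where
  obj n := { P : (SSet.stdSimplex.{w}.obj n.unop ⊗ S).Subcomplex // IsKanOver P }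
  map {n m} f := ↾fun P ↦ ⟨P.1.preimage (SSet.stdSimplex.map f.unop ▷ S), P.2.preimage _⟩
  map_id n := by
    refine ConcreteCategory.hom_ext _ _ fun P ↦ Subtype.ext ?_
    change P.1.preimage (SSet.stdSimplex.map (𝟙 n.unop) ▷ S) = P.1
    have h : SSet.stdSimplex.{w}.map (𝟙 n.unop) = 𝟙 _ := CategoryTheory.Functor.map_id _ _
    rw [h, id_whiskerRight, Subcomplex.preimage_id]
  map_comp {n m l} f g := by
    refine ConcreteCategory.hom_ext _ _ fun P ↦ Subtype.ext ?_
    change P.1.preimage (SSet.stdSimplex.map (g.unop ≫ f.unop) ▷ S) =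
      (P.1.preimage (SSet.stdSimplex.map f.unop ▷ S)).preimage (SSet.stdSimplex.map g.unop ▷ S)
    have h : SSet.stdSimplex.{w}.map (g.unop ≫ f.unop) =
      SSet.stdSimplex.map g.unop ≫ SSet.stdSimplex.map f.unop := CategoryTheory.Functor.map_comp _ _ _
    rw [h, comp_whiskerRight, Subcomplex.preimage_comp]

/-- The tautological simplex of the standard simplex. -/
def stdSimplexId (n : SimplexCategoryᵒᵖ) : (SSet.stdSimplex.{w}.obj n.unop).obj n :=
  SSet.stdSimplex.objEquiv.symm (𝟙 _)

lemma stdSimplex_map_stdSimplexId {n m : SimplexCategoryᵒᵖ} (f : n ⟶ m) :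
    (SSet.stdSimplex.{w}.map f.unop).app m (stdSimplexId m) =
      (SSet.stdSimplex.{w}.obj n.unop).map f (stdSimplexId n) := by
  apply SSet.stdSimplex.objEquiv.injective
  exact (Category.id_comp (obj := SimplexCategory) f.unop).trans
    (Category.comp_id (obj := SimplexCategory) f.unop).symm

lemma stdSimplex_map_apply_stdSimplexId {n m : SimplexCategoryᵒᵖ}
    (a : (SSet.stdSimplex.{w}.obj n.unop).obj m) :
    (SSet.stdSimplex.{w}.obj n.unop).map (SSet.stdSimplex.objEquiv a).op (stdSimplexId n) = a := by
  apply SSet.stdSimplex.objEquiv.injective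
  exact Category.comp_id (obj := SimplexCategory) _

lemma yonedaEquiv_symm_app_stdSimplexId {B : SSet.{w}} {n : SimplexCategoryᵒᵖ} (x : B.obj n) :
    (SSet.yonedaEquiv.symm x : SSet.stdSimplex.obj n.unop ⟶ B).app n (stdSimplexId n) = x := by
  have : B.map (𝟙 n) x = x := by simp
  exact this

lemma yonedaEquiv_symm_map {B : SSet.{w}} {n m : SimplexCategoryᵒᵖ} (f : n ⟶ m) (x : B.obj n) :
    (SSet.yonedaEquiv.symm (B.map f x) : SSet.stdSimplex.obj m.unop ⟶ B) =
      SSet.stdSimplex.map f.unop ≫ SSet.yonedaEquiv.symm x := by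
  apply SSet.yonedaEquiv.injective
  rw [Equiv.apply_symm_apply]
  exact congrFun (congrArg (fun g : n ⟶ m ↦ (B.map g : B.obj n → B.obj m))
    (show f = (𝟙 m.unop ≫ f.unop).op by simp)) x

/-- The subobject of `B ⊗ S` classified by a map to the universe. -/
def kanUniverse.subcomplex {B S : SSet.{w}} (φ : B ⟶ kanUniverse S) : (B ⊗ S).Subcomplex where
  obj n := { z | (stdSimplexId n, z.2) ∈ (φ.app n z.1).1.obj n }
  map {n m} f := by
    rintro ⟨x, s⟩ hx
    have h₁ : φ.app m (B.map f x) = (kanUniverse S).map f (φ.app n x) :=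
      NatTrans.naturality_apply φ f x
    change (stdSimplexId m, S.map f s) ∈ (φ.app m (B.map f x)).1.obj m
    rw [h₁]
    change ((SSet.stdSimplex.map f.unop).app m (stdSimplexId m), S.map f s) ∈ (φ.app n x).1.obj m
    rw [stdSimplex_map_stdSimplexId]
    exact (φ.app n x).1.map f hx

/-- Because simplices of the universe are actual subobjects, not isomorphism classes, classification
is strict and this is an equality. -/
lemma kanUniverse.preimage_subcomplex {B S : SSet.{w}} (φ : B ⟶ kanUniverse S)
    {n : SimplexCategoryᵒᵖ} (x : B.obj n) :
    (kanUniverse.subcomplex φ).preimage ((SSet.yonedaEquiv.symm x : SSet.stdSimplex.obj n.unop ⟶ B) ▷ S) =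
      (φ.app n x).1 := by
  ext m ⟨a, s⟩
  have h₁ : φ.app m (B.map (SSet.stdSimplex.objEquiv a).op x) =
    (kanUniverse S).map (SSet.stdSimplex.objEquiv a).op (φ.app n x) := NatTrans.naturality_apply φ _ x
  change (stdSimplexId m, s) ∈ (φ.app m (B.map (SSet.stdSimplex.objEquiv a).op x)).1.obj m ↔ _
  rw [h₁]
  change ((SSet.stdSimplex.map (SSet.stdSimplex.objEquiv a).op.unop).app m (stdSimplexId m), s) ∈
    (φ.app n x).1.obj m ↔ _
  rw [stdSimplex_map_stdSimplexId, stdSimplex_map_apply_stdSimplexId]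
  rfl

lemma kanUniverse.isKanOver_subcomplex {B S : SSet.{w}} (φ : B ⟶ kanUniverse S) :
    IsKanOver (kanUniverse.subcomplex φ) :=
  isKanOver_of_preimage fun n x ↦ by
    have h := kanUniverse.preimage_subcomplex φ x
    have h' := (φ.app _ x).2
    rw [← h] at h'
    exact h'

/-- The map to the universe classifying a subobject that is Kan over the base. -/
def IsKanOver.classify {B S : SSet.{w}} {Q : (B ⊗ S).Subcomplex} (hQ : IsKanOver Q) :
    B ⟶ kanUniverse S where
  app n := ↾fun x ↦ ⟨Q.preimage ((SSet.yonedaEquiv.symm x : SSet.stdSimplex.obj n.unop ⟶ B) ▷ S),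
    hQ.preimage _⟩
  naturality n m f := by
    ext x
    refine Subtype.ext ?_
    change Q.preimage ((SSet.yonedaEquiv.symm (B.map f x) : SSet.stdSimplex.obj m.unop ⟶ B) ▷ S) =
      (Q.preimage ((SSet.yonedaEquiv.symm x : SSet.stdSimplex.obj n.unop ⟶ B) ▷ S)).preimage
        (SSet.stdSimplex.map f.unop ▷ S)
    rw [yonedaEquiv_symm_map, comp_whiskerRight, Subcomplex.preimage_comp]

lemma IsKanOver.subcomplex_classify {B S : SSet.{w}} {Q : (B ⊗ S).Subcomplex} (hQ : IsKanOver Q) :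
    kanUniverse.subcomplex hQ.classify = Q := by
  ext n ⟨x, s⟩
  change ((SSet.yonedaEquiv.symm x : SSet.stdSimplex.obj n.unop ⟶ B).app n (stdSimplexId n), s) ∈ Q.obj n ↔ _
  rw [yonedaEquiv_symm_app_stdSimplexId]
  rfl

/-- A horn in the universe classifies a subobject that is Kan over the horn; a filler classifies an
extension of it over the simplex. -/
lemma kanComplex_kanUniverse {T : Type w} [Nontrivial T] (c : (ℕ → T) ↪ T) :
    KanComplex (kanUniverse (cofree T)) := by
  rw [kanComplex_iff]
  intro K L i hi
  simp only [J, MorphismProperty.iSup_iff] at hi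
  obtain ⟨m, ⟨k⟩⟩ := hi
  refine ⟨fun {φ v} sq ↦ ?_⟩
  obtain ⟨P, hP, hPφ⟩ := (kanUniverse.isKanOver_subcomplex φ).exists_horn_extension c k
  refine ⟨⟨hP.classify, ?_, by subsingleton⟩⟩
  ext n x
  refine Subtype.ext ?_
  refine Eq.trans ?_ (kanUniverse.preimage_subcomplex φ x)
  rw [← hPφ, ← Subcomplex.preimage_comp,
    ← comp_whiskerRight]
  change P.preimage ((SSet.yonedaEquiv.symm x.1 : SSet.stdSimplex.obj n.unop ⟶ _) ▷ _) = _
  rfl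

/-! ### Anodyne extensions and weak equivalences -/

/-- Embedding `E` in `B ⊗ cofree T` makes `p` a base change of the tautological fibration over the
universe. Its base and total space are Kan complexes, where lifting against `i` is known. -/
lemma anodyneExtensions_of_kanWeakEquivalences {K L : SSet.{w}} (i : K ⟶ L) [Mono i]
    (hi : kanWeakEquivalences i) : anodyneExtensions i := by
  intro E B p hp
  refine ⟨fun {u v} sq ↦ ?_⟩
  obtain ⟨T, _, c, f, _⟩ := exists_mono_cofree E
  have := kanComplex_kanUniverse c
  let m := CartesianMonoidalCategory.lift p f
  have : Mono m := mono_of_mono_fac (CartesianMonoidalCategory.lift_snd p f)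
  have hm : Subcomplex.toRange m ≫ (Subcomplex.range m).ι = m := rfl
  have hQ : IsKanOver (Subcomplex.range m) :=
    (MorphismProperty.cancel_left_of_respectsIso kanFibrations (Subcomplex.toRange m) _).1 hp
  let Q₀ := kanUniverse.subcomplex (𝟙 (kanUniverse (cofree T)))
  have hQ₀ : IsKanOver Q₀ := kanUniverse.isKanOver_subcomplex _
  have : KanComplex (Q₀ : SSet) := kanComplex_of_kanFibration hQ₀
  have h₀ : Q₀.preimage (hQ.classify ▷ cofree T) = Subcomplex.range m := hQ.subcomplex_classify
  -- Generalizing over `Q` avoids transporting maps along the equality `h₀` of subcomplexes.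
  have key : ∀ Q : (B ⊗ cofree T).Subcomplex, Q₀.preimage (hQ.classify ▷ cofree T) = Q →
      ∀ (u : K ⟶ (Q : SSet)) (v : L ⟶ B),
        u ≫ Q.ι ≫ CartesianMonoidalCategory.fst _ _ = i ≫ v →
        ∃ l : L ⟶ (Q : SSet), i ≫ l = u ∧ l ≫ Q.ι ≫ CartesianMonoidalCategory.fst _ _ = v := by
    rintro _ rfl u v h
    exact exists_lift_preimage _ i u v h (hasLiftingProperty_of_kanComplex i hi hQ₀)
  obtain ⟨l, h₁, h₂⟩ := key _ h₀ (u ≫ Subcomplex.toRange m) v sq.w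
  refine ⟨⟨l ≫ inv (Subcomplex.toRange m), by rw [reassoc_of% h₁]; simp, ?_⟩⟩
  have h₃ : inv (Subcomplex.toRange m) ≫ p =
    (Subcomplex.range m).ι ≫ CartesianMonoidalCategory.fst _ _ := (IsIso.inv_comp_eq _).2 rfl
  rw [← h₂, Category.assoc, h₃]

lemma exists_mono_trivialFibrations_fac {E B : SSet.{w}} (p : E ⟶ B) :
    ∃ (M : SSet.{w}) (i : E ⟶ M) (q : M ⟶ B), Mono i ∧ trivialFibrations q ∧ i ≫ q = p := by
  obtain ⟨T, _, c, f, _⟩ := exists_mono_cofree E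
  refine ⟨B ⊗ cofree T, CartesianMonoidalCategory.lift p f, CartesianMonoidalCategory.fst _ _,
    mono_of_mono_fac (CartesianMonoidalCategory.lift_snd p f), ?_,
    CartesianMonoidalCategory.lift_fst _ _⟩
  have : IsPullback (CartesianMonoidalCategory.snd B (cofree T))
    (CartesianMonoidalCategory.fst B (cofree T)) (terminal.from _) (terminal.from _) := by
    refine ⟨⟨by subsingleton⟩, ⟨PullbackCone.IsLimit.mk _
      (fun s ↦ CartesianMonoidalCategory.lift s.snd s.fst) (fun s ↦ by simp) (fun s ↦ by simp)
      fun s m h₁ h₂ ↦ ?_⟩⟩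
    ext1
    · simpa using h₂
    · simpa using h₁
  exact MorphismProperty.of_isPullback this (trivialFibrations_cofree T)

/-- Retract argument: in a factorization through a trivial fibration `q`, the first map is an
acyclic monomorphism, hence anodyne, so `p` is a retract of `q`. -/
lemma trivialFibrations_of_kanWeakEquivalences {E B : SSet.{w}} {p : E ⟶ B}
    (hp : kanFibrations p) (hp' : kanWeakEquivalences p) : trivialFibrations p := by
  obtain ⟨M, i, q, _, hq, fac⟩ := exists_mono_trivialFibrations_fac p
  have hi : anodyneExtensions i := anodyneExtensions_of_kanWeakEquivalences i
    (kanWeakEquivalences_of_postcomp (kanWeakEquivalences_of_trivialFibrations hq) (by rwa [fac]))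
  have := hi _ hp
  have sq : CommSq (𝟙 E) i p q := ⟨by simp [fac]⟩
  intro K L j hj
  have := hq _ hj
  refine ⟨fun {u v} sq' ↦ ?_⟩
  have sq'' : CommSq (u ≫ i) j q v := ⟨by rw [Category.assoc, fac, sq'.w]⟩
  refine ⟨⟨sq''.lift ≫ sq.lift, ?_, ?_⟩⟩
  · rw [sq''.fac_left_assoc, Category.assoc, sq.fac_left, Category.comp_id]
  · rw [Category.assoc, sq.fac_right, sq''.fac_right]

lemma trivialFibrations_iff {E B : SSet.{w}} (p : E ⟶ B) :
    trivialFibrations p ↔ kanFibrations p ∧ kanWeakEquivalences p :=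
  ⟨fun h ↦ ⟨trivialFibrations_le_kanFibrations _ h, kanWeakEquivalences_of_trivialFibrations h⟩,
    fun ⟨h, h'⟩ ↦ trivialFibrations_of_kanWeakEquivalences h h'⟩

lemma exists_anodyneExtensions_kanFibrations_fac {E B : SSet.{w}} (p : E ⟶ B) :
    ∃ (M : SSet.{w}) (i : E ⟶ M) (q : M ⟶ B), anodyneExtensions i ∧ kanFibrations q ∧
      i ≫ q = p := by
  let h := MorphismProperty.factorizationData J.rlp.llp J.rlp p
  exact ⟨h.Z, h.i, h.p, h.hi, h.hp, h.fac⟩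

/-! ### Base change of weak equivalences between fibrations -/

/-- An anodyne map between fibrations over `Z` is the inclusion of a deformation retract over `Z`.
The retraction and the homotopy are both over `Z`, so they survive base change along an arbitrary
`g`. -/
lemma kanWeakEquivalences_pullback_of_anodyneExtensions {Z F E E' P P' : SSet.{w}} {g : F ⟶ Z}
    {p : E ⟶ Z} {p' : E' ⟶ Z} {s : P ⟶ E} {t : P ⟶ F} {s' : P' ⟶ E'} {t' : P' ⟶ F}
    (hP : IsPullback s t p g) (hP' : IsPullback s' t' p' g) (hp : kanFibrations p)
    (hp' : kanFibrations p') (a : E ⟶ E') (ha : a ≫ p' = p) (ha' : anodyneExtensions a)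
    (c : P ⟶ P') (hs : c ≫ s' = s ≫ a) (ht : c ≫ t' = t) : kanWeakEquivalences c := by
  have := ha' _ hp
  have sq : CommSq (𝟙 E) a p p' := ⟨by simp [ha]⟩
  have hr : a ≫ sq.lift = 𝟙 E := sq.fac_left
  have hr' : sq.lift ≫ p = p' := sq.fac_right
  obtain ⟨G, hG₀, hG₁, -, hG⟩ := anodyneExtensions_homotopy_lift a ha' hp' (sq.lift ≫ a) (𝟙 E')
    (CartesianMonoidalCategory.fst _ _ ≫ a) (CartesianMonoidalCategory.fst _ _ ≫ p')
    (by rw [ι₀_fst_assoc, reassoc_of% hr]) (by simp)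
    (by rw [Category.assoc, ha, hr', ι₀_fst_assoc]) (by simp) (by simp)
  let d : P' ⟶ P := hP.lift (s' ≫ sq.lift) t' (by rw [Category.assoc, hr', hP'.w])
  have hds : d ≫ s = s' ≫ sq.lift := hP.lift_fst _ _ _
  have hdt : d ≫ t = t' := hP.lift_snd _ _ _
  have hcd : c ≫ d = 𝟙 P := by
    apply hP.hom_ext
    · rw [Category.assoc, hds, reassoc_of% hs, hr, Category.comp_id, Category.id_comp]
    · rw [Category.assoc, hdt, ht, Category.id_comp]
  refine kanWeakEquivalences_of_homotopyEquivalence d ?_ ?_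
  · rw [hcd]
    exact nonempty_homotopy_refl _
  · refine nonempty_homotopy_of_hom (hP'.lift (s' ▷ _ ≫ G) (CartesianMonoidalCategory.fst _ _ ≫ t')
      (by rw [Category.assoc, hG, CartesianMonoidalCategory.whiskerRight_fst_assoc, hP'.w,
        Category.assoc])) ?_ ?_
    · apply hP'.hom_ext
      · rw [Category.assoc, hP'.lift_fst, ι₀_comp_assoc, hG₀, Category.assoc, hs, reassoc_of% hds]
      · rw [Category.assoc, hP'.lift_snd, ι₀_fst_assoc, Category.assoc, ht, hdt]
    · apply hP'.hom_ext
      · rw [Category.assoc, hP'.lift_fst, ι₁_comp_assoc, hG₁, Category.comp_id, Category.id_comp]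
      · rw [Category.assoc, hP'.lift_snd, ι₁_fst_assoc, Category.id_comp]

lemma kanWeakEquivalences_pullback {Z F E E' P P' : SSet.{w}} {g : F ⟶ Z}
    {p : E ⟶ Z} {p' : E' ⟶ Z} {s : P ⟶ E} {t : P ⟶ F} {s' : P' ⟶ E'} {t' : P' ⟶ F}
    (hP : IsPullback s t p g) (hP' : IsPullback s' t' p' g) (hp : kanFibrations p)
    (hp' : kanFibrations p') (a : E ⟶ E') (ha : a ≫ p' = p) (ha' : kanWeakEquivalences a)
    (c : P ⟶ P') (hs : c ≫ s' = s ≫ a) (ht : c ≫ t' = t) : kanWeakEquivalences c := by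
  obtain ⟨M, i, q, hi, hq, rfl⟩ := exists_anodyneExtensions_kanFibrations_fac a
  have hq' : trivialFibrations q := trivialFibrations_of_kanWeakEquivalences hq
    (kanWeakEquivalences_of_precomp (kanWeakEquivalences_of_anodyneExtensions hi) ha')
  have hqp : kanFibrations (q ≫ p') := MorphismProperty.comp_mem _ _ _ hq hp'
  have hM := IsPullback.of_hasPullback (q ≫ p') g
  let c₁ : P ⟶ pullback (q ≫ p') g := pullback.lift (s ≫ i) t (by
    rw [← hP.w, ← ha]; simp only [Category.assoc])
  let c₂ : pullback (q ≫ p') g ⟶ P' := hP'.lift (pullback.fst _ _ ≫ q) (pullback.snd _ _) (by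
    rw [← pullback.condition, Category.assoc])
  have hc : c₁ ≫ c₂ = c := by
    apply hP'.hom_ext
    · rw [Category.assoc, hP'.lift_fst, pullback.lift_fst_assoc, hs, Category.assoc]
    · rw [Category.assoc, hP'.lift_snd, pullback.lift_snd, ht]
  have hc₂ : IsPullback (pullback.fst (q ≫ p') g) c₂ q s' := by
    have h : c₂ ≫ t' = pullback.snd (q ≫ p') g := hP'.lift_snd _ _ _
    exact IsPullback.of_bot (by rw [h]; exact hM) (hP'.lift_fst _ _ _).symm hP'
  rw [← hc]
  exact kanWeakEquivalences_comp
    (kanWeakEquivalences_pullback_of_anodyneExtensions hP hM hp hqp i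
      (by rw [← ha, Category.assoc]) hi c₁ (pullback.lift_fst _ _ _) (pullback.lift_snd _ _ _))
    (kanWeakEquivalences_of_trivialFibrations (MorphismProperty.of_isPullback hc₂ hq'))

/-! ### Factorizations of maps of simplicial presheaves -/

/-- Maps of simplicial presheaves that satisfy a property objectwise. -/
def objectwise (C : Type u) [Category.{v} C] (P : MorphismProperty SSet.{w}) :
    MorphismProperty (SPre.{w} C) :=
  fun _ _ f ↦ ∀ X : Cᵒᵖ, P (f.app X)

section

variable {C : Type u} [Category.{v} C]

instance [LocallySmall.{w} C] (a b : C) : HasCoproductsOfShape (a ⟶ b) SSet.{w} :=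
  hasColimitsOfShape_of_equivalence (Discrete.equivalence (equivShrink.{w} (a ⟶ b))).symm

instance [LocallySmall.{w} C] (a b : C) : HasProductsOfShape (a ⟶ b) SSet.{w} :=
  hasLimitsOfShape_of_equivalence (Discrete.equivalence (equivShrink.{w} (a ⟶ b))).symm

/-- The map of simplicial presheaves freely generated by a map of simplicial sets at an object. -/
abbrev freeMap [LocallySmall.{w} C] (U : Cᵒᵖ) {A B : SSet.{w}} (j : A ⟶ B) :=
  (evaluationLeftAdjoint SSet.{w} U).map j

lemma hasLiftingProperty_freeMap_iff [LocallySmall.{w} C] (U : Cᵒᵖ) {A B : SSet.{w}} (j : A ⟶ B)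
    {F G : SPre.{w} C} (p : F ⟶ G) :
    HasLiftingProperty (freeMap U j) p ↔ HasLiftingProperty j (p.app U) :=
  (evaluationAdjunctionRight SSet.{w} U).hasLiftingProperty_iff j p

/-- The maps of simplicial presheaves freely generated by a family of maps of simplicial sets. -/
def freeMaps (C : Type u) [Category.{v} C] [EssentiallySmall.{w} C] {ι : Type} {A B : ι → SSet.{w}}
    (j : ∀ i, A i ⟶ B i) : MorphismProperty (SPre.{w} C) :=
  .ofHoms fun x : SmallModel.{w} C × ι ↦
    freeMap (op ((equivSmallModel.{w} C).inverse.obj x.1)) (j x.2)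

/-- By adjunction this is lifting after evaluation at objects of a small model; every object is
isomorphic to one of these. -/
lemma rlp_freeMaps [EssentiallySmall.{w} C] {ι : Type} {A B : ι → SSet.{w}}
    (j : ∀ i, A i ⟶ B i) :
    (freeMaps C j).rlp = objectwise C (MorphismProperty.ofHoms j).rlp := by
  ext F G p
  constructor
  · rintro hp U _ _ _ ⟨i⟩
    let s := (equivSmallModel.{w} C).functor.obj U.unop
    have := hp _ ⟨(s, i)⟩
    rw [hasLiftingProperty_freeMap_iff] at this
    let e : U ≅ op ((equivSmallModel.{w} C).inverse.obj s) :=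
      ((equivSmallModel.{w} C).unitIso.app U.unop).symm.op
    refine (HasLiftingProperty.iff_of_arrow_iso_right (j i)
      (Arrow.isoMk (F.mapIso e) (G.mapIso e) (by simp))).2 this
  · rintro hp _ _ _ ⟨x⟩
    rw [hasLiftingProperty_freeMap_iff]
    exact hp _ _ ⟨x.2⟩

instance [EssentiallySmall.{w} C] : LocallySmall.{w} (SPre.{w} C) :=
  locallySmall_of_faithful.{w} ((Functor.whiskeringLeft _ _ SSet.{w}).obj
    (equivSmallModel.{w} C).inverse.op)

attribute [local instance] Cardinal.fact_isRegular_aleph0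
  Cardinal.orderBotAleph0OrdToType

lemma hasSmallObjectArgument_freeMaps [EssentiallySmall.{w} C] {ι : Type} {A B : ι → SSet.{w}}
    (j : ∀ i, A i ⟶ B i) [∀ i, IsFinitelyPresentable.{w} (A i)] :
    MorphismProperty.HasSmallObjectArgument.{w} (freeMaps C j) := by
  have : MorphismProperty.IsSmall.{w} (freeMaps C j) := MorphismProperty.isSmall_ofHoms ..
  have : MorphismProperty.IsCardinalForSmallObjectArgument (freeMaps C j) Cardinal.aleph0.{w} :=
    { preservesColimit := by
        rintro _ _ _ _ _ ⟨x⟩ f hf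
        -- Evaluation preserves filtered colimits, so its left adjoint preserves finite
        -- presentability.
        have : IsFinitelyPresentable.{w} ((evaluationLeftAdjoint SSet.{w}
          (op ((equivSmallModel.{w} C).inverse.obj x.1))).obj (A x.2)) :=
          (evaluationAdjunctionRight SSet.{w} _).isCardinalPresentable_leftAdjoint_obj _ _
        infer_instance }
  exact ⟨.aleph0, inferInstance, inferInstance, inferInstance⟩

lemma exists_factorization [EssentiallySmall.{w} C] {ι : Type} {A B : ι → SSet.{w}}
    (j : ∀ i, A i ⟶ B i) [∀ i, IsFinitelyPresentable.{w} (A i)] {F G : SPre.{w} C} (f : F ⟶ G) :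
    ∃ (M : SPre.{w} C) (i : F ⟶ M) (q : M ⟶ G),
      (objectwise C (MorphismProperty.ofHoms j).rlp).llp i ∧
      objectwise C (MorphismProperty.ofHoms j).rlp q ∧ i ≫ q = f := by
  have := hasSmallObjectArgument_freeMaps (C := C) j
  let h := MorphismProperty.factorizationData (freeMaps C j).rlp.llp (freeMaps C j).rlp f
  refine ⟨h.Z, h.i, h.p, ?_, ?_, h.fac⟩
  · rw [← rlp_freeMaps]
    exact h.hi
  · rw [← rlp_freeMaps]
    exact h.hp

lemma exists_factorization_trivialFibrations [EssentiallySmall.{w} C] {F G : SPre.{w} C}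
    (f : F ⟶ G) : ∃ (M : SPre.{w} C) (i : F ⟶ M) (q : M ⟶ G),
      (objectwise C trivialFibrations).llp i ∧ objectwise C trivialFibrations q ∧ i ≫ q = f :=
  exists_factorization (fun n ↦ ∂Δ[n].ι) f

lemma ofHoms_sigma_horn_ι : MorphismProperty.ofHoms
    (fun x : Σ n : ℕ, Fin (n + 2) ↦ (Λ[x.1 + 1, x.2] : Subcomplex.{w} _).ι) = J := by
  ext _ _ f
  simp only [J, MorphismProperty.iSup_iff]
  constructor
  · rintro ⟨n, i⟩
    exact ⟨n, ⟨i⟩⟩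
  · rintro ⟨n, ⟨i⟩⟩
    exact ⟨(⟨n, i⟩ : Σ n : ℕ, Fin (n + 2))⟩

lemma exists_factorization_kanFibrations [EssentiallySmall.{w} C] {F G : SPre.{w} C}
    (f : F ⟶ G) : ∃ (M : SPre.{w} C) (i : F ⟶ M) (q : M ⟶ G),
      (objectwise C kanFibrations).llp i ∧ objectwise C kanFibrations q ∧ i ≫ q = f := by
  have h := exists_factorization
    (fun x : Σ n : ℕ, Fin (n + 2) ↦ (Λ[x.1 + 1, x.2] : Subcomplex.{w} _).ι) f
  rwa [ofHoms_sigma_horn_ι] at h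

end

variable {C : Type u} [Category.{v} C]

/-! ### Left lifting properties of sections and stalks -/

lemma rlp_piMap (P : MorphismProperty SSet.{w}) {ι : Type*} {A B : ι → SSet.{w}} [HasProduct A]
    [HasProduct B] (f : ∀ i, A i ⟶ B i) (hf : ∀ i, P.rlp (f i)) : P.rlp (Limits.Pi.map f) := by
  intro _ _ j hj
  have := fun i ↦ hf i j hj
  infer_instance

/-- Evaluation has a right adjoint whose values are products of copies of the given simplicial set,
and products preserve right lifting properties. The skyscraper functor plays the same role for
stalks in `llp_presheafFiber`. -/
lemma llp_app [LocallySmall.{w} C] (P : MorphismProperty SSet.{w}) {F G : SPre.{w} C} (f : F ⟶ G)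
    (hf : (objectwise C P.rlp).llp f) (U : Cᵒᵖ) : P.rlp.llp (f.app U) := by
  intro X Y p hp
  refine ((evaluationAdjunctionLeft SSet.{w} U).hasLiftingProperty_iff f p).2 (hf _ fun V ↦ ?_)
  have : ((evaluationRightAdjoint SSet.{w} U).map p).app V =
      Limits.Pi.map (fun _ : V ⟶ U ↦ p) := by
    apply Pi.hom_ext
    intro g
    exact (Pi.lift_π _ g).trans (Pi.map_π (fun _ ↦ p) g).symm
  rw [this]
  exact rlp_piMap _ _ fun _ ↦ hp

variable {J : GrothendieckTopology C} (x : GrothendieckTopology.Point.{w} J)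

lemma objectwise_skyscraperPresheafFunctor_map (P : MorphismProperty SSet.{w}) {X Y : SSet.{w}}
    (p : X ⟶ Y) (hp : P.rlp p) : objectwise C P.rlp (x.skyscraperPresheafFunctor.map p) :=
  fun _ ↦ rlp_piMap P (fun _ ↦ p) fun _ ↦ hp

lemma llp_presheafFiber (P : MorphismProperty SSet.{w}) {F G : SPre.{w} C} (f : F ⟶ G)
    (hf : (objectwise C P.rlp).llp f) : P.rlp.llp (x.presheafFiber.map f) := by
  intro X Y p hp
  exact (x.skyscraperPresheafAdjunction.hasLiftingProperty_iff f p).2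
    (hf _ (objectwise_skyscraperPresheafFunctor_map x P p hp))

lemma kanComplex_piObj {ι : Type*} (K : ι → SSet.{w}) [HasProduct K] [∀ i, KanComplex (K i)] :
    KanComplex (∏ᶜ K) := by
  rw [kanComplex_iff]
  intro A B j hj
  have hK (i : ι) := kanFibrations_terminal_from (K i) _ hj
  have sq (i : ι) (φ : A ⟶ K i) : CommSq φ j (terminal.from (K i)) (terminal.from B) := ⟨by simp⟩
  exact ⟨fun {φ t} _ ↦ ⟨⟨Pi.lift fun i ↦ (sq i (φ ≫ Pi.π K i)).lift, by cat_disch,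
    by subsingleton⟩⟩⟩

lemma isProjectiveFibrant_skyscraperPresheaf (K : SSet.{w}) [KanComplex K] :
    IsProjectiveFibrant (x.skyscraperPresheaf K) :=
  fun _ ↦ kanComplex_piObj fun _ ↦ K

/-! ### Classes of maps -/

lemma projectiveCofibrations_eq : projectiveCofibrations.{w} C =
    (objectwise C trivialFibrations).llp := by
  have : objectwise C trivialFibrations =
      projectiveFibrations.{w} C ⊓ objectwiseWeakEquivalences C := by
    ext F G f
    exact ⟨fun h ↦ ⟨fun U ↦ ((trivialFibrations_iff _).1 (h U)).1,
      fun U ↦ ((trivialFibrations_iff _).1 (h U)).2⟩,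
      fun h U ↦ (trivialFibrations_iff _).2 ⟨h.1 U, h.2 U⟩⟩
  rw [projectiveCofibrations, this]

lemma injectiveCofibrations_of_llp [LocallySmall.{w} C] {F G : SPre.{w} C} (f : F ⟶ G)
    (hf : (objectwise C trivialFibrations).llp f) : injectiveCofibrations C f :=
  fun U ↦ mono_of_llp_trivialFibrations (llp_app I f hf U)

lemma mono_presheafFiber_map_of_llp {F G : SPre.{w} C} (f : F ⟶ G)
    (hf : (objectwise C trivialFibrations).llp f) : Mono (x.presheafFiber.map f) :=
  mono_of_llp_trivialFibrations (llp_presheafFiber x I f hf)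

lemma anodyneExtensions_app [LocallySmall.{w} C] {F G : SPre.{w} C} (f : F ⟶ G)
    (hf : (objectwise C kanFibrations).llp f) (U : Cᵒᵖ) : anodyneExtensions (f.app U) :=
  llp_app _ f hf U

lemma anodyneExtensions_presheafFiber_map {F G : SPre.{w} C} (f : F ⟶ G)
    (hf : (objectwise C kanFibrations).llp f) : anodyneExtensions (x.presheafFiber.map f) :=
  llp_presheafFiber x _ f hf

lemma objectwise_trivialFibrations_le :
    objectwise.{w} C trivialFibrations ≤ objectwise C kanFibrations :=
  fun _ _ _ h U ↦ trivialFibrations_le_kanFibrations _ (h U)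

lemma llp_objectwise_kanFibrations_le_projectiveAcyclicCofibrations [LocallySmall.{w} C] :
    (objectwise.{w} C kanFibrations).llp ≤ projectiveAcyclicCofibrations C := by
  intro F G f hf
  refine ⟨?_, fun U ↦ kanWeakEquivalences_of_anodyneExtensions (anodyneExtensions_app f hf U)⟩
  rw [projectiveCofibrations_eq]
  exact MorphismProperty.antitone_llp objectwise_trivialFibrations_le _ hf

lemma projectiveAcyclicCofibrations_le_injectiveAcyclicCofibrations [LocallySmall.{w} C] :
    projectiveAcyclicCofibrations.{w} C ≤ injectiveAcyclicCofibrations C := by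
  rintro F G f ⟨hf, hf'⟩
  rw [projectiveCofibrations_eq] at hf
  exact ⟨injectiveCofibrations_of_llp f hf, hf'⟩

/-- The maps freely generated by horn inclusions are projective acyclic cofibrations. This covers
injective and local fibrations at once. -/
lemma objectwise_kanFibrations_of_rlp [EssentiallySmall.{w} C] {P : MorphismProperty (SPre.{w} C)}
    (hP : projectiveAcyclicCofibrations C ≤ P) {F G : SPre.{w} C} (f : F ⟶ G) (hf : P.rlp f) :
    objectwise C kanFibrations f := by
  intro U A B j hj
  rw [← hasLiftingProperty_freeMap_iff]
  refine hf _ (hP _ (llp_objectwise_kanFibrations_le_projectiveAcyclicCofibrations _ ?_))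
  intro _ _ p hp
  rw [hasLiftingProperty_freeMap_iff]
  exact hp U _ hj

/-! ### Stalks of simplicial presheaves -/

section

variable {C : Type u} [Category.{v} C] [LocallySmall.{w} C]
  {J : GrothendieckTopology C} (x : GrothendieckTopology.Point.{w} J)

lemma preservesColimitsOfShape_coyoneda (A : SSet.{w}) [IsFinitelyPresentable.{w} A] :
    PreservesColimitsOfShape x.fiber.Elementsᵒᵖ (coyoneda.obj (op A)) :=
  -- The category of elements may be large; its filtered colimits are computed on a small final
  -- filtered category.
  Functor.Final.preservesColimitsOfShape_of_final
    (FinallySmall.fromFilteredFinalModel.{w} _) _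

lemma exists_eq_comp_toPresheafFiber {A : SSet.{w}} [IsFinitelyPresentable.{w} A] {F : SPre.{w} C}
    (a : A ⟶ x.presheafFiber.obj F) : ∃ (X : C) (y : x.fiber.obj X) (s : A ⟶ F.obj (op X)),
      s ≫ x.toPresheafFiber X y F = a := by
  have := preservesColimitsOfShape_coyoneda x A
  obtain ⟨⟨X, y⟩, s, h⟩ := Types.jointly_surjective_of_isColimit
    (isColimitOfPreserves (coyoneda.obj (op A)) (x.isColimitPresheafFiberCocone F)) a
  exact ⟨X, y, s, h⟩

lemma exists_comp_map_eq {A : SSet.{w}} [IsFinitelyPresentable.{w} A] {F : SPre.{w} C} {X : C}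
    (y : x.fiber.obj X) (s s' : A ⟶ F.obj (op X))
    (h : s ≫ x.toPresheafFiber X y F = s' ≫ x.toPresheafFiber X y F) :
    ∃ (Y : C) (f : Y ⟶ X) (z : x.fiber.obj Y), x.fiber.map f z = y ∧
      s ≫ F.map f.op = s' ≫ F.map f.op := by
  have := preservesColimitsOfShape_coyoneda x A
  obtain ⟨⟨Y, z⟩, ⟨f, hf⟩, hf'⟩ := (Types.FilteredColimit.isColimit_eq_iff'
    (isColimitOfPreserves (coyoneda.obj (op A)) (x.isColimitPresheafFiberCocone F))
    (i := op (Functor.elementsMk x.fiber X y)) s s').1 h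
  exact ⟨Y, f, z, hf, hf'⟩

/-- By finite presentability the whole square already lives over one neighbourhood of the point. The
lifting then exists on a covering sieve, and the point factors through a member of that sieve. -/
lemma hasLiftingProperty_presheafFiber_map {A B : SSet.{w}} [IsFinitelyPresentable.{w} A]
    [IsFinitelyPresentable.{w} B] (j : A ⟶ B) {F G : SPre.{w} C} (p : F ⟶ G)
    (h : ∀ (X : C) (s : A ⟶ F.obj (op X)) (t : B ⟶ G.obj (op X)), s ≫ p.app (op X) = j ≫ t →
      ∃ R ∈ J X, ∀ (U : C) (i : U ⟶ X), R i → ∃ l : B ⟶ F.obj (op U),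
        j ≫ l = s ≫ F.map i.op ∧ l ≫ p.app (op U) = t ≫ G.map i.op) :
    HasLiftingProperty j (x.presheafFiber.map p) := by
  refine ⟨fun {a b} sq ↦ ?_⟩
  obtain ⟨X₁, y₁, s₁, rfl⟩ := exists_eq_comp_toPresheafFiber x a
  obtain ⟨X₂, y₂, t₂, rfl⟩ := exists_eq_comp_toPresheafFiber x b
  obtain ⟨X, y, f₁, f₂, rfl, rfl⟩ : ∃ (X : C) (y : x.fiber.obj X) (f₁ : X ⟶ X₁) (f₂ : X ⟶ X₂),
      x.fiber.map f₁ y = y₁ ∧ x.fiber.map f₂ y = y₂ :=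
    ⟨_, _, (IsCofiltered.minToLeft (Functor.elementsMk x.fiber X₁ y₁)
      (Functor.elementsMk x.fiber X₂ y₂)).val, (IsCofiltered.minToRight
      (Functor.elementsMk x.fiber X₁ y₁) (Functor.elementsMk x.fiber X₂ y₂)).val,
      CategoryOfElements.map_snd _, CategoryOfElements.map_snd _⟩
  simp only [← x.toPresheafFiber_w] at sq ⊢
  have hsq := sq.w
  simp only [Category.assoc, x.toPresheafFiber_naturality, p.naturality_assoc] at hsq
  obtain ⟨Y, f, z, rfl, h'⟩ := exists_comp_map_eq x y (s₁ ≫ F.map f₁.op ≫ p.app _)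
    (j ≫ t₂ ≫ G.map f₂.op) (by simpa using hsq)
  obtain ⟨R, hR, hl⟩ := h Y (s₁ ≫ F.map f₁.op ≫ F.map f.op) (t₂ ≫ G.map f₂.op ≫ G.map f.op)
    (by simpa using h')
  obtain ⟨U, i, hi, z, rfl⟩ := x.jointly_surjective R hR z
  obtain ⟨l, hl, hl'⟩ := hl U i hi
  refine ⟨⟨⟨l ≫ x.toPresheafFiber U z F, ?_, ?_⟩⟩⟩
  · rw [reassoc_of% hl]
    simp
  · rw [Category.assoc, x.toPresheafFiber_naturality, reassoc_of% hl']
    simp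

lemma trivialFibrations_presheafFiber_map {F G : SPre.{w} C} (p : F ⟶ G)
    (hp : IsLocalAcyclicFibration J p) : trivialFibrations (x.presheafFiber.map p) := by
  rintro _ _ _ ⟨n⟩
  exact hasLiftingProperty_presheafFiber_map x _ p fun X s t ↦ hp X n s t

lemma hasLiftingProperty_presheafFiber_map_of_objectwise {A B : SSet.{w}}
    [IsFinitelyPresentable.{w} A] [IsFinitelyPresentable.{w} B] (j : A ⟶ B) {F G : SPre.{w} C}
    (p : F ⟶ G) (h : ∀ X, HasLiftingProperty j (p.app X)) :
    HasLiftingProperty j (x.presheafFiber.map p) := by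
  refine hasLiftingProperty_presheafFiber_map x j p fun X s t h ↦
    ⟨⊤, J.top_mem X, fun U i _ ↦ ?_⟩
  have sq : CommSq s j (p.app (op X)) t := ⟨h⟩
  refine ⟨sq.lift ≫ F.map i.op, by simp, ?_⟩
  rw [Category.assoc, p.naturality, sq.fac_right_assoc]

lemma trivialFibrations_presheafFiber_map_of_objectwise {F G : SPre.{w} C} (p : F ⟶ G)
    (hp : objectwise C trivialFibrations p) : trivialFibrations (x.presheafFiber.map p) := by
  rintro _ _ _ ⟨n⟩
  exact hasLiftingProperty_presheafFiber_map_of_objectwise x _ p fun X ↦ hp X _ ⟨n⟩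

lemma kanFibrations_presheafFiber_map {F G : SPre.{w} C} (p : F ⟶ G)
    (hp : objectwise C kanFibrations p) : kanFibrations (x.presheafFiber.map p) := by
  intro _ _ i hi
  have hp' := fun U ↦ hp U i hi
  simp only [modelCategoryQuillen.J, MorphismProperty.iSup_iff] at hi
  obtain ⟨m, ⟨k⟩⟩ := hi
  exact hasLiftingProperty_presheafFiber_map_of_objectwise x _ p hp'

end

section

variable {C : Type u} [Category.{v} C] [EssentiallySmall.{w} C]
  {J : GrothendieckTopology C} (x : GrothendieckTopology.Point.{w} J)

/-- Factor `f` into a map whose stalks are anodyne and an objectwise trivial fibration, whose stalks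
are trivial fibrations. -/
lemma kanWeakEquivalences_presheafFiber_map {F G : SPre.{w} C} (f : F ⟶ G)
    (hf : objectwiseWeakEquivalences C f) : kanWeakEquivalences (x.presheafFiber.map f) := by
  obtain ⟨M, i, q, hi, hq, rfl⟩ := exists_factorization_kanFibrations f
  rw [Functor.map_comp]
  refine kanWeakEquivalences_comp (kanWeakEquivalences_of_anodyneExtensions
    (anodyneExtensions_presheafFiber_map x i hi)) (kanWeakEquivalences_of_trivialFibrations
    (trivialFibrations_presheafFiber_map_of_objectwise x q fun U ↦ ?_))
  refine trivialFibrations_of_kanWeakEquivalences (hq U) (kanWeakEquivalences_of_precomp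
    (kanWeakEquivalences_of_anodyneExtensions (anodyneExtensions_app i hi U)) ?_)
  simpa using hf U

end

/-! ### Maps into mapping spaces -/

section

variable {C : Type u} [Category.{v} C]

/-- The values of the map `F ⊗ Δ[m] ⟶ W` corresponding to a simplex of a mapping space. -/
def mapSpaceApp {F W : SPre.{w} C} {m : SimplexCategoryᵒᵖ} (g : (mapSpace F W).obj m) (U : Cᵒᵖ)
    {k : SimplexCategoryᵒᵖ} (a : (F.obj U).obj k) (t : (SSet.stdSimplex.{w}.obj m.unop).obj k) :
    (W.obj U).obj k :=
  (NatTrans.app (C := Cᵒᵖ) (D := SSet.{w})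
    (F := F ⊗ (Functor.const Cᵒᵖ).obj (SSet.stdSimplex.{w}.obj m.unop)) (G := W) g U).app k (a, t)

section

variable {F G W : SPre.{w} C} {m : SimplexCategoryᵒᵖ}

lemma map_mapSpaceApp (g : (mapSpace F W).obj m) (U : Cᵒᵖ) {k k' : SimplexCategoryᵒᵖ} (q : k ⟶ k')
    (a : (F.obj U).obj k) (t : (SSet.stdSimplex.{w}.obj m.unop).obj k) :
    (W.obj U).map q (mapSpaceApp g U a t) = mapSpaceApp g U ((F.obj U).map q a)
      ((SSet.stdSimplex.{w}.obj m.unop).map q t) := by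
  let φ : F.obj U ⊗ SSet.stdSimplex.{w}.obj m.unop ⟶ W.obj U := NatTrans.app (C := Cᵒᵖ)
    (D := SSet.{w}) (F := F ⊗ (Functor.const Cᵒᵖ).obj (SSet.stdSimplex.{w}.obj m.unop)) (G := W) g U
  let z : (F.obj U ⊗ SSet.stdSimplex.{w}.obj m.unop : SSet.{w}).obj k := (a, t)
  exact (NatTrans.naturality_apply φ q z).symm

lemma map_app_mapSpaceApp (g : (mapSpace F W).obj m) {U V : Cᵒᵖ} (f : U ⟶ V)
    {k : SimplexCategoryᵒᵖ} (a : (F.obj U).obj k)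
    (t : (SSet.stdSimplex.{w}.obj m.unop).obj k) :
    (W.map f).app k (mapSpaceApp g U a t) = mapSpaceApp g V ((F.map f).app k a) t :=
  (app_congr (NatTrans.naturality (C := Cᵒᵖ) (D := SSet.{w})
    (F := F ⊗ (Functor.const Cᵒᵖ).obj (SSet.stdSimplex.{w}.obj m.unop)) (G := W) g f) k (a, t)).symm

lemma mapSpaceApp_map (g : (mapSpace F W).obj m) {m' : SimplexCategoryᵒᵖ} (q : m ⟶ m') (U : Cᵒᵖ)
    {k : SimplexCategoryᵒᵖ} (a : (F.obj U).obj k) (t : (SSet.stdSimplex.{w}.obj m'.unop).obj k) :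
    mapSpaceApp ((mapSpace F W).map q g) U a t =
      mapSpaceApp g U a ((SSet.stdSimplex.{w}.map q.unop).app k t) := rfl

lemma mapSpace_ext {g g' : (mapSpace F W).obj m}
    (h : ∀ (U : Cᵒᵖ) (k : SimplexCategoryᵒᵖ) (a : (F.obj U).obj k)
      (t : (SSet.stdSimplex.{w}.obj m.unop).obj k), mapSpaceApp g U a t = mapSpaceApp g' U a t) :
    g = g' := by
  apply NatTrans.ext
  funext U
  apply NatTrans.ext
  funext k
  exact ConcreteCategory.hom_ext _ _ fun z ↦ h U k z.1 z.2

variable (m) in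
/-- Constructor for simplices of mapping spaces. -/
def mkMapSpace (e : ∀ (U : Cᵒᵖ) (k : SimplexCategoryᵒᵖ), (F.obj U).obj k →
      (SSet.stdSimplex.{w}.obj m.unop).obj k → (W.obj U).obj k)
    (h : ∀ (U : Cᵒᵖ) (k k' : SimplexCategoryᵒᵖ) (q : k ⟶ k') (a : (F.obj U).obj k)
      (t : (SSet.stdSimplex.{w}.obj m.unop).obj k), (W.obj U).map q (e U k a t) =
        e U k' ((F.obj U).map q a) ((SSet.stdSimplex.{w}.obj m.unop).map q t))
    (h' : ∀ (U V : Cᵒᵖ) (f : U ⟶ V) (k : SimplexCategoryᵒᵖ) (a : (F.obj U).obj k)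
      (t : (SSet.stdSimplex.{w}.obj m.unop).obj k), (W.map f).app k (e U k a t) =
        e V k ((F.map f).app k a) t) : (mapSpace F W).obj m :=
  ({ app U :=
      { app k := ↾fun z ↦ e U k z.1 z.2
        naturality k k' q := ConcreteCategory.hom_ext _ _ fun z ↦ (h U k k' q z.1 z.2).symm }
     naturality U V f := by
       apply NatTrans.ext
       funext k
       exact ConcreteCategory.hom_ext _ _ fun z ↦ (h' U V f k z.1 z.2).symm } :
    F ⊗ (Functor.const Cᵒᵖ).obj (SSet.stdSimplex.{w}.obj m.unop) ⟶ W)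

end

/-- Maps from a simplicial set `X` to the mapping space `Map(F, W)` correspond to maps from the
product of `X` and `F` to `W`. -/
def mapSpaceHomEquiv (X : SSet.{w}) (F W : SPre.{w} C) :
    (SSet.uliftFunctor.{u}.obj X ⟶ mapSpace F W) ≃ (F ⋙ tensorLeft X ⟶ W) where
  toFun φ :=
    { app U :=
        { app m := ↾fun z ↦ mapSpaceApp (φ.app m ⟨z.1⟩) U z.2 (stdSimplex.objEquiv.symm (𝟙 m.unop))
          naturality m m' q := by
            refine ConcreteCategory.hom_ext _ _ fun z ↦ ?_
            have h := NatTrans.naturality_apply φ q ⟨z.1⟩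
            refine Eq.trans ?_ (map_mapSpaceApp (φ.app m ⟨z.1⟩) U q z.2
              (stdSimplex.objEquiv.symm (𝟙 m.unop))).symm
            refine (congrArg (fun g ↦ mapSpaceApp g U ((F.obj U).map q z.2)
              (stdSimplex.objEquiv.symm (𝟙 m'.unop))) h).trans ?_
            rw [mapSpaceApp_map]
            congr 1 }
      naturality U V f := by
        apply NatTrans.ext
        funext m
        exact ConcreteCategory.hom_ext _ _ fun z ↦ (map_app_mapSpaceApp (φ.app m ⟨z.1⟩) f z.2
          (stdSimplex.objEquiv.symm (𝟙 m.unop))).symm }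
  invFun ψ :=
    { app m := ↾fun x ↦ mkMapSpace m
        (fun U k a t ↦ (ψ.app U).app k ((SSet.yonedaEquiv.symm x.down).app k t, a))
        (fun U k k' q a t ↦ by
          refine (NatTrans.naturality_apply (ψ.app U) q _).symm.trans ?_
          refine congrArg (fun y ↦ (ψ.app U).app k' (y, (F.obj U).map q a)) ?_
          exact (NatTrans.naturality_apply (SSet.yonedaEquiv.symm x.down) q t).symm)
        (fun U V f k a t ↦ (app_congr (ψ.naturality f) k _).symm)
      naturality m m' q := by
        refine ConcreteCategory.hom_ext _ _ fun x ↦ ?_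
        apply mapSpace_ext
        intro U k a t
        exact congrArg (fun y ↦ (ψ.app U).app k (y, a))
          (app_congr (SSet.yonedaEquiv_symm_naturality_left q.unop x.down) k t).symm }
  left_inv φ := by
    apply NatTrans.ext
    funext m
    refine ConcreteCategory.hom_ext _ _ fun x ↦ ?_
    apply mapSpace_ext
    intro U k a t
    have h := NatTrans.naturality_apply φ (stdSimplex.objEquiv t).op x
    refine (congrArg (fun g ↦ mapSpaceApp g U a (stdSimplex.objEquiv.symm (𝟙 k.unop))) h).trans ?_
    rw [mapSpaceApp_map]
    congr 1
    exact stdSimplex.objEquiv.injective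
      (Category.id_comp (obj := SimplexCategory) (stdSimplex.objEquiv t))
  right_inv ψ := by
    apply NatTrans.ext
    funext U
    apply NatTrans.ext
    funext m
    refine ConcreteCategory.hom_ext _ _ fun z ↦ ?_
    refine congrArg (fun y ↦ (ψ.app U).app m (y, z.2)) ?_
    exact SSet.yonedaEquiv.apply_symm_apply z.1

lemma mapSpaceHomEquiv_naturality_left {X Y : SSet.{w}} (j : X ⟶ Y) {F W : SPre.{w} C}
    (φ : SSet.uliftFunctor.{u}.obj Y ⟶ mapSpace F W) :
    mapSpaceHomEquiv X F W (SSet.uliftFunctor.{u}.map j ≫ φ) =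
      Functor.whiskerLeft F ((curriedTensor _).map j) ≫ mapSpaceHomEquiv Y F W φ := rfl

lemma mapSpaceHomEquiv_naturality_right {X : SSet.{w}} {F G : SPre.{w} C} (f : F ⟶ G)
    (W : SPre.{w} C) (φ : SSet.uliftFunctor.{u}.obj X ⟶ mapSpace G W) :
    mapSpaceHomEquiv X F W (φ ≫ mapSpacePrecomp f W) =
      Functor.whiskerRight f (tensorLeft X) ≫ mapSpaceHomEquiv X G W φ := rfl

/-- Maps from a simplicial set `X` to the mapping space `Map(F, W)` correspond to maps from `F` to
the power of `W` by `X`. -/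
def mapSpacePowerEquiv (X : SSet.{w}) (F W : SPre.{w} C) :
    (SSet.uliftFunctor.{u}.obj X ⟶ mapSpace F W) ≃ (F ⟶ W ⋙ ihom X) :=
  (mapSpaceHomEquiv X F W).trans (((ihom.adjunction X).whiskerRight Cᵒᵖ).homEquiv F W)

lemma mapSpacePowerEquiv_app {X : SSet.{w}} {F W : SPre.{w} C}
    (φ : SSet.uliftFunctor.{u}.obj X ⟶ mapSpace F W) (U : Cᵒᵖ) :
    (mapSpacePowerEquiv X F W φ).app U =
      MonoidalClosed.curry ((mapSpaceHomEquiv X F W φ).app U) := by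
  rw [MonoidalClosed.curry_eq]
  refine (congrArg (fun t : F ⟶ W ⋙ ihom X ↦ t.app U)
    (((ihom.adjunction X).whiskerRight Cᵒᵖ).homEquiv_unit _ _ _)).trans ?_
  simp

lemma mapSpacePowerEquiv_naturality_left {X Y : SSet.{w}} (j : X ⟶ Y) {F W : SPre.{w} C}
    (φ : SSet.uliftFunctor.{u}.obj Y ⟶ mapSpace F W) :
    mapSpacePowerEquiv X F W (SSet.uliftFunctor.{u}.map j ≫ φ) =
      mapSpacePowerEquiv Y F W φ ≫ Functor.whiskerLeft W (MonoidalClosed.pre j) := by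
  apply NatTrans.ext
  funext U
  rw [NatTrans.comp_app, mapSpacePowerEquiv_app, mapSpacePowerEquiv_app,
    mapSpaceHomEquiv_naturality_left, Functor.whiskerLeft_app, MonoidalClosed.curry_pre_app]
  rfl

lemma mapSpacePowerEquiv_naturality_right {X : SSet.{w}} {F G : SPre.{w} C} (f : F ⟶ G)
    (W : SPre.{w} C) (φ : SSet.uliftFunctor.{u}.obj X ⟶ mapSpace G W) :
    mapSpacePowerEquiv X F W (φ ≫ mapSpacePrecomp f W) = f ≫ mapSpacePowerEquiv X G W φ := by
  apply NatTrans.ext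
  funext U
  rw [NatTrans.comp_app, mapSpacePowerEquiv_app, mapSpacePowerEquiv_app,
    mapSpaceHomEquiv_naturality_right, ← MonoidalClosed.curry_natural_left]
  rfl

/-- The map of powers of a simplicial presheaf induced by a map of simplicial sets. -/
abbrev powerMap {X Y : SSet.{w}} (j : X ⟶ Y) (W : SPre.{w} C) : W ⋙ ihom Y ⟶ W ⋙ ihom X :=
  Functor.whiskerLeft W (MonoidalClosed.pre j)

/-- The mapping space lives in a larger universe than the simplicial sets it is tested on. Passing
to lifting properties against lifted maps `j` moves all later arguments back to universe `w`. -/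
lemma hasLiftingProperty_mapSpacePrecomp_iff {X Y : SSet.{w}} (j : X ⟶ Y) {F G : SPre.{w} C}
    (f : F ⟶ G) (W : SPre.{w} C) :
    HasLiftingProperty (SSet.uliftFunctor.{u}.map j) (mapSpacePrecomp f W) ↔
      HasLiftingProperty f (powerMap j W) := by
  constructor
  · intro _
    refine ⟨fun {a b} sq ↦ ?_⟩
    obtain ⟨β, rfl⟩ := (mapSpacePowerEquiv _ _ _).surjective a
    obtain ⟨α, rfl⟩ := (mapSpacePowerEquiv _ _ _).surjective b
    have sq' : CommSq α (SSet.uliftFunctor.{u}.map j) (mapSpacePrecomp f W) β := ⟨by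
      apply (mapSpacePowerEquiv _ _ _).injective
      rw [mapSpacePowerEquiv_naturality_left, mapSpacePowerEquiv_naturality_right, sq.w]⟩
    refine ⟨⟨⟨mapSpacePowerEquiv _ _ _ sq'.lift, ?_, ?_⟩⟩⟩
    · rw [← mapSpacePowerEquiv_naturality_right, sq'.fac_right]
    · rw [← mapSpacePowerEquiv_naturality_left, sq'.fac_left]
  · intro _
    refine ⟨fun {α β} sq ↦ ?_⟩
    have sq' : CommSq (mapSpacePowerEquiv _ _ _ β) f (powerMap j W)
        (mapSpacePowerEquiv _ _ _ α) := ⟨by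
      rw [← mapSpacePowerEquiv_naturality_left, ← mapSpacePowerEquiv_naturality_right, sq.w]⟩
    refine ⟨⟨⟨(mapSpacePowerEquiv _ _ _).symm sq'.lift, ?_, ?_⟩⟩⟩
    · apply (mapSpacePowerEquiv _ _ _).injective
      rw [mapSpacePowerEquiv_naturality_left, Equiv.apply_symm_apply, sq'.fac_right]
    · apply (mapSpacePowerEquiv _ _ _).injective
      rw [mapSpacePowerEquiv_naturality_right, Equiv.apply_symm_apply, sq'.fac_left]

end

/-! ### Inclusions of subcomplexes of simplices in different universes -/

/-- The standard simplices in different universes. -/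
def uliftStdSimplexIso (n : SimplexCategory) :
    SSet.stdSimplex.{max u w}.obj n ≅ SSet.uliftFunctor.{u}.obj (SSet.stdSimplex.{w}.obj n) :=
  NatIso.ofComponents (fun m ↦ Equiv.toIso
    (((stdSimplex.objEquiv.{max u w} (n := n) (m := m)).trans
      (stdSimplex.objEquiv.{w} (n := n) (m := m)).symm).trans Equiv.ulift.symm)) (by
    intro m m' q
    rfl)

/-- The inclusions of corresponding subcomplexes of a standard simplex in different universes. -/
def uliftSubcomplexArrowIso {n : SimplexCategory} (A : (SSet.stdSimplex.{max u w}.obj n).Subcomplex)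
    (B : (SSet.stdSimplex.{w}.obj n).Subcomplex)
    (h : ∀ m (f : m.unop ⟶ n), stdSimplex.objEquiv.symm f ∈ A.obj m ↔
      stdSimplex.objEquiv.symm f ∈ B.obj m) :
    Arrow.mk A.ι ≅ Arrow.mk (SSet.uliftFunctor.{u}.map B.ι) :=
  Arrow.isoMk (NatIso.ofComponents (fun m ↦ Equiv.toIso
    { toFun x := ⟨⟨stdSimplex.objEquiv.symm (stdSimplex.objEquiv x.1),
        (h m _).1 x.2⟩⟩
      invFun x := ⟨stdSimplex.objEquiv.symm (stdSimplex.objEquiv x.down.1), (h m _).2 x.down.2⟩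
      left_inv _ := rfl
      right_inv _ := rfl }) (fun _ ↦ rfl)) (uliftStdSimplexIso n) rfl

lemma hasLiftingProperty_boundary_ι_iff (n : ℕ) {E B : SSet.{max u w}} (p : E ⟶ B) :
    HasLiftingProperty (boundary.{max u w} n).ι p ↔
      HasLiftingProperty (SSet.uliftFunctor.{u}.map (boundary.{w} n).ι) p :=
  HasLiftingProperty.iff_of_arrow_iso_left
    (uliftSubcomplexArrowIso.{w, u} _ _ fun _ _ ↦ Iff.rfl) p

lemma hasLiftingProperty_horn_ι_iff (n : ℕ) (i : Fin (n + 1)) {E B : SSet.{max u w}} (p : E ⟶ B) :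
    HasLiftingProperty (horn.{max u w} n i).ι p ↔
      HasLiftingProperty (SSet.uliftFunctor.{u}.map (horn.{w} n i).ι) p :=
  HasLiftingProperty.iff_of_arrow_iso_left
    (uliftSubcomplexArrowIso.{w, u} _ _ fun _ _ ↦ Iff.rfl) p

/-! ### Mapping spaces into skyscraper presheaves -/

lemma map_map'_comp_piComparison (G : SSet.{w} ⥤ SSet.{w}) {ι ι' : Type w} (f : ι' → ι)
    (K : SSet.{w}) :
    G.map (Pi.map' f (fun _ ↦ 𝟙 K)) ≫ piComparison G (fun _ : ι' ↦ K) =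
      piComparison G (fun _ : ι ↦ K) ≫ Pi.map' f (fun _ ↦ 𝟙 (G.obj K)) := by
  apply Pi.hom_ext
  intro y
  simp [← G.map_comp]

lemma app_comp_piComparison {G G' : SSet.{w} ⥤ SSet.{w}} (τ : G ⟶ G') (ι : Type w)
    (K : SSet.{w}) :
    τ.app (∏ᶜ fun _ : ι ↦ K) ≫ piComparison G' (fun _ : ι ↦ K) =
      piComparison G (fun _ : ι ↦ K) ≫ Limits.Pi.map (fun _ ↦ τ.app K) := by
  apply Pi.hom_ext
  intro y
  simp

section

variable {C : Type u} [Category.{v} C] {J : GrothendieckTopology C}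
  (x : GrothendieckTopology.Point.{w} J)

/-- The powers of a skyscraper presheaf are skyscraper presheaves. -/
def skyscraperPowerIso (X K : SSet.{w}) :
    x.skyscraperPresheaf K ⋙ ihom X ≅ x.skyscraperPresheaf ((ihom X).obj K) :=
  NatIso.ofComponents (fun U ↦ PreservesProduct.iso (ihom X) (fun _ : x.fiber.obj U.unop ↦ K))
    fun {_ _} f ↦ map_map'_comp_piComparison (ihom X) (x.fiber.map f.unop) K

lemma skyscraperPowerIso_naturality {X Y : SSet.{w}} (j : X ⟶ Y) (K : SSet.{w}) :
    powerMap j (x.skyscraperPresheaf K) ≫ (skyscraperPowerIso x X K).hom =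
      (skyscraperPowerIso x Y K).hom ≫ x.skyscraperPresheafFunctor.map
        ((MonoidalClosed.pre j).app K) := by
  apply NatTrans.ext
  funext U
  exact app_comp_piComparison (MonoidalClosed.pre j) _ K

/-- Powers of skyscrapers are skyscrapers of powers, and the skyscraper is right adjoint to the
stalk. -/
lemma hasLiftingProperty_mapSpacePrecomp_skyscraperPresheaf_iff {X Y : SSet.{w}} (j : X ⟶ Y)
    {F G : SPre.{w} C} (f : F ⟶ G) (K : SSet.{w}) :
    HasLiftingProperty (SSet.uliftFunctor.{u}.map j)
      (mapSpacePrecomp f (x.skyscraperPresheaf K)) ↔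
      HasLiftingProperty (x.presheafFiber.map f) ((MonoidalClosed.pre j).app K) := by
  rw [hasLiftingProperty_mapSpacePrecomp_iff, x.skyscraperPresheafAdjunction.hasLiftingProperty_iff]
  exact HasLiftingProperty.iff_of_arrow_iso_right f (Arrow.isoMk (skyscraperPowerIso x Y K)
    (skyscraperPowerIso x X K) (skyscraperPowerIso_naturality x j K).symm)

end

/-! ### Powers of Kan complexes -/

lemma kanFibrations_pre {A B : SSet.{w}} (i : A ⟶ B) [Mono i] (K : SSet.{w}) [KanComplex K] :
    kanFibrations ((MonoidalClosed.pre i).app K) :=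
  (fibration_iff _).1 (inferInstance : HomotopicalAlgebra.Fibration ((MonoidalClosed.pre i).app K))

/-- Both conditions say that maps to `K` extend along the pushout-product of `i` and `j`, which is
symmetric. -/
lemma hasLiftingProperty_pre_of_swap {A B X Y : SSet.{w}} (i : A ⟶ B) (j : X ⟶ Y) (K : SSet.{w})
    [HasLiftingProperty i ((MonoidalClosed.pre j).app K)] :
    HasLiftingProperty j ((MonoidalClosed.pre i).app K) := by
  refine ⟨fun {φ ψ} sq ↦ ?_⟩
  obtain ⟨φ, rfl⟩ : ∃ φ', MonoidalClosed.curry φ' = φ := ⟨_, MonoidalClosed.curry_uncurry φ⟩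
  obtain ⟨ψ, rfl⟩ : ∃ ψ', MonoidalClosed.curry ψ' = ψ := ⟨_, MonoidalClosed.curry_uncurry ψ⟩
  have h : i ▷ X ≫ φ = A ◁ j ≫ ψ := by
    apply MonoidalClosed.curry_injective
    rw [← MonoidalClosed.curry_pre_app, MonoidalClosed.curry_natural_left, sq.w]
  have sq' : CommSq (MonoidalClosed.curry ((β_ Y A).hom ≫ ψ)) i ((MonoidalClosed.pre j).app K)
      (MonoidalClosed.curry ((β_ X B).hom ≫ φ)) := ⟨by
    rw [MonoidalClosed.curry_pre_app, ← MonoidalClosed.curry_natural_left,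
      BraidedCategory.braiding_naturality_left_assoc,
      BraidedCategory.braiding_naturality_right_assoc, h]⟩
  refine ⟨⟨⟨MonoidalClosed.curry ((β_ B Y).hom ≫ MonoidalClosed.uncurry sq'.lift), ?_, ?_⟩⟩⟩
  · rw [← MonoidalClosed.curry_natural_left, BraidedCategory.braiding_naturality_right_assoc,
      ← MonoidalClosed.uncurry_pre_app, sq'.fac_right, MonoidalClosed.uncurry_curry,
      SymmetricCategory.symmetry_assoc]
  · rw [MonoidalClosed.curry_pre_app, BraidedCategory.braiding_naturality_left_assoc,
      ← MonoidalClosed.uncurry_natural_left, sq'.fac_left, MonoidalClosed.uncurry_curry,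
      SymmetricCategory.symmetry_assoc]

/-- Maps to `K` are points of the internal hom, and homotopies are paths in it. Lifting points gives
existence of extensions; lifting paths with given ends gives uniqueness up to homotopy. -/
lemma kanWeakEquivalences_of_trivialFibrations_pre {A B : SSet.{w}} (i : A ⟶ B)
    (hi : ∀ (K : SSet.{w}) [KanComplex K], trivialFibrations ((MonoidalClosed.pre i).app K)) :
    kanWeakEquivalences i := by
  intro K _
  have hp := hi K
  have hbot (n) := isEmpty_bot_obj (𝟙_ SSet.{w}) n
  refine ⟨fun a ↦ ?_, fun b b' h ↦ ?_⟩
  · have := trivialFibrations_lift (⊥ : (𝟙_ SSet.{w}).Subcomplex).ι hp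
    have sq : CommSq (homOfIsEmpty hbot _) (⊥ : (𝟙_ SSet.{w}).Subcomplex).ι
      ((MonoidalClosed.pre i).app K) (MonoidalClosed.curry ((ρ_ A).hom ≫ a)) :=
      ⟨hom_ext_of_isEmpty hbot _ _⟩
    have h := sq.fac_right
    rw [← MonoidalClosed.curry_uncurry sq.lift, MonoidalClosed.curry_pre_app] at h
    refine ⟨(ρ_ B).inv ≫ MonoidalClosed.uncurry sq.lift, ?_⟩
    rw [rightUnitor_inv_naturality_assoc, MonoidalClosed.curry_injective h, Iso.inv_hom_id_assoc]
    exact nonempty_homotopy_refl a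
  · have h' := nonempty_homotopy_precomp (ρ_ A).hom h
    rw [← rightUnitor_naturality_assoc, ← rightUnitor_naturality_assoc,
      ← nonempty_homotopy_curry_iff, ← MonoidalClosed.curry_pre_app,
      ← MonoidalClosed.curry_pre_app] at h'
    obtain ⟨H, h₀, h₁⟩ := nonempty_homotopy_iff.1 h'
    have hbot' (n) := isEmpty_tensor_obj (hbot n) (Δ[1] : SSet.{w})
    obtain ⟨G, hG₀, hG₁, -, -⟩ := trivialFibrations_homotopy_lift
      (⊥ : (𝟙_ SSet.{w}).Subcomplex).ι hp _ _ (homOfIsEmpty hbot' _) H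
      (hom_ext_of_isEmpty hbot _ _) (hom_ext_of_isEmpty hbot _ _) h₀.symm h₁.symm
      (hom_ext_of_isEmpty hbot' _ _)
    have h'' := nonempty_homotopy_of_hom G hG₀ hG₁
    rw [nonempty_homotopy_curry_iff] at h''
    simpa using nonempty_homotopy_precomp (ρ_ B).inv h''

/-! ### Mapping spaces into projectively fibrant simplicial presheaves -/

section

variable {C : Type u} [Category.{v} C]

lemma mapSpacePrecomp_comp {F G H : SPre.{w} C} (f : F ⟶ G) (g : G ⟶ H) (W : SPre.{w} C) :
    mapSpacePrecomp (f ≫ g) W = mapSpacePrecomp g W ≫ mapSpacePrecomp f W := rfl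

lemma mapSpacePrecomp_id (F W : SPre.{w} C) : mapSpacePrecomp (𝟙 F) W = 𝟙 _ := by
  apply NatTrans.ext
  funext m
  exact ConcreteCategory.hom_ext _ _ fun g ↦ mapSpace_ext fun U k a t ↦ rfl

lemma trivialFibrations_mapSpacePrecomp_iff {F G : SPre.{w} C} (f : F ⟶ G) (W : SPre.{w} C) :
    trivialFibrations (mapSpacePrecomp f W) ↔
      ∀ n : ℕ, HasLiftingProperty f (powerMap (boundary.{w} n).ι W) := by
  simp only [← hasLiftingProperty_mapSpacePrecomp_iff, ← hasLiftingProperty_boundary_ι_iff]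
  exact ⟨fun h n ↦ h _ ⟨n⟩, by rintro h _ _ _ ⟨n⟩; exact h n⟩

lemma trivialFibrations_mapSpacePrecomp {F G : SPre.{w} C} (f : F ⟶ G)
    (hf : (objectwise C kanFibrations).llp f) {W : SPre.{w} C} (hW : IsProjectiveFibrant W) :
    trivialFibrations (mapSpacePrecomp f W) := by
  rw [trivialFibrations_mapSpacePrecomp_iff]
  refine fun n ↦ hf _ fun U ↦ ?_
  have := hW U
  exact kanFibrations_pre (boundary.{w} n).ι (W.obj U)

lemma IsProjectiveCofibrant.lift {F : SPre.{w} C} (hF : IsProjectiveCofibrant F)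
    {G H : SPre.{w} C} (p : G ⟶ H) (hp : objectwise C trivialFibrations p) (f : F ⟶ H) :
    ∃ g : F ⟶ G, g ≫ p = f := by
  rw [IsProjectiveCofibrant, projectiveCofibrations_eq] at hF
  have := hF p hp
  have sq : CommSq (initial.to G) (initial.to F) p f := ⟨by simp⟩
  exact ⟨sq.lift, sq.fac_right⟩

lemma IsProjectiveCofibrant.of_llp {F G : SPre.{w} C} (hF : IsProjectiveCofibrant F) (f : F ⟶ G)
    (hf : (objectwise C trivialFibrations).llp f) : IsProjectiveCofibrant G := by
  rw [IsProjectiveCofibrant, projectiveCofibrations_eq] at hF ⊢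
  rw [← initial.to_comp f]
  exact MorphismProperty.comp_mem _ _ _ hF hf

lemma objectwise_trivialFibrations_powerMap {X Y : SSet.{w}} (j : X ⟶ Y) [Mono j]
    (hj : kanWeakEquivalences j) {W : SPre.{w} C} (hW : IsProjectiveFibrant W) :
    objectwise C trivialFibrations (powerMap j W) := by
  intro U
  have := hW U
  exact trivialFibrations_pre j hj (W.obj U)

/-- Filling a horn amounts to lifting a map from `F` along the power of `W` by the horn inclusion,
which is an objectwise trivial fibration. -/
lemma kanComplex_mapSpace {F W : SPre.{w} C} (hF : IsProjectiveCofibrant F)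
    (hW : IsProjectiveFibrant W) : KanComplex (mapSpace F W) := by
  rw [kanComplex_iff]
  intro _ _ i hi
  simp only [modelCategoryQuillen.J, MorphismProperty.iSup_iff] at hi
  obtain ⟨n, ⟨k⟩⟩ := hi
  rw [hasLiftingProperty_horn_ι_iff.{w, u}]
  refine ⟨fun {φ t} sq ↦ ?_⟩
  obtain ⟨ψ, hψ⟩ := hF.lift (powerMap (horn.{w} (n + 1) k).ι W)
    (objectwise_trivialFibrations_powerMap _ (kanWeakEquivalences_of_anodyneExtensions
      (J.le_llp_rlp _ (by
        simp only [modelCategoryQuillen.J, MorphismProperty.iSup_iff]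
        exact ⟨n, ⟨k⟩⟩))) hW)
    (mapSpacePowerEquiv _ _ _ φ)
  obtain ⟨ψ, rfl⟩ := (mapSpacePowerEquiv _ _ _).surjective ψ
  rw [← mapSpacePowerEquiv_naturality_left] at hψ
  exact ⟨⟨⟨ψ, (mapSpacePowerEquiv _ _ _).injective hψ, by subsingleton⟩⟩⟩

end

/-- On homotopy classes of maps into `K`, the section `c'` makes precomposition with `c ≫ d`
surjective, and `a` makes it injective. Two-out-of-three then applies to `a`. -/
lemma kanWeakEquivalences_of_sections {M₁ M₂ M₃ : SSet.{w}} {a : M₁ ⟶ M₂} {c : M₂ ⟶ M₃}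
    {d : M₃ ⟶ M₁} {c' : M₃ ⟶ M₂} (h : a ≫ c ≫ d = 𝟙 M₁) (h' : c ≫ c' = 𝟙 M₂)
    (hd : kanWeakEquivalences d) : kanWeakEquivalences a := by
  have hcd : kanWeakEquivalences (c ≫ d) := by
    intro K _
    refine ⟨fun m ↦ ?_, fun k k' hk ↦ ?_⟩
    · obtain ⟨k, hk⟩ := (hd K).1 (c' ≫ m)
      exact ⟨k, by simpa [reassoc_of% h'] using nonempty_homotopy_precomp c hk⟩
    · have := nonempty_homotopy_precomp a hk
      simpa [reassoc_of% h] using this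
  refine kanWeakEquivalences_of_postcomp hcd ?_
  rw [h]
  exact kanWeakEquivalences_of_isIso _

/-! ### Mapping spaces into skyscrapers detect weak equivalences of stalks -/

section

variable {C : Type u} [Category.{v} C] {J : GrothendieckTopology C}
  (x : GrothendieckTopology.Point.{w} J)

/-- For a cofibration between cofibrant objects, `mapSpacePrecomp` into the skyscraper of `K` is a
Kan fibration between Kan complexes, hence a trivial fibration. By adjunction and the swap lemma
this says that restriction of maps to `K` along the stalk of `i` is a trivial fibration. -/
lemma kanWeakEquivalences_presheafFiber_map_of_llp {F G : SPre.{w} C} (i : F ⟶ G)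
    (hF : IsProjectiveCofibrant F) (hi : (objectwise C trivialFibrations).llp i)
    (h : ∀ (K : SSet.{w}) [KanComplex K],
      kanWeakEquivalences (mapSpacePrecomp i (x.skyscraperPresheaf K))) :
    kanWeakEquivalences (x.presheafFiber.map i) := by
  have := mono_presheafFiber_map_of_llp x i hi
  refine kanWeakEquivalences_of_trivialFibrations_pre _ fun K _ ↦ ?_
  have hK := isProjectiveFibrant_skyscraperPresheaf x K
  have := kanComplex_mapSpace hF hK
  have := kanComplex_mapSpace (hF.of_llp i hi) hK
  have hM : trivialFibrations (mapSpacePrecomp i (x.skyscraperPresheaf K)) := by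
    refine trivialFibrations_of_kanComplex ?_ (h K)
    intro _ _ j hj
    simp only [modelCategoryQuillen.J, MorphismProperty.iSup_iff] at hj
    obtain ⟨n, ⟨k⟩⟩ := hj
    rw [hasLiftingProperty_horn_ι_iff.{w, u},
      hasLiftingProperty_mapSpacePrecomp_skyscraperPresheaf_iff]
    refine trivialFibrations_lift _ (trivialFibrations_pre _
      (kanWeakEquivalences_of_anodyneExtensions (modelCategoryQuillen.J.le_llp_rlp _ ?_)) K)
    simp only [modelCategoryQuillen.J, MorphismProperty.iSup_iff]
    exact ⟨n, ⟨k⟩⟩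
  rw [trivialFibrations_mapSpacePrecomp_iff] at hM
  rintro _ _ _ ⟨n⟩
  have := hM n
  rw [← hasLiftingProperty_mapSpacePrecomp_iff,
    hasLiftingProperty_mapSpacePrecomp_skyscraperPresheaf_iff] at this
  exact hasLiftingProperty_pre_of_swap _ _ _

end

/-! ### Skyscrapers as hypercover-local objects; local weak equivalences on stalks -/

section

variable {C : Type u} [Category.{v} C] [EssentiallySmall.{w} C]

lemma exists_factorization_of_objectwiseWeakEquivalences {F G : SPre.{w} C} (f : F ⟶ G)
    (hf : objectwiseWeakEquivalences C f) :
    ∃ (M : SPre.{w} C) (i : F ⟶ M) (q : M ⟶ G),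
      (objectwise C kanFibrations).llp i ∧ objectwise C trivialFibrations q ∧ i ≫ q = f := by
  obtain ⟨M, i, q, hi, hq, rfl⟩ := exists_factorization_kanFibrations f
  refine ⟨M, i, q, hi, fun U ↦ ?_, rfl⟩
  refine trivialFibrations_of_kanWeakEquivalences (hq U) (kanWeakEquivalences_of_precomp
    (kanWeakEquivalences_of_anodyneExtensions (anodyneExtensions_app i hi U)) ?_)
  simpa using hf U

/-- The acyclic cofibration `j` induces a trivial fibration. The objectwise trivial fibration `q`
has a section `s`, as its target is cofibrant; factoring `s` in the same way, with a section of its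
second factor, gives the situation of `kanWeakEquivalences_of_sections`. -/
lemma kanWeakEquivalences_mapSpacePrecomp {F G : SPre.{w} C} (f : F ⟶ G)
    (hF : IsProjectiveCofibrant F) (hG : IsProjectiveCofibrant G)
    (hf : objectwiseWeakEquivalences C f) {W : SPre.{w} C} (hW : IsProjectiveFibrant W) :
    kanWeakEquivalences (mapSpacePrecomp f W) := by
  obtain ⟨E, j, q, hj, hq, rfl⟩ := exists_factorization_of_objectwiseWeakEquivalences f hf
  have hE := hF.of_llp j (MorphismProperty.antitone_llp objectwise_trivialFibrations_le _ hj)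
  obtain ⟨s, hs⟩ := hG.lift q hq (𝟙 G)
  have hs' : objectwiseWeakEquivalences C s := fun U ↦
    kanWeakEquivalences_of_postcomp (kanWeakEquivalences_of_trivialFibrations (hq U)) (by
      rw [← NatTrans.comp_app, hs]
      exact kanWeakEquivalences_of_isIso _)
  obtain ⟨E', j', q', hj', hq', rfl⟩ := exists_factorization_of_objectwiseWeakEquivalences s hs'
  obtain ⟨s', hs'⟩ := hE.lift q' hq' (𝟙 E)
  rw [mapSpacePrecomp_comp]
  refine kanWeakEquivalences_comp (kanWeakEquivalences_of_sections
    (c := mapSpacePrecomp q' W) (d := mapSpacePrecomp j' W) (c' := mapSpacePrecomp s' W) ?_ ?_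
    (kanWeakEquivalences_of_trivialFibrations (trivialFibrations_mapSpacePrecomp j' hj' hW)))
    (kanWeakEquivalences_of_trivialFibrations (trivialFibrations_mapSpacePrecomp j hj hW))
  · rw [← mapSpacePrecomp_comp, ← mapSpacePrecomp_comp, hs, mapSpacePrecomp_id]
  · rw [← mapSpacePrecomp_comp, hs', mapSpacePrecomp_id]

variable (J : GrothendieckTopology C)

lemma objectwiseWeakEquivalences_le_localWeakEquivalences :
    objectwiseWeakEquivalences.{w} C ≤ localWeakEquivalences J := by
  intro F G f hf W hW F' G' f' a b hF' hG' ha hb h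
  refine kanWeakEquivalences_mapSpacePrecomp f' hF' hG' (fun U ↦ ?_) hW.1
  refine kanWeakEquivalences_of_postcomp (hb U) ?_
  rw [← NatTrans.comp_app, h]
  exact kanWeakEquivalences_comp (ha U) (hf U)

variable {J} (x : GrothendieckTopology.Point.{w} J)

/-- On stalks a hypercover is a trivial fibration, so any cofibrant approximation of it is a weak
equivalence there. Its cofibration part `i` has an acyclic monomorphism as stalk, hence an anodyne
map, which lifts against the fibrations between powers of `K`. -/
lemma isHypercoverLocal_skyscraperPresheaf (K : SSet.{w}) [KanComplex K] :
    IsHypercoverLocal J (x.skyscraperPresheaf K) := by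
  have hK := isProjectiveFibrant_skyscraperPresheaf x K
  refine ⟨hK, fun X U p hp F G f a b hF hG ha hb h ↦ ?_⟩
  obtain ⟨M, i, q, hi, hq, rfl⟩ := exists_factorization_trivialFibrations f
  have hxf : kanWeakEquivalences (x.presheafFiber.map (i ≫ q)) := by
    refine kanWeakEquivalences_of_postcomp (kanWeakEquivalences_presheafFiber_map x b hb) ?_
    rw [← Functor.map_comp, h, Functor.map_comp]
    exact kanWeakEquivalences_comp (kanWeakEquivalences_presheafFiber_map x a ha)
      (kanWeakEquivalences_of_trivialFibrations
        (trivialFibrations_presheafFiber_map x p hp.isLocalAcyclicFibration))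
  have hxi : kanWeakEquivalences (x.presheafFiber.map i) := by
    rw [Functor.map_comp] at hxf
    exact kanWeakEquivalences_of_postcomp (kanWeakEquivalences_of_trivialFibrations
      (trivialFibrations_presheafFiber_map_of_objectwise x q hq)) hxf
  have := mono_presheafFiber_map_of_llp x i hi
  rw [mapSpacePrecomp_comp]
  refine kanWeakEquivalences_comp (kanWeakEquivalences_mapSpacePrecomp q (hF.of_llp i hi) hG
    (fun U ↦ kanWeakEquivalences_of_trivialFibrations (hq U)) hK)
    (kanWeakEquivalences_of_trivialFibrations ((trivialFibrations_mapSpacePrecomp_iff _ _).2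
      fun n ↦ ?_))
  rw [← hasLiftingProperty_mapSpacePrecomp_iff,
    hasLiftingProperty_mapSpacePrecomp_skyscraperPresheaf_iff]
  exact anodyneExtensions_of_kanWeakEquivalences _ hxi _ (kanFibrations_pre _ K)

/-- A cofibrant approximation of `f` that is itself a cofibration is tested against the skyscrapers
of all Kan complexes. -/
lemma localWeakEquivalences_le_stalkwiseWeakEquivalences :
    localWeakEquivalences.{w} J ≤ stalkwiseWeakEquivalences J := by
  intro A B f hf x
  obtain ⟨A', i₀, a, hi₀, ha, -⟩ := exists_factorization_trivialFibrations (initial.to A)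
  obtain ⟨B', i, b, hi, hb, h⟩ := exists_factorization_trivialFibrations (a ≫ f)
  have hA' : IsProjectiveCofibrant A' := by
    rw [IsProjectiveCofibrant, projectiveCofibrations_eq, Subsingleton.elim (initial.to A') i₀]
    exact hi₀
  have hxa := kanWeakEquivalences_of_trivialFibrations
    (trivialFibrations_presheafFiber_map_of_objectwise x a ha)
  have hxb := kanWeakEquivalences_of_trivialFibrations
    (trivialFibrations_presheafFiber_map_of_objectwise x b hb)
  have hxi : kanWeakEquivalences (x.presheafFiber.map i) :=
    kanWeakEquivalences_presheafFiber_map_of_llp x i hA' hi fun K _ ↦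
      hf _ (isHypercoverLocal_skyscraperPresheaf x K) i a b hA' (hA'.of_llp i hi)
        (fun U ↦ kanWeakEquivalences_of_trivialFibrations (ha U))
        (fun U ↦ kanWeakEquivalences_of_trivialFibrations (hb U)) h
  refine kanWeakEquivalences_of_precomp hxa ?_
  rw [← Functor.map_comp, ← h, Functor.map_comp]
  exact kanWeakEquivalences_comp hxi hxb

end

/-! ### Comparison of homotopy pullbacks -/

-- Filtered colimits are exact in simplicial sets because they are so in types; hence stalks
-- preserve pullbacks.
instance : AB5OfSize.{w, w} SSet.{w} where
  ofShape K _ _ := by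
    have : HasExactColimitsOfShape K (Type w) := ⟨inferInstance⟩
    exact inferInstanceAs (HasExactColimitsOfShape K (SimplexCategoryᵒᵖ ⥤ Type w))

/-- The two legs are replaced one at a time, through the mixed pullback of `p'` and `q`. -/
lemma kanWeakEquivalences_pullback_map {Z E E' F F' P P' : SSet.{w}} {p : E ⟶ Z} {q : F ⟶ Z}
    {p' : E' ⟶ Z} {q' : F' ⟶ Z} {s : P ⟶ E} {t : P ⟶ F} {s' : P' ⟶ E'} {t' : P' ⟶ F'}
    (hP : IsPullback s t p q) (hP' : IsPullback s' t' p' q') (hp : kanFibrations p)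
    (hp' : kanFibrations p') (hq : kanFibrations q) (hq' : kanFibrations q')
    {a : E ⟶ E'} {b : F ⟶ F'} (ha : a ≫ p' = p) (hb : b ≫ q' = q) (ha' : kanWeakEquivalences a)
    (hb' : kanWeakEquivalences b) (c : P ⟶ P') (hs : c ≫ s' = s ≫ a) (ht : c ≫ t' = t ≫ b) :
    kanWeakEquivalences c := by
  have hQ := IsPullback.of_hasPullback p' q
  let c₁ : P ⟶ pullback p' q := pullback.lift (s ≫ a) t (by rw [Category.assoc, ha, hP.w])
  let c₂ : pullback p' q ⟶ P' := hP'.lift (pullback.fst p' q) (pullback.snd p' q ≫ b)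
    (by rw [Category.assoc, hb, hQ.w])
  have hc₂ : c₂ ≫ t' = pullback.snd p' q ≫ b := hP'.lift_snd _ _ _
  have hc₂' : c₂ ≫ s' = pullback.fst p' q := hP'.lift_fst _ _ _
  have hc : c = c₁ ≫ c₂ := by
    apply hP'.hom_ext
    · rw [hs, Category.assoc, hc₂', pullback.lift_fst]
    · rw [ht, Category.assoc, hc₂, pullback.lift_snd_assoc]
  rw [hc]
  exact kanWeakEquivalences_comp
    (kanWeakEquivalences_pullback hP hQ hp hp' a ha ha' c₁ (pullback.lift_fst _ _ _)
      (pullback.lift_snd _ _ _))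
    (kanWeakEquivalences_pullback hQ.flip hP'.flip hq hq' b hb hb' c₂ hc₂ hc₂')

section

variable {C : Type u} [Category.{v} C]

lemma nonempty_factorizationMap {A B A' B' : MorphismProperty (SPre.{w} C)} (hA : A ≤ A')
    (hB' : B' ≤ A'.rlp) {X Z : SPre.{w} C} {f : X ⟶ Z} (E : A.MapFactorizationData B f)
    (E' : A'.MapFactorizationData B' f) : Nonempty (FactorizationMap E E') := by
  have := hB' _ E'.hp _ (hA _ E.hi)
  have sq : CommSq E'.i E.i E'.p E.p := ⟨by simp⟩
  exact ⟨⟨sq.lift, sq.fac_left, sq.fac_right⟩⟩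

variable [EssentiallySmall.{w} C] {J : GrothendieckTopology C}

lemma kanWeakEquivalences_presheafFiber_map_factorizationMap
    {A B A' B' : MorphismProperty (SPre.{w} C)} (hA : A ≤ objectwiseWeakEquivalences C)
    (hA' : A' ≤ localWeakEquivalences J) {X Z : SPre.{w} C} {f : X ⟶ Z}
    {E : A.MapFactorizationData B f} {E' : A'.MapFactorizationData B' f}
    (a : FactorizationMap E E') (x : GrothendieckTopology.Point.{w} J) :
    kanWeakEquivalences (x.presheafFiber.map a.hom) := by
  refine kanWeakEquivalences_of_precomp
    (kanWeakEquivalences_presheafFiber_map x _ (hA _ E.hi)) ?_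
  rw [← Functor.map_comp, a.i_hom]
  exact localWeakEquivalences_le_stalkwiseWeakEquivalences _ (hA' _ E'.hi) x

lemma stalkwiseWeakEquivalences_homotopyPullbackMap
    {A B A' B' : MorphismProperty (SPre.{w} C)} (hA : A ≤ objectwiseWeakEquivalences C)
    (hA' : A' ≤ localWeakEquivalences J) (hB : B ≤ objectwise C kanFibrations)
    (hB' : B' ≤ objectwise C kanFibrations) {X Y Z : SPre.{w} C} {f : X ⟶ Z} {g : Y ⟶ Z}
    {Ef : A.MapFactorizationData B f} {Eg : A.MapFactorizationData B g}
    {Ef' : A'.MapFactorizationData B' f} {Eg' : A'.MapFactorizationData B' g}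
    (a : FactorizationMap Ef Ef') (b : FactorizationMap Eg Eg') :
    stalkwiseWeakEquivalences J (homotopyPullbackMap a b) := by
  intro x
  refine kanWeakEquivalences_pullback_map
    ((IsPullback.of_hasPullback Ef.p Eg.p).map x.presheafFiber)
    ((IsPullback.of_hasPullback Ef'.p Eg'.p).map x.presheafFiber)
    (kanFibrations_presheafFiber_map x _ (hB _ Ef.hp))
    (kanFibrations_presheafFiber_map x _ (hB' _ Ef'.hp))
    (kanFibrations_presheafFiber_map x _ (hB _ Eg.hp))
    (kanFibrations_presheafFiber_map x _ (hB' _ Eg'.hp))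
    (by rw [← Functor.map_comp, a.hom_p]) (by rw [← Functor.map_comp, b.hom_p])
    (kanWeakEquivalences_presheafFiber_map_factorizationMap hA hA' a x)
    (kanWeakEquivalences_presheafFiber_map_factorizationMap hA hA' b x) _ ?_ ?_
  · rw [← Functor.map_comp, ← Functor.map_comp, homotopyPullbackMap, pullback.lift_fst]
  · rw [← Functor.map_comp, ← Functor.map_comp, homotopyPullbackMap, pullback.lift_snd]

variable (J)

lemma projectiveAcyclicCofibrations_le_localProjectiveAcyclicCofibrations :
    projectiveAcyclicCofibrations.{w} C ≤ localProjectiveAcyclicCofibrations J :=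
  fun _ _ _ h ↦ ⟨h.1, objectwiseWeakEquivalences_le_localWeakEquivalences J _ h.2⟩

lemma injectiveAcyclicCofibrations_le_localInjectiveAcyclicCofibrations :
    injectiveAcyclicCofibrations.{w} C ≤ localInjectiveAcyclicCofibrations J :=
  fun _ _ _ h ↦ ⟨h.1, objectwiseWeakEquivalences_le_localWeakEquivalences J _ h.2⟩

end

end SimplicialPresheaf

end

theorem lemma2p4 {T : Type u} [Category.{v} T] [EssentiallySmall.{w} T]
    (J : GrothendieckTopology T) [GrothendieckTopology.HasEnoughPoints.{w} J]
    {X Y Z : SPre.{w} T} (f : X ⟶ Z) (g : Y ⟶ Z) :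
    (∀ (Ef : (projectiveAcyclicCofibrations T).MapFactorizationData (projectiveFibrations T) f)
       (Eg : (projectiveAcyclicCofibrations T).MapFactorizationData (projectiveFibrations T) g)
       (Lf : (localProjectiveAcyclicCofibrations J).MapFactorizationData
          (localProjectiveFibrations J) f)
       (Lg : (localProjectiveAcyclicCofibrations J).MapFactorizationData
          (localProjectiveFibrations J) g),
       Nonempty (FactorizationMap Ef Lf) ∧ Nonempty (FactorizationMap Eg Lg) ∧
       ∀ (a : FactorizationMap Ef Lf) (b : FactorizationMap Eg Lg),
         stalkwiseWeakEquivalences J (homotopyPullbackMap a b)) ∧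
    (∀ (Ef : (injectiveAcyclicCofibrations T).MapFactorizationData (injectiveFibrations T) f)
       (Eg : (injectiveAcyclicCofibrations T).MapFactorizationData (injectiveFibrations T) g)
       (Lf : (localInjectiveAcyclicCofibrations J).MapFactorizationData
          (localInjectiveFibrations J) f)
       (Lg : (localInjectiveAcyclicCofibrations J).MapFactorizationData
          (localInjectiveFibrations J) g),
       Nonempty (FactorizationMap Ef Lf) ∧ Nonempty (FactorizationMap Eg Lg) ∧
       ∀ (a : FactorizationMap Ef Lf) (b : FactorizationMap Eg Lg),
         stalkwiseWeakEquivalences J (homotopyPullbackMap a b)) := by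
  have hp := projectiveAcyclicCofibrations_le_localProjectiveAcyclicCofibrations.{w} J
  have hi := injectiveAcyclicCofibrations_le_localInjectiveAcyclicCofibrations.{w} J
  have hpi := projectiveAcyclicCofibrations_le_injectiveAcyclicCofibrations.{w} (C := T)
  refine ⟨fun Ef Eg Lf Lg ↦ ⟨nonempty_factorizationMap hp le_rfl Ef Lf,
      nonempty_factorizationMap hp le_rfl Eg Lg, fun a b ↦
      stalkwiseWeakEquivalences_homotopyPullbackMap inf_le_right inf_le_right le_rfl
        (fun _ _ p h ↦ objectwise_kanFibrations_of_rlp hp p h) a b⟩,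
    fun Ef Eg Lf Lg ↦ ⟨nonempty_factorizationMap hi le_rfl Ef Lf,
      nonempty_factorizationMap hi le_rfl Eg Lg, fun a b ↦
      stalkwiseWeakEquivalences_homotopyPullbackMap inf_le_right inf_le_right
        -- In the injective case the projective acyclic cofibrations lie in the injective ones and,
        -- through them, in the local injective ones, so both kinds of fibrations are objectwise
        -- Kan.
        (fun _ _ p h ↦ objectwise_kanFibrations_of_rlp hpi p h)
        (fun _ _ p h ↦ objectwise_kanFibrations_of_rlp (hpi.trans hi) p h) a b⟩⟩
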